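/- \textbf{Setting.} Let $\mathfrak S_2$ be the Siegel upper half-plane of degree $2$. A characteristic is a pair $m=(m',m'')$ with $m',m''\in(\mathbb Z/2)^2$; it is even or odd according to the value of $m'\cdot m''\in\mathbb Z/2$. There are ten even and six odd characteristics. Lifting $m',m''$ to vectors with entries in $\{0,1\}$, put $$\theta_m(\tau,z)=\sum_{k\in\mathbb Z^2}\exp\Big(\pi i\big[{}^t(k+\tfrac{m'}2)\,\tau\,(k+\tfrac{m'}2)+2\,{}^t(k+\tfrac{m'}2)(z+\tfrac{m''}2)\big]\Big),\qquad \theta_m(\tau)=\theta_m(\tau,0).$$ Let $\chi_5=\prod_{m\ \mathrm{even}}\theta_m$. Enumerate the odd characteristics as $n^{(1)},\dots,n^{(6)}$, and for a pair $N=\{n^{(i)},n^{(j)}\}$ with $i<j$ let $D(N)(\tau)=\pi^{-2}\det\big(\partial_{z_b}\theta_{n}(\tau,0)\big)_{n=n^{(i)},n^{(j)};\ b=1,2}$; these are $15$ functions. For arbitrary distinct $n,n'$ write $D(n,n')$ for $D(\{n,n'\})$; the identities below are up to sign. Let $C_4^-$ be the set of $4$-element sets of even characteristics in which the sum of any three elements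 is odd. Consider the polynomial ring over $\mathbb C$ in variables $X_N$ (one for each $D(N)$) and $Y_{mn}=Y_{nm}$ (one for each product $\theta_m^2\theta_n^2$, $m,n$ even, $m=n$ allowed), and let $I$ be the ideal of all relations, that is, of the polynomials that vanish identically on $\mathfrak S_2$ after $X_N\mapsto D(N)$, $Y_{mn}\mapsto\theta_m^2\theta_n^2$. Let $I_D$ and $I_\theta$ be the sets of relations that involve only the $X_N$, respectively only the $Y_{mn}$. \textbf{Proposition.} (1) For every $M\in C_4^-$ there is exactly one $N$, and for every $N$ exactly one $M\in C_4^-$, such that $$\text{(rc1)}\quad D(N)^2=\prod_{m\in M}\theta_m^2 .$$ Moreover the following relations hold, with a suitable sign in each case: (rc2) if $n_i,n_j,n_k,n_l,n_s,n_t$ are the six odd characteristics, $D(n_i,n_j)D(n_k,n_l)D(n_s,n_t)=\pm\prod_{i=1}^6\theta_{m_i}^2$ with six distinct $m_i$; (rc3) for four distinct odd characteristics, $D(n_i,n_j)D(n_j,n_k)D(n_k,n_l)D(n_l,n_i)=\pm\prod_{i=1}^8\theta_{m_i}^2$ with eight distinct $m_i$; (rc4) $D(n,n_j)D(n,n_k)D(n,n_l)D(m,n_r)D(m,n_s)=\pm\prod_{i=1}^{10}\theta_{m_i}^2$,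 where $n_j,n_k,n_l,n_r,n_s$ are the five odd characteristics other than $n$, where $m=n_j$ or $m=n$, and where the $m_i$ need not be distinct; (rc5) $D(n_i,n_j)D(n_j,n_k)D(n_k,n_i)\,D(n_l,n_r)D(n_r,n_s)D(n_s,n_l)=\pm\chi_5^2\theta_p^2\theta_q^2$ for suitable even $p,q$, where $\{n_i,n_j,n_k\}$ and $\{n_l,n_r,n_s\}$ are two triples of distinct odd characteristics that are disjoint or have exactly one element in common. Let $\mathcal R$ be the set of all polynomials $\prod X_N\mp\prod Y_{mn}$ that correspond to (rc1)--(rc5), for all ways of grouping the factors $\theta_m^2$ in pairs (for (rc5): the factors of $\chi_5^2$ in pairs, times $Y_{pq}$). (2) \emph{(Generation.)} Every relation between the $D(N)$ and the products $\theta_m^2\theta_n^2$, that is, every identity $F(D)=P(\theta_m^2\theta_n^2)$ with $F$, $P$ polynomials, is generated by (rc1)--(rc5) up to the relations among the $D(N)$ alone and among the $\theta_m^2\theta_n^2$ alone: $F(X)-P(Y)$ belongs to the ideal generated by $\mathcal R\cup I_D\cup I_\theta$. If $F$ is a monomial, that is, if the relation is $\prod_iD(N_i)=P(\theta_m^2\theta_n^2)$,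 with any number of factors, then it belongs to the ideal generated by $\mathcal R\cup I_\theta$; in particular products of more than six determinants give nothing new. (3) For every relation $G\in I$, of any form, there is a monomial $\mu$ in the $X_N$ such that $\mu\,G$ belongs to the ideal generated by $\mathcal R\cup I_\theta$. (4) \emph{(Independence.)} No element of $\mathcal R$ belongs to the ideal generated by $I_\theta$ and by the elements of $\mathcal R$ with a different left-hand side $\prod D(N)$. -/

import Mathlib

open MvPolynomial

noncomputable section

namespace ThetaGenusTwo

/-! ### Characteristics -/

/-- Characteristics of genus two: pairs `(m', m'')` of vectors over `ℤ/2`. -/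
abbrev Characteristic : Type := (Fin 2 → ZMod 2) × (Fin 2 → ZMod 2)

/-- `m` is even when `m' · m'' = 0` modulo two. -/
def IsEven (m : Characteristic) : Prop := m.1 0 * m.2 0 + m.1 1 * m.2 1 = 0

/-- `m` is odd when `m' · m'' = 1` modulo two. -/
def IsOdd (m : Characteristic) : Prop := m.1 0 * m.2 0 + m.1 1 * m.2 1 = 1

instance (m : Characteristic) : Decidable (IsEven m) := by unfold IsEven; infer_instance

instance (m : Characteristic) : Decidable (IsOdd m) := by unfold IsOdd; infer_instance

/-- The ten even characteristics. -/
abbrev EvenChar : Type := {m : Characteristic // IsEven m}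

/-- The enumeration `n⁽¹⁾, …, n⁽⁶⁾` of the odd characteristics. -/
def oddChar : Fin 6 → Characteristic :=
  ![(![0, 1], ![0, 1]), (![1, 0], ![1, 0]), (![0, 1], ![1, 1]),
    (![1, 0], ![1, 1]), (![1, 1], ![0, 1]), (![1, 1], ![1, 0])]

theorem oddChar_injective : Function.Injective oddChar := by
  unfold Function.Injective; decide

theorem isOdd_iff_mem_range (m : Characteristic) : IsOdd m ↔ ∃ i, oddChar i = m := by
  revert m; decide

/-- The set `C₄⁻`: four-element sets of even characteristics in which the sum of any three
distinct elements is odd. -/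
def C4Minus : Set (Finset EvenChar) :=
  {M | M.card = 4 ∧ ∀ T ⊆ M, T.card = 3 → IsOdd (∑ m ∈ T, (m : Characteristic))}

/-! ### Theta functions and Jacobian determinants -/

/-- The Siegel upper half-plane of degree two. -/
def SiegelHalfPlane : Type :=
  {τ : Matrix (Fin 2) (Fin 2) ℂ // τ.IsSymm ∧ (τ.map Complex.im).PosDef}

/-- The vector `k + m'/2`, where `m'` is lifted to a vector with entries in `{0, 1}`. -/
def shift (m : Characteristic) (k : Fin 2 → ℤ) : Fin 2 → ℂ :=
  fun i => (k i : ℂ) + ((m.1 i).val : ℂ) / 2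

/-- The Riemann theta function with characteristic `m`. -/
def theta (m : Characteristic) (τ : SiegelHalfPlane) (z : Fin 2 → ℂ) : ℂ :=
  ∑' k : Fin 2 → ℤ, Complex.exp (Real.pi * Complex.I *
    (shift m k ⬝ᵥ (τ.1.mulVec (shift m k)) +
      2 * (shift m k ⬝ᵥ fun i => z i + ((m.2 i).val : ℂ) / 2)))

/-- The theta constant with characteristic `m`. -/
def thetaConst (m : Characteristic) (τ : SiegelHalfPlane) : ℂ := theta m τ 0

/-- The partial derivative of `theta m τ` with respect to the `i`-th coordinate of `z`, at `0`. -/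
def thetaGrad (m : Characteristic) (τ : SiegelHalfPlane) (i : Fin 2) : ℂ :=
  deriv (fun w : ℂ => theta m τ (Pi.single i w)) 0

/-- The normalised Jacobian determinant of two theta functions. -/
def jacobian (n₁ n₂ : Characteristic) (τ : SiegelHalfPlane) : ℂ :=
  1 / (Real.pi : ℂ) ^ 2 *
    Matrix.det !![thetaGrad n₁ τ 0, thetaGrad n₁ τ 1; thetaGrad n₂ τ 0, thetaGrad n₂ τ 1]

/-- The fifteen unordered pairs of distinct odd characteristics, through their indices. -/
abbrev OddPair : Type := {e : Sym2 (Fin 6) // ¬ e.IsDiag}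

/-- `D(N) = D(n⁽ⁱ⁾, n⁽ʲ⁾)` for `N = {i, j}` with `i < j`. -/
def jacD (N : OddPair) : SiegelHalfPlane → ℂ :=
  jacobian (oddChar N.1.inf) (oddChar N.1.sup)

/-- The function `θ_m² θ_n²` attached to the unordered pair `{m, n}`. -/
def thetaSq : Sym2 EvenChar → SiegelHalfPlane → ℂ :=
  Sym2.lift ⟨fun m n τ => thetaConst m τ ^ 2 * thetaConst n τ ^ 2,
    fun m n => by funext τ; exact mul_comm _ _⟩

/-! ### Polynomial relations -/

/-- Polynomials in one variable for each `D(N)` and one variable for each `θ_m² θ_n²`. -/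
abbrev RelRing : Type := MvPolynomial (OddPair ⊕ Sym2 EvenChar) ℂ

/-- Substitution of the functions `D(N)` and `θ_m² θ_n²` for the variables. -/
def substitution : RelRing →ₐ[ℂ] (SiegelHalfPlane → ℂ) :=
  aeval (Sum.elim jacD thetaSq)

/-- All the polynomial relations satisfied by the `D(N)` and the `θ_m² θ_n²`. -/
def relations : Ideal RelRing := RingHom.ker substitution

/-- A polynomial in the `D(N)` alone. -/
def inD (F : MvPolynomial OddPair ℂ) : RelRing := rename Sum.inl F

/-- A polynomial in the `θ_m² θ_n²` alone. -/
def inTheta (P : MvPolynomial (Sym2 EvenChar) ℂ) : RelRing := rename Sum.inr P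

/-- The relations among the `D(N)` alone. -/
def relationsD : Set RelRing := {f | f ∈ relations ∧ ∃ F, f = inD F}

/-- The relations among the `θ_m² θ_n²` alone. -/
def relationsTheta : Set RelRing := {f | f ∈ relations ∧ ∃ P, f = inTheta P}

/-- The monomial `∏ D(N)` over a multiset of pairs. -/
def monD (s : Multiset OddPair) : RelRing := (s.map fun N => X (Sum.inl N)).prod

/-- The monomial `∏ θ_m² θ_n²` over a multiset of pairs `{m, n}`. -/
def monTheta (t : Multiset (Sym2 EvenChar)) : RelRing := (t.map fun p => X (Sum.inr p)).prod

/-- The binomial `∏ D(N) - ε ∏ θ_m² θ_n²` with a sign `ε`. -/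
def binomial (s : Multiset OddPair) (ε : ℤˣ) (t : Multiset (Sym2 EvenChar)) : RelRing :=
  monD s - C ((ε : ℤ) : ℂ) * monTheta t

/-- `s` is the multiset `{N, N}`. -/
def IsSquare (s : Multiset OddPair) : Prop := ∃ N, s = {N, N}

/-- `D(n_i,n_j) D(n_k,n_l) D(n_s,n_t)`, the six indices being distinct. -/
def IsProduct3 (s : Multiset OddPair) : Prop :=
  ∃ f : Equiv.Perm (Fin 6),
    s.map Subtype.val = {s(f 0, f 1), s(f 2, f 3), s(f 4, f 5)}

/-- `D(n_i,n_j) D(n_j,n_k) D(n_k,n_l) D(n_l,n_i)`, the four indices being distinct. -/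
def IsProduct4 (s : Multiset OddPair) : Prop :=
  ∃ f : Equiv.Perm (Fin 6),
    s.map Subtype.val = {s(f 0, f 1), s(f 1, f 2), s(f 2, f 3), s(f 3, f 0)}

/-- `D(n,n_j) D(n,n_k) D(n,n_l) D(m,n_r) D(m,n_s)`, where `n_j, n_k, n_l, n_r, n_s` are the five
odd characteristics other than `n`, and `m` is either `n_j` or `n` itself. -/
def IsProduct5 (s : Multiset OddPair) : Prop :=
  ∃ f : Equiv.Perm (Fin 6), ∃ m : Fin 6, (m = f 1 ∨ m = f 0) ∧
    s.map Subtype.val = {s(f 0, f 1), s(f 0, f 2), s(f 0, f 3), s(m, f 4), s(m, f 5)}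

/-- `D(n_i,n_j) D(n_j,n_k) D(n_k,n_i) D(n_l,n_r) D(n_r,n_s) D(n_s,n_l)`: two triangles of distinct
pairs, either with no common characteristic or with exactly one. -/
def IsProduct6 (s : Multiset OddPair) : Prop :=
  ∃ f : Equiv.Perm (Fin 6), ∃ c : Fin 6, (c = f 5 ∨ c = f 0) ∧
    s.map Subtype.val = {s(f 0, f 1), s(f 1, f 2), s(f 2, f 0),
      s(f 3, f 4), s(f 4, c), s(c, f 3)}

/-- `D(M)² = θ_a² θ_b² θ_c² θ_d²` with `M = {a, b, c, d}` in `C₄⁻`. -/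
def rc1 (s : Multiset OddPair) : Set RelRing :=
  {g | g ∈ relations ∧ IsSquare s ∧ ∃ a b c d : EvenChar,
    ({a, b, c, d} : Finset EvenChar) ∈ C4Minus ∧ g = binomial s 1 {s(a, b), s(c, d)}}

/-- Products of three determinants equal, up to sign, to a product of six distinct `θ_m²`. -/
def rc2 (s : Multiset OddPair) : Set RelRing :=
  {g | g ∈ relations ∧ IsProduct3 s ∧ ∃ (ε : ℤˣ) (a : Fin 6 → EvenChar), Function.Injective a ∧
    g = binomial s ε {s(a 0, a 1), s(a 2, a 3), s(a 4, a 5)}}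

/-- Products of four determinants equal, up to sign, to a product of eight distinct `θ_m²`. -/
def rc3 (s : Multiset OddPair) : Set RelRing :=
  {g | g ∈ relations ∧ IsProduct4 s ∧ ∃ (ε : ℤˣ) (a : Fin 8 → EvenChar), Function.Injective a ∧
    g = binomial s ε {s(a 0, a 1), s(a 2, a 3), s(a 4, a 5), s(a 6, a 7)}}

/-- Products of five determinants equal, up to sign, to a product of ten `θ_m²`, with possible
repetitions. -/
def rc4 (s : Multiset OddPair) : Set RelRing :=
  {g | g ∈ relations ∧ IsProduct5 s ∧ ∃ (ε : ℤˣ) (a : Fin 10 → EvenChar),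
    g = binomial s ε {s(a 0, a 1), s(a 2, a 3), s(a 4, a 5), s(a 6, a 7), s(a 8, a 9)}}

/-- Products of six determinants equal, up to sign, to `χ₅² θ_m² θ_n²`, where `χ₅` is the product
of the ten theta constants, each of them occurring exactly once among `a 0, …, a 9`. -/
def rc5 (s : Multiset OddPair) : Set RelRing :=
  {g | g ∈ relations ∧ IsProduct6 s ∧ ∃ (ε : ℤˣ) (a : Fin 10 → EvenChar) (m n : EvenChar),
    Function.Bijective a ∧
    g = binomial s ε
      {s(a 0, a 1), s(a 2, a 3), s(a 4, a 5), s(a 6, a 7), s(a 8, a 9), s(m, n)}}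

/-- The relations of the system whose left-hand side is `∏ D(N)`, the product over `s`. -/
def rcAt (s : Multiset OddPair) : Set RelRing := rc1 s ∪ rc2 s ∪ rc3 s ∪ rc4 s ∪ rc5 s

/-- The whole system of relations. -/
def rcSystem : Set RelRing := ⋃ s, rcAt s

end ThetaGenusTwo

end

open MvPolynomial

noncomputable section

namespace ThetaGenusTwo

/-! Everything rests on Rosenhain's formula (`rosenhain`): up to sign, the Jacobian of `n_i`, `n_j`
is the product of the four even theta constants with characteristics `n_i + n_j + n_l`, `l ≠ i, j`.
It is proved by doubling `τ`. By the addition formula, a Jacobian at `τ` times two even theta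
constants is an explicit factor times a Jacobian at `2τ` for another pair, and the fourfold products
satisfy the same identity up to sign (`Link`). One pair is linked to itself, so for it the two sides
of Rosenhain's formula are in a ratio invariant under `τ ↦ 4τ`, and the limit at the boundary
evaluates it (`jac_two_three_imag`). The identity principle, applied on complex lines only, extends
the formula to the whole half-plane, and the remaining links carry it to all fifteen pairs.

Monomials in the `D(N)` are multigraphs on six vertices, the odd characteristics. Even
characteristics are the partitions of the vertices into two triples, and a theta constant occurs in
`D(N)` exactly when its partition does not separate the two ends of `N`. Counting partitions gives
the right-hand sides of the system (`prod_jacD`).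

For generation, five automorphisms of the half-plane change each theta constant by a sign. They fix
all `θ_m² θ_n²` and act on a monomial in the `D(N)` by a sign character. If the character is
trivial, every vertex is missed by an even number of edges (`evenMissing_of_multExp`), and a
nonempty multigraph of this kind contains a double edge or one of six graphs, precisely the
left-hand sides of the system (`exists_le_isListed`). Stripping these off turns an invariant
monomial into a polynomial in the `θ_m² θ_n²` modulo the system (`exists_sub_inTheta_mem`), so an
invariant relation reduces to one among the `θ_m² θ_n²`. A general relation splits into components
for the sign characters, each again a relation. In `F(D) - P` a component with nontrivial character
involves the `D(N)` alone; for an arbitrary relation a suitable monomial factor makes every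
component invariant.

For independence, go to a cusp, where all `D(N)` tend to zero. Specialising the `θ_m² θ_n²` to their
limits kills the relations among them and leaves only the left-hand monomial of each member of the
system. The listed multigraphs are minimal (`IsListed.eq_of_le`), so none of these monomials is
divisible by another. -/

/-! ### Theta series in coordinates and their absolute convergence -/

/-- A point of the Siegel upper half-plane in coordinates: `τ = [[p, q], [q, r]]`. -/
def InSiegel (p q r : ℂ) : Prop := 0 < p.im ∧ q.im ^ 2 < p.im * r.im

/-- The entry `k + a/2` of a shifted lattice vector. -/
def half (a : ZMod 2) (k : ℤ) : ℝ := (k : ℝ) + (a.val : ℝ) / 2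

/-- The factor `exp (π i (k + a/2) b)`. -/
def phase (a b : ZMod 2) (k : ℤ) : ℂ := Complex.I ^ ((2 * k + (a.val : ℤ)) * (b.val : ℤ))

/-- The terms of a theta series with a weight `w` depending on the lattice vector. -/
def serTerm (w : ℝ → ℝ → ℝ) (m : Characteristic) (p q r : ℂ) (k : ℤ × ℤ) : ℂ :=
  (w (half (m.1 0) k.1) (half (m.1 1) k.2) : ℂ) *
    (Complex.exp (Real.pi * Complex.I * (p * half (m.1 0) k.1 ^ 2 +
      2 * q * half (m.1 0) k.1 * half (m.1 1) k.2 + r * half (m.1 1) k.2 ^ 2)) *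
    (phase (m.1 0) (m.2 0) k.1 * phase (m.1 1) (m.2 1) k.2))

/-- A theta series with a weight `w` depending on the lattice vector. -/
def ser (w : ℝ → ℝ → ℝ) (m : Characteristic) (p q r : ℂ) : ℂ := ∑' k, serTerm w m p q r k

/-- Weights of at most exponential growth. -/
def Mild (w : ℝ → ℝ → ℝ) : Prop := ∀ x y, |w x y| ≤ Real.exp (|x| + |y|)

theorem mild_one : Mild fun _ _ => 1 := fun x y => by
  rw [abs_one]; exact Real.one_le_exp (by positivity)

theorem mild_fst : Mild fun x _ => x := fun x y => by
  have := Real.add_one_le_exp (|x| + |y|)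
  linarith [abs_nonneg y]

theorem mild_snd : Mild fun _ y => y := fun x y => by
  have := Real.add_one_le_exp (|x| + |y|)
  linarith [abs_nonneg x]

theorem norm_phase (a b : ZMod 2) (k : ℤ) : ‖phase a b k‖ = 1 := by
  simp [phase, norm_zpow]

theorem summable_exp_abs {δ : ℝ} (hδ : 0 < δ) : Summable fun k : ℤ => Real.exp (-δ * |(k : ℝ)|) := by
  have h : Summable fun n : ℕ => Real.exp (-δ * (n : ℝ)) := by
    have := Real.summable_exp_nat_mul_iff (a := -δ)
    simpa [mul_comm] using this.2 (by linarith)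
  refine Summable.of_nat_of_neg (by simpa using h) (by simpa using h)

theorem summable_gauss_half {δ : ℝ} (hδ : 0 < δ) (R : ℝ) (a : ZMod 2) :
    Summable fun k : ℤ => Real.exp (R * |half a k| - δ * half a k ^ 2) := by
  have h := (summable_exp_abs hδ).mul_left (Real.exp ((R + δ) ^ 2 / (4 * δ) + δ))
  refine Summable.of_nonneg_of_le (fun _ => (Real.exp_pos _).le) (fun k => ?_) h
  rw [← Real.exp_add]
  apply Real.exp_le_exp.2
  have h1 : |(k : ℝ)| ≤ |half a k| + 1 := by
    have : (k : ℝ) = half a k - (a.val : ℝ) / 2 := by simp [half]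
    have h2 : (a.val : ℝ) ≤ 1 := by
      have := ZMod.val_lt a
      exact_mod_cast Nat.lt_succ_iff.1 this
    have h3 : (0 : ℝ) ≤ a.val := by positivity
    rw [abs_le]
    constructor <;> cases abs_cases (half a k) <;> linarith
  set x := |half a k|
  have h4 : half a k ^ 2 = x ^ 2 := (sq_abs _).symm
  -- The maximum of the quadratic in `x`; this absorbs the linear growth into a constant and leaves
  -- decay `exp (-δ x)`.
  have h5 : (R + δ) * x - δ * x ^ 2 ≤ (R + δ) ^ 2 / (4 * δ) := by
    rw [le_div_iff₀ (by linarith)]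
    nlinarith [sq_nonneg (2 * δ * x - (R + δ))]
  rw [h4]
  nlinarith

/-- The dominating series. -/
theorem summable_gauss {δ : ℝ} (hδ : 0 < δ) (R : ℝ) (a b : ZMod 2) :
    Summable fun k : ℤ × ℤ => Real.exp (R * (|half a k.1| + |half b k.2|) -
      δ * (half a k.1 ^ 2 + half b k.2 ^ 2)) := by
  have := (summable_gauss_half hδ R a).mul_of_nonneg (summable_gauss_half hδ R b)
    (fun _ => (Real.exp_pos _).le) (fun _ => (Real.exp_pos _).le)
  refine this.congr fun k => ?_
  rw [← Real.exp_add]; congr 1; ring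

/-- A lower bound for the smallest eigenvalue of the imaginary part. -/
def eigBound (p q r : ℂ) : ℝ := (p.im * r.im - q.im ^ 2) / (p.im + r.im)

theorem InSiegel.pos_right {p q r : ℂ} (h : InSiegel p q r) : 0 < r.im := by
  have := h.1; have := h.2; by_contra hn
  nlinarith [sq_nonneg q.im]

theorem InSiegel.eigBound_pos {p q r : ℂ} (h : InSiegel p q r) : 0 < eigBound p q r := by
  have := h.1; have := h.2; have := h.pos_right
  unfold eigBound; apply div_pos <;> linarith

/-- The bound is determinant over trace. By Cayley–Hamilton, trace times the form minus determinant
times the squared norm of a vector `v` is the squared norm of `Y v`, with `Y` the imaginary part;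
this is the sum of the two squares supplied below. -/
theorem InSiegel.eigBound_le {p q r : ℂ} (h : InSiegel p q r) (x y : ℝ) :
    eigBound p q r * (x ^ 2 + y ^ 2) ≤ p.im * x ^ 2 + 2 * q.im * x * y + r.im * y ^ 2 := by
  have h1 := h.1; have h2 := h.pos_right
  unfold eigBound
  rw [div_mul_eq_mul_div, div_le_iff₀ (by linarith)]
  nlinarith [sq_nonneg (p.im * x + q.im * y), sq_nonneg (q.im * x + r.im * y)]

theorem norm_exp_quad (p q r : ℂ) (x y : ℝ) :
    ‖Complex.exp (Real.pi * Complex.I * (p * x ^ 2 + 2 * q * x * y + r * y ^ 2))‖ =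
      Real.exp (-Real.pi * (p.im * x ^ 2 + 2 * q.im * x * y + r.im * y ^ 2)) := by
  rw [Complex.norm_exp]
  congr 1
  have : Real.pi * Complex.I * (p * x ^ 2 + 2 * q * x * y + r * y ^ 2) =
      Complex.I * (((Real.pi * x ^ 2 : ℝ) : ℂ) * p + ((Real.pi * 2 * x * y : ℝ) : ℂ) * q +
        ((Real.pi * y ^ 2 : ℝ) : ℂ) * r) := by push_cast; ring
  rw [this, Complex.I_mul_re]
  simp only [Complex.add_im, Complex.im_ofReal_mul]
  ring

/-- The point enters only through a lower bound `c` for its imaginary part, so one majorant serves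
all points admitting the same `c`. -/
theorem norm_serTerm_le {w : ℝ → ℝ → ℝ} (hw : Mild w) (m : Characteristic) {p q r : ℂ}
    {c : ℝ} (hc : ∀ x y : ℝ, c * (x ^ 2 + y ^ 2) ≤
      p.im * x ^ 2 + 2 * q.im * x * y + r.im * y ^ 2) (k : ℤ × ℤ) :
    ‖serTerm w m p q r k‖ ≤ Real.exp (1 * (|half (m.1 0) k.1| + |half (m.1 1) k.2|) -
      (Real.pi * c) * (half (m.1 0) k.1 ^ 2 + half (m.1 1) k.2 ^ 2)) := by
  unfold serTerm
  rw [norm_mul, norm_mul, norm_mul, norm_phase, norm_phase, norm_exp_quad, mul_one, mul_one,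
    Complex.norm_real, Real.norm_eq_abs, sub_eq_add_neg, Real.exp_add, one_mul]
  refine mul_le_mul (hw _ _) ?_ (Real.exp_pos _).le (Real.exp_pos _).le
  apply Real.exp_le_exp.2
  have := hc (half (m.1 0) k.1) (half (m.1 1) k.2)
  nlinarith [Real.pi_pos]

theorem summable_norm_serTerm {w : ℝ → ℝ → ℝ} (hw : Mild w) (m : Characteristic) {p q r : ℂ}
    (h : InSiegel p q r) : Summable fun k => ‖serTerm w m p q r k‖ :=
  Summable.of_nonneg_of_le (fun _ => norm_nonneg _) (norm_serTerm_le hw m h.eigBound_le)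
    (summable_gauss (mul_pos Real.pi_pos h.eigBound_pos) 1 _ _)

theorem summable_serTerm {w : ℝ → ℝ → ℝ} (hw : Mild w) (m : Characteristic) {p q r : ℂ}
    (h : InSiegel p q r) : Summable (serTerm w m p q r) :=
  (summable_norm_serTerm hw m h).of_norm

/-! ### Holomorphy along complex lines -/

/-- The functions whose restrictions to complex lines in the half-plane are holomorphic. -/
def LineHol (F : ℂ → ℂ → ℂ → ℂ) : Prop := ∀ p q r p' q' r' : ℂ,
  DifferentiableOn ℂ (fun s => F (p + s * p') (q + s * q') (r + s * r'))
    {s | InSiegel (p + s * p') (q + s * q') (r + s * r')}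

theorem isOpen_line (p q r p' q' r' : ℂ) :
    IsOpen {s : ℂ | InSiegel (p + s * p') (q + s * q') (r + s * r')} := by
  unfold InSiegel
  have h1 : IsOpen {s : ℂ | 0 < (p + s * p').im} := isOpen_lt continuous_const (by fun_prop)
  have h2 : IsOpen {s : ℂ | (q + s * q').im ^ 2 < (p + s * p').im * (r + s * r').im} :=
    isOpen_lt (by fun_prop) (by fun_prop)
  exact h1.inter h2

/-- Convexity provides the connectedness required by the identity principle. It comes down to the
mixed inequality `2 Q Q' ≤ P R' + P' R`, an instance of the inequality of arithmetic and geometric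
means. -/
theorem convex_line (p q r p' q' r' : ℂ) :
    Convex ℝ {s : ℂ | InSiegel (p + s * p') (q + s * q') (r + s * r')} := by
  intro s hs t ht a b ha hb hab
  have key : ∀ z z' : ℂ, (z + (a • s + b • t) * z').im = a * (z + s * z').im + b * (z + t * z').im := by
    intro z z'
    have h1 : z.im = (a + b) * z.im := by rw [hab, one_mul]
    simp only [Complex.add_im, Complex.mul_im, Complex.real_smul, Complex.add_re, Complex.mul_re,
      Complex.ofReal_re, Complex.ofReal_im]
    linear_combination h1
  simp only [Set.mem_ofPred_eq, InSiegel] at *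
  have hs' := InSiegel.pos_right hs
  have ht' := InSiegel.pos_right ht
  obtain ⟨h1, h2⟩ := hs
  obtain ⟨h3, h4⟩ := ht
  rw [key, key, key]
  generalize (p + s * p').im = P at *
  generalize (q + s * q').im = Q at *
  generalize (r + s * r').im = R at *
  generalize (p + t * p').im = P' at *
  generalize (q + t * q').im = Q' at *
  generalize (r + t * r').im = R' at *
  have hcross : 2 * (Q * Q') ≤ P * R' + P' * R := by
    have h5 : (Q * Q') ^ 2 ≤ (P * R) * (P' * R') := by
      rw [mul_pow]; exact mul_le_mul h2.le h4.le (sq_nonneg _) (by positivity)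
    have h6 : (2 * (Q * Q')) ^ 2 ≤ (P * R' + P' * R) ^ 2 := by
      nlinarith [sq_nonneg (P * R' - P' * R)]
    exact abs_le_of_sq_le_sq' h6 (by positivity) |>.2
  rcases ha.eq_or_lt with rfl | ha
  · obtain rfl : b = 1 := by linarith
    constructor <;> linarith
  · constructor
    · have := mul_pos ha h1
      have := mul_nonneg hb h3.le
      linarith
    · have e1 := mul_lt_mul_of_pos_left h2 (mul_pos ha ha)
      have e2 := mul_le_mul_of_nonneg_left h4.le (mul_nonneg hb hb)
      have e3 := mul_le_mul_of_nonneg_left hcross (mul_nonneg ha.le hb)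
      nlinarith

theorem lineHol_const (c : ℂ) : LineHol fun _ _ _ => c := fun _ _ _ _ _ _ =>
  differentiableOn_const c

theorem LineHol.mul {F G : ℂ → ℂ → ℂ → ℂ} (hF : LineHol F) (hG : LineHol G) :
    LineHol fun p q r => F p q r * G p q r := fun p q r p' q' r' =>
  (hF p q r p' q' r').mul (hG p q r p' q' r')

theorem LineHol.sub {F G : ℂ → ℂ → ℂ → ℂ} (hF : LineHol F) (hG : LineHol G) :
    LineHol fun p q r => F p q r - G p q r := fun p q r p' q' r' =>
  (hF p q r p' q' r').sub (hG p q r p' q' r')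

theorem LineHol.add {F G : ℂ → ℂ → ℂ → ℂ} (hF : LineHol F) (hG : LineHol G) :
    LineHol fun p q r => F p q r + G p q r := fun p q r p' q' r' =>
  (hF p q r p' q' r').add (hG p q r p' q' r')

/-- Near a point of the line the eigenvalue bound exceeds half its value there, which gives a single
summable Gaussian majorant for all nearby terms. -/
theorem lineHol_ser {w : ℝ → ℝ → ℝ} (hw : Mild w) (m : Characteristic) : LineHol (ser w m) := by
  intro p q r p' q' r' s₀ hs₀
  set c := eigBound (p + s₀ * p') (q + s₀ * q') (r + s₀ * r') with hc
  have hcpos : 0 < c := hs₀.eigBound_pos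
  set U := {s : ℂ | InSiegel (p + s * p') (q + s * q') (r + s * r')} with hU
  have hcont : ContinuousAt (fun s => eigBound (p + s * p') (q + s * q') (r + s * r')) s₀ := by
    unfold eigBound
    have h1 := hs₀.1
    have h2 := InSiegel.pos_right hs₀
    refine ContinuousAt.div (by fun_prop) (by fun_prop) (by linarith)
  have hev : ∀ᶠ s in nhds s₀, c / 2 < eigBound (p + s * p') (q + s * q') (r + s * r') :=
    hcont.eventually (lt_mem_nhds (by linarith))
  obtain ⟨V, hV, hVo, hsV⟩ := mem_nhds_iff.1
    (Filter.inter_mem hev ((isOpen_line p q r p' q' r').mem_nhds hs₀))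
  refine DifferentiableAt.differentiableWithinAt (DifferentiableOn.differentiableAt (s := V) ?_
    (hVo.mem_nhds hsV))
  refine Complex.differentiableOn_tsum_of_summable_norm
    (summable_gauss (mul_pos Real.pi_pos (half_pos hcpos)) 1 (m.1 0) (m.1 1)) ?_ hVo ?_
  · intro k
    unfold serTerm
    fun_prop
  · intro k s hs
    obtain ⟨h1, h2⟩ := hV hs
    refine norm_serTerm_le hw m (fun x y => ?_) k
    refine le_trans ?_ (InSiegel.eigBound_le h2 x y)
    exact mul_le_mul_of_nonneg_right (le_of_lt h1) (by positivity)

/-- Identity principle along a complex line. -/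
theorem LineHol.eq_zero_of_frequently {F : ℂ → ℂ → ℂ → ℂ} (hF : LineHol F)
    {p q r p' q' r' : ℂ} (h0 : InSiegel p q r) (h1 : InSiegel (p + p') (q + q') (r + r'))
    (hfr : ∃ᶠ s in nhdsWithin (0 : ℂ) {0}ᶜ, F (p + s * p') (q + s * q') (r + s * r') = 0) :
    F (p + p') (q + q') (r + r') = 0 := by
  have := ((hF p q r p' q' r').analyticOnNhd
    (isOpen_line p q r p' q' r')).eqOn_zero_of_preconnected_of_frequently_eq_zero
    (convex_line p q r p' q' r').isPreconnected (z₀ := 0) (by simpa using h0) hfr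
  simpa using this (x := 1) (by simpa using h1)

/-- A holomorphic factor that does not vanish identically can be cancelled. -/
theorem LineHol.eq_zero_of_mul {F H : ℂ → ℂ → ℂ → ℂ} (hF : LineHol F) (hH : LineHol H)
    (h : ∀ p q r, InSiegel p q r → F p q r * H p q r = 0) {p₀ q₀ r₀ : ℂ}
    (h₀ : InSiegel p₀ q₀ r₀) (hne : H p₀ q₀ r₀ ≠ 0) {p q r : ℂ} (hpqr : InSiegel p q r) :
    F p q r = 0 := by
  have hopen := isOpen_line p₀ q₀ r₀ (p - p₀) (q - q₀) (r - r₀)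
  have h0mem : (0 : ℂ) ∈ {s : ℂ | InSiegel (p₀ + s * (p - p₀)) (q₀ + s * (q - q₀))
      (r₀ + s * (r - r₀))} := by simpa using h₀
  have hcont : ContinuousAt (fun s : ℂ => H (p₀ + s * (p - p₀)) (q₀ + s * (q - q₀))
      (r₀ + s * (r - r₀))) 0 :=
    ((hH p₀ q₀ r₀ (p - p₀) (q - q₀) (r - r₀)).differentiableAt (hopen.mem_nhds h0mem)).continuousAt
  have hev := hcont.eventually_ne (y := 0) (by simpa using hne)
  have hz : ∀ᶠ s in nhds (0 : ℂ), F (p₀ + s * (p - p₀)) (q₀ + s * (q - q₀))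
      (r₀ + s * (r - r₀)) = 0 := by
    filter_upwards [hev, hopen.mem_nhds h0mem] with s hs1 hs2
    exact (mul_eq_zero.1 (h _ _ _ hs2)).resolve_right hs1
  have := hF.eq_zero_of_frequently h₀ (p' := p - p₀) (q' := q - q₀) (r' := r - r₀)
    (by simpa using hpqr) (hz.filter_mono nhdsWithin_le_nhds).frequently
  simpa using this

/-! ### Theta constants and gradients as series -/

theorem phase_eq_exp (a b : ZMod 2) (k : ℤ) :
    phase a b k = Complex.exp (Real.pi * Complex.I * (2 * (half a k * ((b.val : ℂ) / 2)))) := by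
  unfold phase half
  conv_lhs => rw [← Complex.exp_pi_div_two_mul_I, ← Complex.exp_int_mul]
  congr 1
  push_cast
  ring

theorem siegel_coords (τ : SiegelHalfPlane) : InSiegel (τ.1 0 0) (τ.1 0 1) (τ.1 1 1) := by
  obtain ⟨τ, hs, hp⟩ := τ
  have h10 : τ 1 0 = τ 0 1 := hs.apply 0 1
  have h := (Matrix.posDef_iff_dotProduct_mulVec.1 hp).2
  have key : ∀ x y : ℝ, (x ≠ 0 ∨ y ≠ 0) →
      0 < (τ 0 0).im * x ^ 2 + 2 * (τ 0 1).im * x * y + (τ 1 1).im * y ^ 2 := by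
    intro x y hxy
    have := h (x := ![x, y]) (by
      intro h0
      have e0 := congrFun h0 0
      have e1 := congrFun h0 1
      simp at e0 e1
      tauto)
    simp [dotProduct, Matrix.mulVec, Fin.sum_univ_two, h10] at this
    linarith
  have h1 : 0 < (τ 0 0).im := by simpa using key 1 0 (by simp)
  refine ⟨h1, ?_⟩
  -- At this vector the form equals its first diagonal entry times its determinant.
  have h2 := key (-(τ 0 1).im) (τ 0 0).im (Or.inr h1.ne')
  simp only at *
  by_contra hn
  nlinarith

/-- The point of the Siegel upper half-plane with given coordinates. -/
def siegelMk (p q r : ℂ) (h : InSiegel p q r) : SiegelHalfPlane :=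
  ⟨!![p, q; q, r], by
    constructor
    · ext i j; fin_cases i <;> fin_cases j <;> rfl
    · rw [Matrix.posDef_iff_dotProduct_mulVec]
      constructor
      · ext i j; fin_cases i <;> fin_cases j <;> simp
      · intro x hx
        have hpos : 0 < x 0 ^ 2 + x 1 ^ 2 := by
          by_contra hn
          apply hx
          have h0 : x 0 = 0 := by nlinarith [sq_nonneg (x 0), sq_nonneg (x 1)]
          have h1 : x 1 = 0 := by nlinarith [sq_nonneg (x 0), sq_nonneg (x 1)]
          ext i; fin_cases i <;> simp [h0, h1]
        have := lt_of_lt_of_le (mul_pos h.eigBound_pos hpos) (h.eigBound_le (x 0) (x 1))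
        simp [dotProduct, Matrix.mulVec, Fin.sum_univ_two]
        linarith⟩

theorem theta_term (m : Characteristic) (τ : SiegelHalfPlane) (z : Fin 2 → ℂ) (k : ℤ × ℤ) :
    Complex.exp (Real.pi * Complex.I *
      (shift m ((finTwoArrowEquiv ℤ).symm k) ⬝ᵥ
          (τ.1.mulVec (shift m ((finTwoArrowEquiv ℤ).symm k))) +
        2 * (shift m ((finTwoArrowEquiv ℤ).symm k) ⬝ᵥ fun i => z i + ((m.2 i).val : ℂ) / 2))) =
    serTerm (fun _ _ => 1) m (τ.1 0 0) (τ.1 0 1) (τ.1 1 1) k *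
      Complex.exp (2 * Real.pi * Complex.I *
        (half (m.1 0) k.1 * z 0 + half (m.1 1) k.2 * z 1)) := by
  have h10 : τ.1 1 0 = τ.1 0 1 := τ.2.1.apply 0 1
  unfold serTerm
  rw [phase_eq_exp, phase_eq_exp, Complex.ofReal_one, one_mul, ← Complex.exp_add,
    ← Complex.exp_add, ← Complex.exp_add]
  congr 1
  simp only [dotProduct, Matrix.mulVec, Fin.sum_univ_two, shift, half, h10,
    finTwoArrowEquiv_symm_apply, Matrix.cons_val_zero, Matrix.cons_val_one]
  push_cast
  ring

theorem theta_eq (m : Characteristic) (τ : SiegelHalfPlane) (z : Fin 2 → ℂ) :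
    theta m τ z = ∑' k : ℤ × ℤ, serTerm (fun _ _ => 1) m (τ.1 0 0) (τ.1 0 1) (τ.1 1 1) k *
      Complex.exp (2 * Real.pi * Complex.I *
        (half (m.1 0) k.1 * z 0 + half (m.1 1) k.2 * z 1)) := by
  unfold theta
  rw [← (finTwoArrowEquiv ℤ).symm.tsum_eq]
  exact tsum_congr (theta_term m τ z)

theorem thetaConst_eq (m : Characteristic) (τ : SiegelHalfPlane) :
    thetaConst m τ = ser (fun _ _ => 1) m (τ.1 0 0) (τ.1 0 1) (τ.1 1 1) := by
  simp [thetaConst, theta_eq, ser]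

/-- The linear weights occurring in the gradient at the origin. -/
def coordWeight (i : Fin 2) : ℝ → ℝ → ℝ := ![fun x _ => x, fun _ y => y] i

theorem mild_coordWeight (i : Fin 2) : Mild (coordWeight i) := by
  fin_cases i
  · exact mild_fst
  · exact mild_snd

theorem deriv_tsum_exp {m : Characteristic} {p q r : ℂ} (h : InSiegel p q r)
    {w : ℝ → ℝ → ℝ} (hw : ∀ x y, |w x y| ≤ |x| + |y|) :
    deriv (fun t : ℂ => ∑' k : ℤ × ℤ, serTerm (fun _ _ => 1) m p q r k *
      Complex.exp (2 * Real.pi * Complex.I * (w (half (m.1 0) k.1) (half (m.1 1) k.2) * t))) 0 =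
    2 * Real.pi * Complex.I * ser w m p q r := by
  have hs := Complex.hasSum_deriv_of_summable_norm (z := (0 : ℂ)) (U := Metric.ball 0 1)
    (F := fun (k : ℤ × ℤ) (t : ℂ) => serTerm (fun _ _ => 1) m p q r k *
      Complex.exp (2 * Real.pi * Complex.I * (w (half (m.1 0) k.1) (half (m.1 1) k.2) * t)))
    -- The rate is `9 = 1 + 8`: one unit from the bound on the theta term, and eight from `2 π < 8`
    -- on the unit disc.
    (summable_gauss (mul_pos Real.pi_pos h.eigBound_pos) 9 (m.1 0) (m.1 1))
    (fun k => by fun_prop) Metric.isOpen_ball (fun k t ht => by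
      rw [norm_mul]
      set x := half (m.1 0) k.1
      set y := half (m.1 1) k.2
      have h1 := norm_serTerm_le mild_one m h.eigBound_le k
      have h2 : ‖Complex.exp (2 * Real.pi * Complex.I * (w x y * t))‖ ≤
          Real.exp (8 * (|x| + |y|)) := by
        rw [Complex.norm_exp]
        apply Real.exp_le_exp.2
        refine (Complex.re_le_norm _).trans ?_
        have ht' : ‖t‖ ≤ 1 := by simpa using (Metric.mem_ball.1 ht).le
        have hp := Real.pi_lt_four
        simp only [norm_mul, Complex.norm_ofNat, Complex.norm_real, Real.norm_eq_abs,
          Complex.norm_I, abs_of_pos Real.pi_pos, mul_one]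
        have h3 : |w x y| * ‖t‖ ≤ |x| + |y| :=
          (mul_le_of_le_one_right (abs_nonneg _) ht').trans (hw x y)
        have h4 : 0 ≤ |x| + |y| := by positivity
        nlinarith [Real.pi_pos, mul_nonneg (abs_nonneg (w x y)) (norm_nonneg t)]
      refine (mul_le_mul h1 h2 (norm_nonneg _) (Real.exp_pos _).le).trans (le_of_eq ?_)
      rw [← Real.exp_add]
      congr 1
      ring) (Metric.mem_ball_self one_pos)
  rw [← hs.tsum_eq, ser, ← tsum_mul_left]
  refine tsum_congr fun k => ?_
  have hd : HasDerivAt (fun t : ℂ => serTerm (fun _ _ => 1) m p q r k *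
      Complex.exp (2 * Real.pi * Complex.I * (w (half (m.1 0) k.1) (half (m.1 1) k.2) * t)))
      (serTerm (fun _ _ => 1) m p q r k * (Complex.exp (2 * Real.pi * Complex.I *
        (w (half (m.1 0) k.1) (half (m.1 1) k.2) * 0)) *
        (2 * Real.pi * Complex.I * (w (half (m.1 0) k.1) (half (m.1 1) k.2) * 1)))) 0 :=
    ((((hasDerivAt_id' (0 : ℂ)).const_mul _).const_mul _).cexp).const_mul _
  rw [hd.deriv]
  simp only [serTerm, mul_zero, Complex.exp_zero, Complex.ofReal_one]
  ring

theorem thetaGrad_eq (m : Characteristic) (τ : SiegelHalfPlane) (i : Fin 2) :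
    thetaGrad m τ i = 2 * Real.pi * Complex.I *
      ser (coordWeight i) m (τ.1 0 0) (τ.1 0 1) (τ.1 1 1) := by
  unfold thetaGrad
  rw [← deriv_tsum_exp (siegel_coords τ) (w := coordWeight i) (fun x y => by
    fin_cases i <;> simp [coordWeight])]
  congr 1
  funext t
  rw [theta_eq]
  fin_cases i <;> simp [coordWeight]

/-- The theta constant as a function of the coordinates. -/
def tc (m : Characteristic) (p q r : ℂ) : ℂ := ser (fun _ _ => 1) m p q r

/-- The gradient at the origin, up to the factor `2 π i`. -/
def tg (i : Fin 2) (m : Characteristic) (p q r : ℂ) : ℂ := ser (coordWeight i) m p q r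

/-- The normalised Jacobian determinant as a function of the coordinates. -/
def jac (n₁ n₂ : Characteristic) (p q r : ℂ) : ℂ :=
  -4 * (tg 0 n₁ p q r * tg 1 n₂ p q r - tg 1 n₁ p q r * tg 0 n₂ p q r)

theorem jacobian_eq (n₁ n₂ : Characteristic) (τ : SiegelHalfPlane) :
    jacobian n₁ n₂ τ = jac n₁ n₂ (τ.1 0 0) (τ.1 0 1) (τ.1 1 1) := by
  have hpi : (Real.pi : ℂ) ≠ 0 := by exact_mod_cast Real.pi_ne_zero
  unfold jacobian jac tg
  rw [Matrix.det_fin_two_of, thetaGrad_eq, thetaGrad_eq, thetaGrad_eq, thetaGrad_eq]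
  field_simp
  ring_nf
  rw [Complex.I_sq]
  ring

theorem lineHol_tc (m : Characteristic) : LineHol (tc m) := lineHol_ser mild_one m

theorem lineHol_jac (n₁ n₂ : Characteristic) : LineHol (jac n₁ n₂) :=
  (lineHol_const (-4)).mul
    (((lineHol_ser (mild_coordWeight 0) n₁).mul (lineHol_ser (mild_coordWeight 1) n₂)).sub
      ((lineHol_ser (mild_coordWeight 1) n₁).mul (lineHol_ser (mild_coordWeight 0) n₂)))

/-! ### The addition formula -/

/-- The sign `(-1)^x`. -/
def sgn (x : ZMod 2) : ℂ := (-1) ^ x.val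

/-- The lattice coordinate `k` in terms of `u`, `v` and the class `σ`. -/
def addFst (a σ : ZMod 2) (u v : ℤ) : ℤ := u + v + σ.val * (1 - a.val)

/-- The lattice coordinate `l` in terms of `u`, `v` and the class `σ`. -/
def addSnd (a σ : ZMod 2) (u v : ℤ) : ℤ := u - v - σ.val * a.val

theorem zmod_two_cases (a : ZMod 2) : a = 0 ∨ a = 1 := by revert a; decide

/-- Two vectors of the same shifted lattice are written as sum and difference of vectors shifted by
`a + σ` and `σ`. The correction terms in `addFst` and `addSnd` account for the carry when `a + σ` is
reduced modulo two. -/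
theorem half_addFst (a σ : ZMod 2) (u v : ℤ) :
    half a (addFst a σ u v) = half (a + σ) u + half σ v := by
  rcases zmod_two_cases a with rfl | rfl <;> rcases zmod_two_cases σ with rfl | rfl <;>
    simp [half, addFst, ZMod.val_one, show (1 + 1 : ZMod 2) = 0 from rfl] <;> ring

theorem half_addSnd (a σ : ZMod 2) (u v : ℤ) :
    half a (addSnd a σ u v) = half (a + σ) u - half σ v := by
  rcases zmod_two_cases a with rfl | rfl <;> rcases zmod_two_cases σ with rfl | rfl <;>
    simp [half, addSnd, ZMod.val_one, show (1 + 1 : ZMod 2) = 0 from rfl] <;> ring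

theorem phase_mul (a b b' σ : ZMod 2) (u v : ℤ) :
    phase a b (addFst a σ u v) * phase a b' (addSnd a σ u v) =
      sgn (a * b * b' + σ * b') * (phase (a + σ) (b + b') u * phase σ (b + b') v) := by
  have hI : (Complex.I : ℂ) ≠ 0 := Complex.I_ne_zero
  have h4 : ∀ n : ℤ, Complex.I ^ (4 * n) = 1 := fun n => by
    rw [zpow_mul]; simp [show (Complex.I ^ (4 : ℤ)) = 1 from by
      exact_mod_cast Complex.I_pow_four]
  have hneg : (-1 : ℂ) = Complex.I ^ (2 : ℤ) := by
    rw [show (2 : ℤ) = ((2 : ℕ) : ℤ) from rfl, zpow_natCast, Complex.I_sq]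
  have key : ∀ (e e' n : ℤ), e = e' + 4 * n → Complex.I ^ e = Complex.I ^ e' := by
    intro e e' n h
    rw [h, zpow_add₀ hI, h4, mul_one]
  have hs : ∀ x : ZMod 2, sgn x = Complex.I ^ (2 * (x.val : ℤ)) := by
    intro x
    rw [zpow_mul, ← hneg, zpow_natCast, sgn]
  rw [hs]
  unfold phase addFst addSnd
  rw [← zpow_add₀ hI, ← zpow_add₀ hI, ← zpow_add₀ hI]
  rcases zmod_two_cases a with rfl | rfl <;> rcases zmod_two_cases σ with rfl | rfl <;>
    rcases zmod_two_cases b with rfl | rfl <;> rcases zmod_two_cases b' with rfl | rfl <;>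
    simp only [ZMod.val_zero, ZMod.val_one, show (1 + 1 : ZMod 2) = 0 from rfl, add_zero, zero_add,
      mul_zero, mul_one, Nat.cast_zero, Nat.cast_one, sub_zero, sub_self]
  -- In each of the sixteen cases the exponents of `I` differ by four times one of these integers.
  all_goals first
    | rfl
    | exact key _ _ 0 (by omega)
    | exact key _ _ u (by omega)
    | exact key _ _ (-v) (by omega)
    | exact key _ _ v (by omega)
    | exact key _ _ (-v - 1) (by omega)

theorem addition_coord_injective (a : ZMod 2) {σ σ' : ZMod 2} {u v u' v' : ℤ}
    (h1 : addFst a σ u v = addFst a σ' u' v') (h2 : addSnd a σ u v = addSnd a σ' u' v') :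
    σ = σ' ∧ u = u' ∧ v = v' := by
  unfold addFst addSnd at *
  rcases zmod_two_cases a with rfl | rfl <;> rcases zmod_two_cases σ with rfl | rfl <;>
    rcases zmod_two_cases σ' with rfl | rfl <;>
    simp only [ZMod.val_zero, ZMod.val_one, Nat.cast_zero, Nat.cast_one, true_and] at * <;> omega

/-- The class `σ` is the parity of `k - l`. -/
theorem addition_coord_surjective (a : ZMod 2) (k l : ℤ) :
    ∃ σ u v, addFst a σ u v = k ∧ addSnd a σ u v = l := by
  unfold addFst addSnd
  rcases Int.even_or_odd (k - l) with ⟨c, hc⟩ | ⟨c, hc⟩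
  · exact ⟨0, l + c, c, by simp; omega, by simp⟩
  · rcases zmod_two_cases a with rfl | rfl
    · exact ⟨1, l + c, c, by simp [ZMod.val_one]; omega, by simp⟩
    · exact ⟨1, k - c, c, by rw [ZMod.val_one]; simp, by rw [ZMod.val_one]; simp; omega⟩

/-- Two lattice vectors with a common shift in terms of their half sum and half difference. -/
def additionMap (a : Fin 2 → ZMod 2) (x : (ZMod 2 × ZMod 2) × (ℤ × ℤ) × (ℤ × ℤ)) :
    (ℤ × ℤ) × (ℤ × ℤ) :=
  ((addFst (a 0) x.1.1 x.2.1.1 x.2.2.1, addFst (a 1) x.1.2 x.2.1.2 x.2.2.2),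
    (addSnd (a 0) x.1.1 x.2.1.1 x.2.2.1, addSnd (a 1) x.1.2 x.2.1.2 x.2.2.2))

theorem additionMap_bijective (a : Fin 2 → ZMod 2) : Function.Bijective (additionMap a) := by
  constructor
  · rintro ⟨⟨s1, s2⟩, ⟨u1, u2⟩, ⟨v1, v2⟩⟩ ⟨⟨t1, t2⟩, ⟨x1, x2⟩, ⟨y1, y2⟩⟩ h
    simp only [additionMap, Prod.mk.injEq] at h
    obtain ⟨⟨h1, h2⟩, h3, h4⟩ := h
    obtain ⟨rfl, rfl, rfl⟩ := addition_coord_injective _ h1 h3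
    obtain ⟨rfl, rfl, rfl⟩ := addition_coord_injective _ h2 h4
    rfl
  · rintro ⟨⟨k1, k2⟩, ⟨l1, l2⟩⟩
    obtain ⟨s1, u1, v1, h1, h2⟩ := addition_coord_surjective (a 0) k1 l1
    obtain ⟨s2, u2, v2, h3, h4⟩ := addition_coord_surjective (a 1) k2 l2
    exact ⟨((s1, s2), (u1, u2), (v1, v2)), by simp [additionMap, h1, h2, h3, h4]⟩

/-- The sign in the addition formula. -/
def addSign (a b b' : Fin 2 → ZMod 2) (σ : ZMod 2 × ZMod 2) : ℂ :=
  sgn (a 0 * b 0 * b' 0 + σ.1 * b' 0) * sgn (a 1 * b 1 * b' 1 + σ.2 * b' 1)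

theorem serTerm_eq_mul (w : ℝ → ℝ → ℝ) (m : Characteristic) (p q r : ℂ) (k : ℤ × ℤ) :
    serTerm w m p q r k = (w (half (m.1 0) k.1) (half (m.1 1) k.2) : ℂ) *
      serTerm (fun _ _ => 1) m p q r k := by
  simp [serTerm]

theorem serTerm_mul (a b b' : Fin 2 → ZMod 2) (p q r : ℂ)
    (x : (ZMod 2 × ZMod 2) × (ℤ × ℤ) × (ℤ × ℤ)) :
    serTerm (fun _ _ => 1) (a, b) p q r (additionMap a x).1 *
      serTerm (fun _ _ => 1) (a, b') p q r (additionMap a x).2 =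
    addSign a b b' x.1 * (serTerm (fun _ _ => 1) (a + ![x.1.1, x.1.2], b + b') (2 * p) (2 * q) (2 * r) x.2.1 *
      serTerm (fun _ _ => 1) (![x.1.1, x.1.2], b + b') (2 * p) (2 * q) (2 * r) x.2.2) := by
  obtain ⟨⟨s1, s2⟩, ⟨u1, u2⟩, ⟨v1, v2⟩⟩ := x
  have h0 := phase_mul (a 0) (b 0) (b' 0) s1 u1 v1
  have h1 := phase_mul (a 1) (b 1) (b' 1) s2 u2 v2
  simp only [serTerm, additionMap, addSign, half_addFst, half_addSnd, Complex.ofReal_one, one_mul,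
    Pi.add_apply, Matrix.cons_val_zero, Matrix.cons_val_one]
  rw [mul_mul_mul_comm, ← Complex.exp_add, mul_mul_mul_comm (phase _ _ _), h0, h1,
    mul_mul_mul_comm (Complex.exp _) _ (Complex.exp _), ← Complex.exp_add]
  rw [show ∀ A B C D E F G : ℂ, A * (B * (C * D) * (E * (F * G))) =
    B * E * (A * (C * F * (D * G))) from fun _ _ _ _ _ _ _ => by ring]
  congr 3
  push_cast
  ring

/-- The re-indexed summand `g` is left open so that the same rearrangement serves theta constants
and gradients. -/
theorem additionSum {a b b' : Fin 2 → ZMod 2} {p q r : ℂ} (h : InSiegel p q r)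
    {w : ℝ → ℝ → ℝ} (hw : Mild w) (g : (ZMod 2 × ZMod 2) → (ℤ × ℤ) × (ℤ × ℤ) → ℂ)
    (hg : ∀ x, serTerm (fun _ _ => 1) (a, b) p q r (additionMap a x).1 *
      serTerm w (a, b') p q r (additionMap a x).2 = g x.1 x.2) :
    tc (a, b) p q r * ser w (a, b') p q r = ∑ σ, ∑' y, g σ y := by
  have h1 := summable_norm_serTerm mild_one (a, b) h
  have h2 := summable_norm_serTerm hw (a, b') h
  have hs := summable_mul_of_summable_norm h1 h2
  unfold tc ser
  rw [tsum_mul_tsum_of_summable_norm h1 h2,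
    ← (Equiv.ofBijective _ (additionMap_bijective a)).tsum_eq]
  rw [← (Equiv.ofBijective _ (additionMap_bijective a)).summable_iff] at hs
  have hs' : Summable fun x : (ZMod 2 × ZMod 2) × (ℤ × ℤ) × (ℤ × ℤ) => g x.1 x.2 :=
    hs.congr fun x => hg x
  rw [show (∑ σ, ∑' y, g σ y) = ∑' σ, ∑' y, g σ y from (tsum_fintype _).symm, ← hs'.tsum_prod]
  exact tsum_congr fun x => hg x

theorem InSiegel.two_mul {p q r : ℂ} (h : InSiegel p q r) :
    InSiegel (2 * p) (2 * q) (2 * r) := by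
  obtain ⟨h1, h2⟩ := h
  constructor <;> simp <;> nlinarith

/-- The parallelogram law `Q(u + v) + Q(u - v) = 2 Q(u) + 2 Q(v)` separates the double series into
products of series at `2τ`. -/
theorem tc_mul_tc (a b b' : Fin 2 → ZMod 2) {p q r : ℂ} (h : InSiegel p q r) :
    tc (a, b) p q r * tc (a, b') p q r = ∑ σ : ZMod 2 × ZMod 2, addSign a b b' σ *
      (tc (a + ![σ.1, σ.2], b + b') (2 * p) (2 * q) (2 * r) *
        tc (![σ.1, σ.2], b + b') (2 * p) (2 * q) (2 * r)) := by
  rw [show tc (a, b') p q r = ser (fun _ _ => 1) (a, b') p q r from rfl,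
    additionSum h mild_one (fun σ y => addSign a b b' σ *
      (serTerm (fun _ _ => 1) (a + ![σ.1, σ.2], b + b') (2 * p) (2 * q) (2 * r) y.1 *
        serTerm (fun _ _ => 1) (![σ.1, σ.2], b + b') (2 * p) (2 * q) (2 * r) y.2))
      (fun x => serTerm_mul a b b' p q r x)]
  refine Finset.sum_congr rfl fun σ _ => ?_
  rw [tsum_mul_left]
  unfold tc ser
  rw [tsum_mul_tsum_of_summable_norm (summable_norm_serTerm mild_one _ h.two_mul)
    (summable_norm_serTerm mild_one _ h.two_mul)]

/-- The gradient weight is linear and the second vector is `u - v`, so each class contributes a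
difference of two products. -/
theorem tc_mul_tg (i : Fin 2) (a b b' : Fin 2 → ZMod 2) {p q r : ℂ} (h : InSiegel p q r) :
    tc (a, b) p q r * tg i (a, b') p q r = ∑ σ : ZMod 2 × ZMod 2, addSign a b b' σ *
      (tg i (a + ![σ.1, σ.2], b + b') (2 * p) (2 * q) (2 * r) *
        tc (![σ.1, σ.2], b + b') (2 * p) (2 * q) (2 * r) -
      tc (a + ![σ.1, σ.2], b + b') (2 * p) (2 * q) (2 * r) *
        tg i (![σ.1, σ.2], b + b') (2 * p) (2 * q) (2 * r)) := by
  have hw := mild_coordWeight i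
  rw [tg, additionSum h hw (fun σ y => addSign a b b' σ *
      (serTerm (coordWeight i) (a + ![σ.1, σ.2], b + b') (2 * p) (2 * q) (2 * r) y.1 *
        serTerm (fun _ _ => 1) (![σ.1, σ.2], b + b') (2 * p) (2 * q) (2 * r) y.2 -
      serTerm (fun _ _ => 1) (a + ![σ.1, σ.2], b + b') (2 * p) (2 * q) (2 * r) y.1 *
        serTerm (coordWeight i) (![σ.1, σ.2], b + b') (2 * p) (2 * q) (2 * r) y.2))]
  · refine Finset.sum_congr rfl fun σ _ => ?_
    have s1 := summable_norm_serTerm mild_one (a + ![σ.1, σ.2], b + b') h.two_mul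
    have s2 := summable_norm_serTerm mild_one (![σ.1, σ.2], b + b') h.two_mul
    have s3 := summable_norm_serTerm hw (a + ![σ.1, σ.2], b + b') h.two_mul
    have s4 := summable_norm_serTerm hw (![σ.1, σ.2], b + b') h.two_mul
    rw [tsum_mul_left, (summable_mul_of_summable_norm s3 s2).tsum_sub
      (summable_mul_of_summable_norm s1 s4)]
    unfold tc tg ser
    rw [tsum_mul_tsum_of_summable_norm s3 s2, tsum_mul_tsum_of_summable_norm s1 s4]
  · intro x
    rw [serTerm_eq_mul (coordWeight i) (a, b'), serTerm_eq_mul (coordWeight i) (_, b + b'),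
      serTerm_eq_mul (coordWeight i) (![_, _], b + b'), mul_left_comm, serTerm_mul]
    fin_cases i <;>
      simp [coordWeight, additionMap, half_addSnd] <;> ring

/-! ### Parity -/

theorem phase_neg (a b : ZMod 2) (k : ℤ) : phase a b (-k - a.val) = sgn (a * b) * phase a b k := by
  have hI : (Complex.I : ℂ) ≠ 0 := Complex.I_ne_zero
  have h2 : Complex.I ^ (2 : ℤ) = -1 := by
    rw [show (2 : ℤ) = ((2 : ℕ) : ℤ) from rfl, zpow_natCast, Complex.I_sq]
  unfold phase sgn
  rcases zmod_two_cases a with rfl | rfl <;> rcases zmod_two_cases b with rfl | rfl <;>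
    simp [ZMod.val_one]
  · rw [zpow_mul, h2]
    rcases Int.even_or_odd k with hk | hk <;> simp [hk.neg_one_zpow]
  · rw [show 2 * (-k - 1) + 1 = -(2 * k) - 1 by ring, zpow_sub₀ hI, zpow_add₀ hI, zpow_neg,
      zpow_mul, h2]
    rcases Int.even_or_odd k with hk | hk <;> simp [hk.neg_one_zpow]

theorem half_neg (a : ZMod 2) (k : ℤ) : half a (-k - a.val) = -half a k := by
  simp [half]; ring

/-- The involution `v ↦ -v` of the shifted lattice. -/
def negShift (m : Characteristic) : ℤ × ℤ ≃ ℤ × ℤ where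
  toFun k := (-k.1 - (m.1 0).val, -k.2 - (m.1 1).val)
  invFun k := (-k.1 - (m.1 0).val, -k.2 - (m.1 1).val)
  left_inv k := by simp
  right_inv k := by simp

/-- The shifted lattice is stable under `v ↦ -v`, and the phases change by `(-1)` to the power `m' ·
m''`. -/
theorem ser_parity (m : Characteristic) (p q r : ℂ) {w : ℝ → ℝ → ℝ} {ε : ℝ}
    (hw : ∀ x y, w (-x) (-y) = ε * w x y) :
    ser w m p q r = ε * (sgn (m.1 0 * m.2 0) * sgn (m.1 1 * m.2 1)) * ser w m p q r := by
  conv_lhs => rw [ser, ← (negShift m).tsum_eq]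
  rw [ser, ← tsum_mul_left]
  refine tsum_congr fun k => ?_
  simp only [serTerm, negShift, Equiv.coe_fn_mk, phase_neg, half_neg, hw]
  push_cast
  simp only [neg_sq, mul_neg, neg_mul, neg_neg]
  ring

theorem sgn_mul_sgn (x y : ZMod 2) : sgn x * sgn y = sgn (x + y) := by
  rcases zmod_two_cases x with rfl | rfl <;> rcases zmod_two_cases y with rfl | rfl <;>
    simp [sgn, ZMod.val_one, show (1 + 1 : ZMod 2) = 0 from rfl]

theorem tc_odd {m : Characteristic} (hm : IsOdd m) (p q r : ℂ) : tc m p q r = 0 := by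
  have h := ser_parity m p q r (w := fun _ _ => 1) (ε := 1) (fun _ _ => by simp)
  rw [sgn_mul_sgn, show m.1 0 * m.2 0 + m.1 1 * m.2 1 = 1 from hm] at h
  simp [sgn, ZMod.val_one] at h
  exact self_eq_neg.1 h

theorem tg_even {m : Characteristic} (hm : IsEven m) (i : Fin 2) (p q r : ℂ) :
    tg i m p q r = 0 := by
  have h := ser_parity m p q r (w := coordWeight i) (ε := -1) (fun _ _ => by
    fin_cases i <;> simp [coordWeight])
  rw [sgn_mul_sgn, show m.1 0 * m.2 0 + m.1 1 * m.2 1 = 0 from hm] at h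
  simp [sgn] at h
  exact self_eq_neg.1 h

section

/-! ### Jacobian determinants and the duplication of `τ` -/

/-- Pairing with `β` is zero on `0`, `α` and one on `a`, `a + α`, so these four vectors are distinct
and exhaust the plane over `ℤ/2`. -/
theorem univ_eq_of_isOdd : ∀ a α β : Fin 2 → ZMod 2, IsOdd (a, β) → IsEven (α, β) → α ≠ 0 →
    (Finset.univ : Finset (ZMod 2 × ZMod 2)) =
      {(0, 0), (α 0, α 1), (a 0, a 1), (a 0 + α 0, a 1 + α 1)} ∧
    ((0, 0) : ZMod 2 × ZMod 2) ∉
      ({(α 0, α 1), (a 0, a 1), (a 0 + α 0, a 1 + α 1)} : Finset (ZMod 2 × ZMod 2)) ∧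
    (α 0, α 1) ∉ ({(a 0, a 1), (a 0 + α 0, a 1 + α 1)} : Finset (ZMod 2 × ZMod 2)) ∧
    (a 0, a 1) ∉ ({(a 0 + α 0, a 1 + α 1)} : Finset (ZMod 2 × ZMod 2)) := by
  decide

theorem sum_eq_of_isOdd {a α β : Fin 2 → ZMod 2} (ha : IsOdd (a, β)) (hα : IsEven (α, β))
    (hα0 : α ≠ 0) (f : ZMod 2 × ZMod 2 → ℂ) :
    ∑ σ, f σ = f (0, 0) + f (α 0, α 1) + f (a 0, a 1) + f (a 0 + α 0, a 1 + α 1) := by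
  obtain ⟨h, h1, h2, h3⟩ := univ_eq_of_isOdd a α β ha hα hα0
  rw [h, Finset.sum_insert h1, Finset.sum_insert h2, Finset.sum_insert h3, Finset.sum_singleton]
  ring

theorem vec_eta (a : Fin 2 → ZMod 2) : ![a 0, a 1] = a := by
  ext i; fin_cases i <;> rfl

theorem vec_eta_add (a b : Fin 2 → ZMod 2) : ![a 0 + b 0, a 1 + b 1] = a + b := by
  ext i; fin_cases i <;> rfl

theorem vec_eta_zero : ![(0 : ZMod 2), 0] = 0 := by
  ext i; fin_cases i <;> rfl

theorem add_self_vec (a : Fin 2 → ZMod 2) : a + a = 0 := by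
  ext i; exact CharTwo.add_self_eq_zero _

/-- The sign `(-1)^(Σ x_i y_i)`. -/
def dsgn (x y : Fin 2 → ZMod 2) : ℂ := sgn (x 0 * y 0 + x 1 * y 1)

theorem addSign_eq (a b b' σ : Fin 2 → ZMod 2) :
    addSign a b b' (σ 0, σ 1) = dsgn (a * b) b' * dsgn σ b' := by
  unfold addSign dsgn
  rw [sgn_mul_sgn, sgn_mul_sgn]
  congr 1
  simp only [Pi.mul_apply]
  ring

theorem dsgn_zero (b : Fin 2 → ZMod 2) : dsgn 0 b = 1 := by simp [dsgn, sgn]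

theorem dsgn_add (a a' b : Fin 2 → ZMod 2) : dsgn (a + a') b = dsgn a b * dsgn a' b := by
  unfold dsgn
  rw [sgn_mul_sgn]
  congr 1
  simp only [Pi.add_apply]
  ring

theorem dsgn_odd {a b : Fin 2 → ZMod 2} (h : IsOdd (a, b)) : dsgn a b = -1 := by
  unfold dsgn
  rw [show a 0 * b 0 + a 1 * b 1 = 1 from h]
  simp [sgn, ZMod.val_one]

theorem dsgn_even {a b : Fin 2 → ZMod 2} (h : IsEven (a, b)) : dsgn a b = 1 := by
  unfold dsgn
  rw [show a 0 * b 0 + a 1 * b 1 = 0 from h]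
  simp [sgn]

theorem isOdd_add {a α β : Fin 2 → ZMod 2} (ha : IsOdd (a, β)) (hα : IsEven (α, β)) :
    IsOdd (a + α, β) := by
  unfold IsOdd IsEven at *
  simp only [Pi.add_apply] at *
  linear_combination ha + hα

theorem isEven_zero (β : Fin 2 → ZMod 2) : IsEven (0, β) := by simp [IsEven]

variable {p q r : ℂ}

/-- Duplication formula for the gradients of the odd theta functions. -/
theorem tc_mul_tg_odd {a α b β : Fin 2 → ZMod 2} (h : InSiegel p q r) (ha : IsOdd (a, β))
    (hα : IsEven (α, β)) (hα0 : α ≠ 0) (hb : IsOdd (a, b + β)) (i : Fin 2) :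
    tc (a, b) p q r * tg i (a, b + β) p q r = 2 * dsgn (a * b) (b + β) *
      (tg i (a, β) (2 * p) (2 * q) (2 * r) * tc (0, β) (2 * p) (2 * q) (2 * r) +
        dsgn α (b + β) * (tg i (a + α, β) (2 * p) (2 * q) (2 * r) *
          tc (α, β) (2 * p) (2 * q) (2 * r))) := by
  have e : b + (b + β) = β := by rw [← add_assoc, add_self_vec, zero_add]
  have hsum := tc_mul_tg i a b (b + β) h
  rw [sum_eq_of_isOdd ha hα hα0, e] at hsum
  have h0 := addSign_eq a b (b + β) 0
  have h1 := addSign_eq a b (b + β) α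
  have h2 := addSign_eq a b (b + β) a
  have h3 := addSign_eq a b (b + β) (a + α)
  simp only [Pi.zero_apply, Pi.add_apply] at h0 h1 h2 h3
  simp only [h0, h1, h2, h3, vec_eta, vec_eta_add, vec_eta_zero, add_zero] at hsum
  -- Parity leaves one product in each class. The classes `σ` and `a + σ` then give equal
  -- contributions, since the sign `-1` of `a` cancels the minus sign of the formula; hence the
  -- factor two.
  rw [add_self_vec, ← add_assoc, add_self_vec, zero_add, tc_odd ha, tc_odd (isOdd_add ha hα),
    tg_even hα, tg_even (isEven_zero β), dsgn_add, dsgn_odd hb, dsgn_zero] at hsum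
  rw [hsum]
  ring

/-- Duplication formula for the even theta constants. -/
theorem tc_mul_tc_even {a α b β : Fin 2 → ZMod 2} (h : InSiegel p q r) (ha : IsOdd (a, β))
    (hα : IsEven (α, β)) (hα0 : α ≠ 0) :
    tc (0, b) p q r * tc (0, b + β) p q r =
      tc (0, β) (2 * p) (2 * q) (2 * r) ^ 2 +
        dsgn α (b + β) * tc (α, β) (2 * p) (2 * q) (2 * r) ^ 2 := by
  have e : b + (b + β) = β := by rw [← add_assoc, add_self_vec, zero_add]
  have hsum := tc_mul_tc 0 b (b + β) h
  rw [sum_eq_of_isOdd ha hα hα0, e] at hsum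
  have h0 := addSign_eq 0 b (b + β) 0
  have h1 := addSign_eq 0 b (b + β) α
  have h2 := addSign_eq 0 b (b + β) a
  have h3 := addSign_eq 0 b (b + β) (a + α)
  simp only [Pi.zero_apply, Pi.add_apply] at h0 h1 h2 h3
  simp only [h0, h1, h2, h3, vec_eta, vec_eta_add, vec_eta_zero, zero_add, zero_mul] at hsum
  rw [tc_odd ha, tc_odd (isOdd_add ha hα), dsgn_zero] at hsum
  rw [hsum]
  ring

/-- Duplication formula for the even theta constants. -/
theorem tc_mul_tc_even' {a α b β : Fin 2 → ZMod 2} (h : InSiegel p q r) (ha : IsOdd (a, β))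
    (hα : IsEven (α, β)) (hα0 : α ≠ 0) (hb : IsEven (α, b + β)) :
    tc (α, b) p q r * tc (α, b + β) p q r = 2 * dsgn (α * b) (b + β) *
      (tc (0, β) (2 * p) (2 * q) (2 * r) * tc (α, β) (2 * p) (2 * q) (2 * r)) := by
  have e : b + (b + β) = β := by rw [← add_assoc, add_self_vec, zero_add]
  have hsum := tc_mul_tc α b (b + β) h
  rw [sum_eq_of_isOdd ha hα hα0, e] at hsum
  have h0 := addSign_eq α b (b + β) 0
  have h1 := addSign_eq α b (b + β) α
  have h2 := addSign_eq α b (b + β) a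
  have h3 := addSign_eq α b (b + β) (a + α)
  simp only [Pi.zero_apply, Pi.add_apply] at h0 h1 h2 h3
  simp only [h0, h1, h2, h3, vec_eta, vec_eta_add, vec_eta_zero, add_zero] at hsum
  rw [add_self_vec, tc_odd ha, tc_odd (isOdd_add ha hα), dsgn_zero, dsgn_even hb] at hsum
  rw [hsum]
  ring

/-- Duplication of a Jacobian determinant, the first halves of the characteristics agreeing. -/
theorem jac_mul_same {a α b b' β : Fin 2 → ZMod 2} (h : InSiegel p q r) (ha : IsOdd (a, β))
    (hα : IsEven (α, β)) (hα0 : α ≠ 0) (hb : IsOdd (a, b + β)) (hb' : IsOdd (a, b' + β)) :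
    jac (a, b + β) (a, b' + β) p q r * (tc (a, b) p q r * tc (a, b') p q r) =
      4 * dsgn (a * b) (b + β) * dsgn (a * b') (b' + β) *
        (dsgn α (b' + β) - dsgn α (b + β)) *
        (tc (0, β) (2 * p) (2 * q) (2 * r) * tc (α, β) (2 * p) (2 * q) (2 * r)) *
        jac (a, β) (a + α, β) (2 * p) (2 * q) (2 * r) := by
  -- Both gradients are combinations of the same two gradients at `2τ`, so the Jacobian is
  -- multiplied by the determinant of the coefficients.
  have h1 := tc_mul_tg_odd h ha hα hα0 hb
  have h2 := tc_mul_tg_odd h ha hα hα0 hb'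
  unfold jac
  calc _ = -4 * ((tc (a, b) p q r * tg 0 (a, b + β) p q r) *
        (tc (a, b') p q r * tg 1 (a, b' + β) p q r) - (tc (a, b) p q r * tg 1 (a, b + β) p q r) *
        (tc (a, b') p q r * tg 0 (a, b' + β) p q r)) := by ring
    _ = _ := by rw [h1, h1, h2, h2]; ring

/-- Duplication of a Jacobian determinant, the first halves of the characteristics being
different. -/
theorem jac_mul_diff {a α b b' β : Fin 2 → ZMod 2} (h : InSiegel p q r) (ha : IsOdd (a, β))
    (hα : IsEven (α, β)) (hα0 : α ≠ 0) (hb : IsOdd (a, b + β)) (hb' : IsOdd (a + α, b' + β)) :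
    jac (a, b + β) (a + α, b' + β) p q r * (tc (a, b) p q r * tc (a + α, b') p q r) =
      4 * dsgn (a * b) (b + β) * dsgn ((a + α) * b') (b' + β) *
        (tc (0, β) (2 * p) (2 * q) (2 * r) ^ 2 - dsgn α (b' + β) * dsgn α (b + β) *
          tc (α, β) (2 * p) (2 * q) (2 * r) ^ 2) *
        jac (a, β) (a + α, β) (2 * p) (2 * q) (2 * r) := by
  have h1 := tc_mul_tg_odd h ha hα hα0 hb
  have h2 := tc_mul_tg_odd h (isOdd_add ha hα) hα hα0 hb'
  have e : a + α + α = a := by rw [add_assoc, add_self_vec, add_zero]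
  rw [e] at h2
  unfold jac
  calc _ = -4 * ((tc (a, b) p q r * tg 0 (a, b + β) p q r) *
        (tc (a + α, b') p q r * tg 1 (a + α, b' + β) p q r) -
        (tc (a, b) p q r * tg 1 (a, b + β) p q r) *
        (tc (a + α, b') p q r * tg 0 (a + α, b' + β) p q r)) := by ring
    _ = _ := by rw [h1, h1, h2, h2]; ring

end

section

/-! ### Duplication for the fifteen pairs -/

/-- The product of the four even theta constants attached to a pair of odd characteristics. -/
def thetaProd (i j : Fin 6) (p q r : ℂ) : ℂ :=
  ∏ l, if l = i ∨ l = j then 1 else tc (oddChar i + oddChar j + oddChar l) p q r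

/-- A relation between the Jacobian determinants at `τ` and at `2 τ`, satisfied up to sign by the
corresponding products of theta constants as well. -/
def Link (i j i' j' : Fin 6) (m m' : Characteristic) (X : ℂ → ℂ → ℂ → ℂ) : Prop :=
  ∃ δ : ℤˣ, ∀ p q r, InSiegel p q r →
    jac (oddChar i) (oddChar j) p q r * (tc m p q r * tc m' p q r) =
      X (2 * p) (2 * q) (2 * r) * jac (oddChar i') (oddChar j') (2 * p) (2 * q) (2 * r) ∧
    thetaProd i j p q r * (tc m p q r * tc m' p q r) =
      ((δ : ℤ) : ℂ) * X (2 * p) (2 * q) (2 * r) * thetaProd i' j' (2 * p) (2 * q) (2 * r)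

theorem mul_congr₃ {a b c a' b' c' : ℂ} (h : a = a') (h' : b = b') (h'' : c = c') :
    a * b * c = a' * b' * c' := by rw [h, h', h'']

/-- The half of a link that concerns Jacobians is the duplication formula; what remains for each
concrete pair is the identity `hT` between theta constants. -/
theorem link_same {i j i' j' : Fin 6} {a α b b' β : Fin 2 → ZMod 2} (δ : ℤˣ)
    (e : oddChar i = (a, b + β) ∧ oddChar j = (a, b' + β) ∧ oddChar i' = (a, β) ∧
      oddChar j' = (a + α, β)) (ha : IsOdd (a, β))
    (hα : IsEven (α, β)) (hα0 : α ≠ 0) (hb : IsOdd (a, b + β)) (hb' : IsOdd (a, b' + β))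
    (hT : ∀ p q r, InSiegel p q r → thetaProd i j p q r * (tc (a, b) p q r * tc (a, b') p q r) =
      ((δ : ℤ) : ℂ) * (4 * dsgn (a * b) (b + β) * dsgn (a * b') (b' + β) *
        (dsgn α (b' + β) - dsgn α (b + β)) * (tc (0, β) (2 * p) (2 * q) (2 * r) *
          tc (α, β) (2 * p) (2 * q) (2 * r))) * thetaProd i' j' (2 * p) (2 * q) (2 * r)) :
    Link i j i' j' (a, b) (a, b') fun p q r => 4 * dsgn (a * b) (b + β) *
      dsgn (a * b') (b' + β) * (dsgn α (b' + β) - dsgn α (b + β)) *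
        (tc (0, β) p q r * tc (α, β) p q r) := by
  obtain ⟨e1, e2, e3, e4⟩ := e
  refine ⟨δ, fun p q r h => ⟨?_, hT p q r h⟩⟩
  rw [e1, e2, e3, e4]
  exact jac_mul_same h ha hα hα0 hb hb'

theorem link_diff {i j i' j' : Fin 6} {a a' α b b' β : Fin 2 → ZMod 2} (δ : ℤˣ)
    (haa : a' = a + α) (e : oddChar i = (a, b + β) ∧ oddChar j = (a', b' + β) ∧ oddChar i' = (a, β) ∧
      oddChar j' = (a', β)) (ha : IsOdd (a, β))
    (hα : IsEven (α, β)) (hα0 : α ≠ 0) (hb : IsOdd (a, b + β)) (hb' : IsOdd (a', b' + β))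
    (hT : ∀ p q r, InSiegel p q r →
      thetaProd i j p q r * (tc (a, b) p q r * tc (a', b') p q r) =
      ((δ : ℤ) : ℂ) * (4 * dsgn (a * b) (b + β) * dsgn (a' * b') (b' + β) *
        (tc (0, β) (2 * p) (2 * q) (2 * r) ^ 2 - dsgn α (b' + β) * dsgn α (b + β) *
          tc (α, β) (2 * p) (2 * q) (2 * r) ^ 2)) * thetaProd i' j' (2 * p) (2 * q) (2 * r)) :
    Link i j i' j' (a, b) (a', b') fun p q r =>
      4 * dsgn (a * b) (b + β) * dsgn (a' * b') (b' + β) *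
        (tc (0, β) p q r ^ 2 - dsgn α (b' + β) * dsgn α (b + β) * tc (α, β) p q r ^ 2) := by
  subst haa
  obtain ⟨e1, e2, e3, e4⟩ := e
  refine ⟨δ, fun p q r h => ⟨?_, hT p q r h⟩⟩
  rw [e1, e2, e3, e4]
  exact jac_mul_diff h ha hα hα0 hb hb'

variable {p q r : ℂ}

/-- These nine instances of even duplication are all that the links need: six theta constants on the
left of a link group into three pairs, each pair being the left-hand side of one instance. -/
theorem even_10 (h : InSiegel p q r) : tc (![1, 0], 0) p q r * tc (![1, 0], ![0, 1]) p q r =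
    2 * (tc (0, ![0, 1]) (2 * p) (2 * q) (2 * r) * tc (![1, 0], ![0, 1]) (2 * p) (2 * q) (2 * r)) := by
  simpa [dsgn, sgn] using tc_mul_tc_even' (a := ![0, 1]) (b := 0) h
    (by decide : IsOdd (![0, 1], ![0, 1])) (by decide : IsEven (![1, 0], ![0, 1])) (by decide) (by decide)

theorem even_01 (h : InSiegel p q r) : tc (![0, 1], 0) p q r * tc (![0, 1], ![1, 0]) p q r =
    2 * (tc (0, ![1, 0]) (2 * p) (2 * q) (2 * r) * tc (![0, 1], ![1, 0]) (2 * p) (2 * q) (2 * r)) := by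
  simpa [dsgn, sgn] using tc_mul_tc_even' (a := ![1, 0]) (b := 0) h
    (by decide : IsOdd (![1, 0], ![1, 0])) (by decide : IsEven (![0, 1], ![1, 0])) (by decide) (by decide)

theorem even_11 (h : InSiegel p q r) : tc (![1, 1], 0) p q r * tc (![1, 1], ![1, 1]) p q r =
    2 * (tc (0, ![1, 1]) (2 * p) (2 * q) (2 * r) * tc (![1, 1], ![1, 1]) (2 * p) (2 * q) (2 * r)) := by
  simpa [dsgn, sgn] using tc_mul_tc_even' (a := ![1, 0]) (b := 0) h
    (by decide : IsOdd (![1, 0], ![1, 1])) (by decide : IsEven (![1, 1], ![1, 1])) (by decide) (by decide)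

theorem zero_01a (h : InSiegel p q r) : tc (0, 0) p q r * tc (0, ![0, 1]) p q r =
    tc (0, ![0, 1]) (2 * p) (2 * q) (2 * r) ^ 2 + tc (![1, 0], ![0, 1]) (2 * p) (2 * q) (2 * r) ^ 2 := by
  simpa [dsgn, sgn, ZMod.val_one, show (1 + 1 : ZMod 2) = 0 from rfl, sub_eq_add_neg] using
    tc_mul_tc_even (a := ![0, 1]) (b := 0) h
    (by decide : IsOdd (![0, 1], ![0, 1])) (by decide : IsEven (![1, 0], ![0, 1])) (by decide)

theorem zero_01b (h : InSiegel p q r) : tc (0, ![1, 0]) p q r * tc (0, ![1, 1]) p q r =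
    tc (0, ![0, 1]) (2 * p) (2 * q) (2 * r) ^ 2 - tc (![1, 0], ![0, 1]) (2 * p) (2 * q) (2 * r) ^ 2 := by
  simpa [dsgn, sgn, ZMod.val_one, show (1 + 1 : ZMod 2) = 0 from rfl, sub_eq_add_neg] using
    tc_mul_tc_even (a := ![0, 1]) (b := ![1, 0]) h
    (by decide : IsOdd (![0, 1], ![0, 1])) (by decide : IsEven (![1, 0], ![0, 1])) (by decide)

theorem zero_10a (h : InSiegel p q r) : tc (0, 0) p q r * tc (0, ![1, 0]) p q r =
    tc (0, ![1, 0]) (2 * p) (2 * q) (2 * r) ^ 2 + tc (![0, 1], ![1, 0]) (2 * p) (2 * q) (2 * r) ^ 2 := by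
  simpa [dsgn, sgn, ZMod.val_one, show (1 + 1 : ZMod 2) = 0 from rfl, sub_eq_add_neg] using
    tc_mul_tc_even (a := ![1, 0]) (b := 0) h
    (by decide : IsOdd (![1, 0], ![1, 0])) (by decide : IsEven (![0, 1], ![1, 0])) (by decide)

theorem zero_10b (h : InSiegel p q r) : tc (0, ![0, 1]) p q r * tc (0, ![1, 1]) p q r =
    tc (0, ![1, 0]) (2 * p) (2 * q) (2 * r) ^ 2 - tc (![0, 1], ![1, 0]) (2 * p) (2 * q) (2 * r) ^ 2 := by
  simpa [dsgn, sgn, ZMod.val_one, show (1 + 1 : ZMod 2) = 0 from rfl, sub_eq_add_neg] using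
    tc_mul_tc_even (a := ![1, 0]) (b := ![0, 1]) h
    (by decide : IsOdd (![1, 0], ![1, 0])) (by decide : IsEven (![0, 1], ![1, 0])) (by decide)

theorem zero_11a (h : InSiegel p q r) : tc (0, 0) p q r * tc (0, ![1, 1]) p q r =
    tc (0, ![1, 1]) (2 * p) (2 * q) (2 * r) ^ 2 + tc (![1, 1], ![1, 1]) (2 * p) (2 * q) (2 * r) ^ 2 := by
  simpa [dsgn, sgn, ZMod.val_one, show (1 + 1 : ZMod 2) = 0 from rfl, sub_eq_add_neg] using
    tc_mul_tc_even (a := ![1, 0]) (b := 0) h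
    (by decide : IsOdd (![1, 0], ![1, 1])) (by decide : IsEven (![1, 1], ![1, 1])) (by decide)

theorem zero_11b (h : InSiegel p q r) : tc (0, ![0, 1]) p q r * tc (0, ![1, 0]) p q r =
    tc (0, ![1, 1]) (2 * p) (2 * q) (2 * r) ^ 2 - tc (![1, 1], ![1, 1]) (2 * p) (2 * q) (2 * r) ^ 2 := by
  simpa [dsgn, sgn, ZMod.val_one, show (1 + 1 : ZMod 2) = 0 from rfl, sub_eq_add_neg] using
    tc_mul_tc_even (a := ![1, 0]) (b := ![0, 1]) h
    (by decide : IsOdd (![1, 0], ![1, 1])) (by decide : IsEven (![1, 1], ![1, 1])) (by decide)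

/-- Every link ends at one of the pairs `{2, 3}`, `{0, 4}`, `{1, 5}`, the pairs of odd
characteristics with a common second half `β`. -/
theorem link_02_23 : ∃ X, Link 0 2 2 3 (![0, 1], ![1, 0]) (![0, 1], 0) X :=
  ⟨_, link_same (α := ![1, 1]) (β := ![1, 1]) 1 (by decide)
    (by decide) (by decide) (by decide) (by decide) (by decide) fun p q r h => by
      have key := mul_congr₃ (even_10 h) (even_01 h) (even_11 h)
      simp [thetaProd, Fin.prod_univ_six, oddChar, show (1 + 1 : ZMod 2) = 0 from rfl, dsgn, sgn,
        ZMod.val_one, vec_eta_zero] at key ⊢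
      linear_combination key⟩

theorem link_01_23 : ∃ X, Link 0 1 2 3 (![0, 1], ![1, 0]) (![1, 0], ![0, 1]) X :=
  ⟨_, link_diff (α := ![1, 1]) (β := ![1, 1]) 1 (by decide) (by decide)
    (by decide) (by decide) (by decide) (by decide) (by decide) fun p q r h => by
      have key := mul_congr₃ (even_01 h) (even_10 h) (zero_11b h)
      simp [thetaProd, Fin.prod_univ_six, oddChar, show (1 + 1 : ZMod 2) = 0 from rfl, dsgn, sgn,
        ZMod.val_one, vec_eta_zero] at key ⊢
      linear_combination key⟩

theorem link_03_23 : ∃ X, Link 0 3 2 3 (![0, 1], ![1, 0]) (![1, 0], 0) X :=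
  ⟨_, link_diff (α := ![1, 1]) (β := ![1, 1]) 1 (by decide) (by decide)
    (by decide) (by decide) (by decide) (by decide) (by decide) fun p q r h => by
      have key := mul_congr₃ (even_01 h) (even_10 h) (zero_11a h)
      simp [thetaProd, Fin.prod_univ_six, oddChar, show (1 + 1 : ZMod 2) = 0 from rfl, dsgn, sgn,
        ZMod.val_one, vec_eta_zero] at key ⊢
      linear_combination key⟩

theorem link_21_23 : ∃ X, Link 2 1 2 3 (![0, 1], 0) (![1, 0], ![0, 1]) X :=
  ⟨_, link_diff (α := ![1, 1]) (β := ![1, 1]) 1 (by decide) (by decide)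
    (by decide) (by decide) (by decide) (by decide) (by decide) fun p q r h => by
      have key := mul_congr₃ (even_01 h) (even_10 h) (zero_11a h)
      simp [thetaProd, Fin.prod_univ_six, oddChar, show (1 + 1 : ZMod 2) = 0 from rfl, dsgn, sgn,
        ZMod.val_one, vec_eta_zero] at key ⊢
      linear_combination key⟩

theorem link_31_32 : ∃ X, Link 3 1 3 2 (![1, 0], 0) (![1, 0], ![0, 1]) X :=
  ⟨_, link_same (α := ![1, 1]) (β := ![1, 1]) (-1) (by decide)
    (by decide) (by decide) (by decide) (by decide) (by decide) fun p q r h => by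
      have key := mul_congr₃ (even_10 h) (even_01 h) (even_11 h)
      simp [thetaProd, Fin.prod_univ_six, oddChar, show (1 + 1 : ZMod 2) = 0 from rfl, dsgn, sgn,
        ZMod.val_one, vec_eta_zero] at key ⊢
      linear_combination key⟩

/-- This pair is linked to itself, which makes iteration of `τ ↦ 2τ` possible and supplies the
starting case of Rosenhain's formula. -/
theorem link_23_23 : ∃ X, Link 2 3 2 3 (![0, 1], 0) (![1, 0], 0) X :=
  ⟨_, link_diff (α := ![1, 1]) (β := ![1, 1]) 1 (by decide) (by decide)
    (by decide) (by decide) (by decide) (by decide) (by decide) fun p q r h => by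
      have key := mul_congr₃ (even_01 h) (even_10 h) (zero_11b h)
      simp [thetaProd, Fin.prod_univ_six, oddChar, show (1 + 1 : ZMod 2) = 0 from rfl, dsgn, sgn,
        ZMod.val_one, vec_eta_zero] at key ⊢
      linear_combination key⟩

/-- The factor is kept explicit because this link is later followed backwards, which requires
cancelling it. -/
theorem link_02_04 : ∃ c ≠ 0, Link 0 2 0 4 (![0, 1], 0) (![0, 1], ![1, 0]) fun p q r =>
    c * (tc (0, ![0, 1]) p q r * tc (![1, 0], ![0, 1]) p q r) :=
  ⟨_, by simp [dsgn, sgn, ZMod.val_one]; norm_num,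
    link_same (α := ![1, 0]) (β := ![0, 1]) (-1) (by decide)
    (by decide) (by decide) (by decide) (by decide) (by decide) fun p q r h => by
      have key := mul_congr₃ (even_10 h) (even_01 h) (even_11 h)
      simp [thetaProd, Fin.prod_univ_six, oddChar, show (1 + 1 : ZMod 2) = 0 from rfl, dsgn, sgn,
        ZMod.val_one, vec_eta_zero] at key ⊢
      linear_combination key⟩

theorem link_05_04 : ∃ X, Link 0 5 0 4 (![0, 1], 0) (![1, 1], ![1, 1]) X :=
  ⟨_, link_diff (α := ![1, 0]) (β := ![0, 1]) (-1) (by decide) (by decide)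
    (by decide) (by decide) (by decide) (by decide) (by decide) fun p q r h => by
      have key := mul_congr₃ (even_01 h) (even_11 h) (zero_01a h)
      simp [thetaProd, Fin.prod_univ_six, oddChar, show (1 + 1 : ZMod 2) = 0 from rfl, dsgn, sgn,
        ZMod.val_one, vec_eta_zero] at key ⊢
      linear_combination key⟩

theorem link_24_04 : ∃ X, Link 2 4 0 4 (![0, 1], ![1, 0]) (![1, 1], 0) X :=
  ⟨_, link_diff (α := ![1, 0]) (β := ![0, 1]) 1 (by decide) (by decide)
    (by decide) (by decide) (by decide) (by decide) (by decide) fun p q r h => by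
      have key := mul_congr₃ (even_01 h) (even_11 h) (zero_01a h)
      simp [thetaProd, Fin.prod_univ_six, oddChar, show (1 + 1 : ZMod 2) = 0 from rfl, dsgn, sgn,
        ZMod.val_one, vec_eta_zero] at key ⊢
      linear_combination key⟩

theorem link_25_04 : ∃ X, Link 2 5 0 4 (![0, 1], ![1, 0]) (![1, 1], ![1, 1]) X :=
  ⟨_, link_diff (α := ![1, 0]) (β := ![0, 1]) (-1) (by decide) (by decide)
    (by decide) (by decide) (by decide) (by decide) (by decide) fun p q r h => by
      have key := mul_congr₃ (even_01 h) (even_11 h) (zero_01b h)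
      simp [thetaProd, Fin.prod_univ_six, oddChar, show (1 + 1 : ZMod 2) = 0 from rfl, dsgn, sgn,
        ZMod.val_one, vec_eta_zero] at key ⊢
      linear_combination key⟩

theorem link_45_40 : ∃ X, Link 4 5 4 0 (![1, 1], 0) (![1, 1], ![1, 1]) X :=
  ⟨_, link_same (α := ![1, 0]) (β := ![0, 1]) 1 (by decide)
    (by decide) (by decide) (by decide) (by decide) (by decide) fun p q r h => by
      have key := mul_congr₃ (even_10 h) (even_01 h) (even_11 h)
      simp [thetaProd, Fin.prod_univ_six, oddChar, show (1 + 1 : ZMod 2) = 0 from rfl, dsgn, sgn,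
        ZMod.val_one, vec_eta_zero] at key ⊢
      linear_combination key⟩

theorem link_13_15 : ∃ c ≠ 0, Link 1 3 1 5 (![1, 0], 0) (![1, 0], ![0, 1]) fun p q r =>
    c * (tc (0, ![1, 0]) p q r * tc (![0, 1], ![1, 0]) p q r) :=
  ⟨_, by simp [dsgn, sgn, ZMod.val_one]; norm_num,
    link_same (α := ![0, 1]) (β := ![1, 0]) (-1) (by decide)
    (by decide) (by decide) (by decide) (by decide) (by decide) fun p q r h => by
      have key := mul_congr₃ (even_10 h) (even_01 h) (even_11 h)
      simp [thetaProd, Fin.prod_univ_six, oddChar, show (1 + 1 : ZMod 2) = 0 from rfl, dsgn, sgn,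
        ZMod.val_one, vec_eta_zero] at key ⊢
      linear_combination key⟩

theorem link_14_15 : ∃ X, Link 1 4 1 5 (![1, 0], 0) (![1, 1], ![1, 1]) X :=
  ⟨_, link_diff (α := ![0, 1]) (β := ![1, 0]) (-1) (by decide) (by decide)
    (by decide) (by decide) (by decide) (by decide) (by decide) fun p q r h => by
      have key := mul_congr₃ (even_10 h) (even_11 h) (zero_10a h)
      simp [thetaProd, Fin.prod_univ_six, oddChar, show (1 + 1 : ZMod 2) = 0 from rfl, dsgn, sgn,
        ZMod.val_one, vec_eta_zero] at key ⊢
      linear_combination key⟩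

theorem link_34_15 : ∃ X, Link 3 4 1 5 (![1, 0], ![0, 1]) (![1, 1], ![1, 1]) X :=
  ⟨_, link_diff (α := ![0, 1]) (β := ![1, 0]) (-1) (by decide) (by decide)
    (by decide) (by decide) (by decide) (by decide) (by decide) fun p q r h => by
      have key := mul_congr₃ (even_10 h) (even_11 h) (zero_10b h)
      simp [thetaProd, Fin.prod_univ_six, oddChar, show (1 + 1 : ZMod 2) = 0 from rfl, dsgn, sgn,
        ZMod.val_one, vec_eta_zero] at key ⊢
      linear_combination key⟩

theorem link_35_15 : ∃ X, Link 3 5 1 5 (![1, 0], ![0, 1]) (![1, 1], 0) X :=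
  ⟨_, link_diff (α := ![0, 1]) (β := ![1, 0]) 1 (by decide) (by decide)
    (by decide) (by decide) (by decide) (by decide) (by decide) fun p q r h => by
      have key := mul_congr₃ (even_10 h) (even_11 h) (zero_10a h)
      simp [thetaProd, Fin.prod_univ_six, oddChar, show (1 + 1 : ZMod 2) = 0 from rfl, dsgn, sgn,
        ZMod.val_one, vec_eta_zero] at key ⊢
      linear_combination key⟩

end

/-! ### Behaviour at the boundary -/

/-- The quadratic form with matrix `[[x, y], [y, z]]` on a shifted lattice. -/
def qform (x y z : ℝ) (a : Fin 2 → ZMod 2) (k : ℤ × ℤ) : ℝ :=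
  x * half (a 0) k.1 ^ 2 + 2 * y * half (a 0) k.1 * half (a 1) k.2 + z * half (a 1) k.2 ^ 2

theorem serTerm_imag (w : ℝ → ℝ → ℝ) (m : Characteristic) (t x y z : ℝ) (k : ℤ × ℤ) :
    serTerm w m (Complex.I * (t * x)) (Complex.I * (t * y)) (Complex.I * (t * z)) k =
      (Real.exp (-(Real.pi * t * qform x y z m.1 k)) : ℂ) *
        ((w (half (m.1 0) k.1) (half (m.1 1) k.2) : ℂ) *
          (phase (m.1 0) (m.2 0) k.1 * phase (m.1 1) (m.2 1) k.2)) := by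
  unfold serTerm
  have e : Real.pi * Complex.I * (Complex.I * (t * x) * half (m.1 0) k.1 ^ 2 +
      2 * (Complex.I * (t * y)) * half (m.1 0) k.1 * half (m.1 1) k.2 +
      Complex.I * (t * z) * half (m.1 1) k.2 ^ 2) =
      ((-(Real.pi * t * qform x y z m.1 k) : ℝ) : ℂ) := by
    unfold qform
    push_cast
    linear_combination (Real.pi * (t * x * half (m.1 0) k.1 ^ 2 +
      2 * (t * y) * half (m.1 0) k.1 * half (m.1 1) k.2 +
      t * z * half (m.1 1) k.2 ^ 2) : ℂ) * Complex.I_mul_I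
  rw [e, Complex.ofReal_exp]
  ring

theorem inSiegel_imag {t x y z : ℝ} (ht : 0 < t) (hx : 0 < x) (h : y ^ 2 < x * z) :
    InSiegel (Complex.I * (t * x)) (Complex.I * (t * y)) (Complex.I * (t * z)) := by
  constructor
  · simp; positivity
  · simp only [Complex.I_mul_im, ← Complex.ofReal_mul, Complex.ofReal_re]
    nlinarith [mul_lt_mul_of_pos_left h (mul_pos ht ht)]

open Filter Topology in
/-- The leading term of a theta series along a ray to the boundary. -/
theorem tendsto_ser {w : ℝ → ℝ → ℝ} (hw : Mild w) (m : Characteristic) {x y z μ : ℝ}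
    (hx : 0 < x) (h : y ^ 2 < x * z) (s : Finset (ℤ × ℤ))
    (hμ : ∀ k, μ ≤ qform x y z m.1 k) (hs : ∀ k, k ∈ s ↔ qform x y z m.1 k = μ) :
    Tendsto (fun t : ℝ => (Real.exp (Real.pi * t * μ) : ℂ) *
      ser w m (Complex.I * (t * x)) (Complex.I * (t * y)) (Complex.I * (t * z))) atTop
      (𝓝 (∑ k ∈ s, (w (half (m.1 0) k.1) (half (m.1 1) k.2) : ℂ) *
          (phase (m.1 0) (m.2 0) k.1 * phase (m.1 1) (m.2 1) k.2))) := by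
  classical
  set c : ℤ × ℤ → ℂ := fun k => (w (half (m.1 0) k.1) (half (m.1 1) k.2) : ℂ) *
          (phase (m.1 0) (m.2 0) k.1 * phase (m.1 1) (m.2 1) k.2) with hc
  have e1 : ∀ t : ℝ, (Real.exp (Real.pi * t * μ) : ℂ) *
      ser w m (Complex.I * (t * x)) (Complex.I * (t * y)) (Complex.I * (t * z)) =
      ∑' k, (Real.exp (-(Real.pi * t * (qform x y z m.1 k - μ))) : ℂ) * c k := by
    intro t
    rw [ser, ← tsum_mul_left]
    refine tsum_congr fun k => ?_
    rw [serTerm_imag, ← mul_assoc, ← Complex.ofReal_mul, ← Real.exp_add]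
    congr 3
    ring
  have e2 : ∑ k ∈ s, c k = ∑' k, if k ∈ s then c k else 0 := by
    rw [tsum_eq_sum (s := s) (fun k hk => by simp [hk])]
    exact Finset.sum_congr rfl fun k hk => by simp [hk]
  simp only [e1]
  rw [e2]
  -- For `t ≥ 1` the rescaled terms are at most their values at `t = 1`, because the form minus its
  -- minimum is nonnegative; the series at `t = 1` therefore dominates.
  have hsum : Summable fun k => Real.exp (Real.pi * μ) * ‖serTerm w m (Complex.I * ((1 : ℝ) * x))
      (Complex.I * ((1 : ℝ) * y)) (Complex.I * ((1 : ℝ) * z)) k‖ :=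
    (summable_norm_serTerm hw m (inSiegel_imag one_pos hx h)).mul_left _
  refine tendsto_tsum_of_dominated_convergence hsum (fun k => ?_) ?_
  · by_cases hk : k ∈ s
    · simp [hk, (hs k).1 hk]
    · simp only [hk, if_false]
      have hpos : 0 < qform x y z m.1 k - μ :=
        sub_pos.2 (lt_of_le_of_ne (hμ k) fun h => hk ((hs k).2 h.symm))
      have h1 : Tendsto (fun t : ℝ => Real.exp (-(Real.pi * t * (qform x y z m.1 k - μ)))) atTop
          (𝓝 0) := by
        refine Real.tendsto_exp_neg_atTop_nhds_zero.comp ?_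
        exact (tendsto_id.const_mul_atTop Real.pi_pos).atTop_mul_const hpos
      have h2 := ((Complex.continuous_ofReal.tendsto 0).comp h1).mul_const (c k)
      simpa using h2
  · filter_upwards [eventually_ge_atTop 1] with t ht k
    rw [serTerm_imag]
    change ‖_ * c k‖ ≤ _ * ‖_ * c k‖
    rw [norm_mul _ (c k), norm_mul _ (c k), ← mul_assoc]
    refine mul_le_mul_of_nonneg_right ?_ (norm_nonneg (c k))
    simp only [Complex.norm_real, Real.norm_eq_abs, abs_of_pos (Real.exp_pos _)]
    rw [← Real.exp_add]
    apply Real.exp_le_exp.2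
    have := mul_nonneg (mul_nonneg Real.pi_pos.le (sub_nonneg.2 ht)) (sub_nonneg.2 (hμ k))
    nlinarith

theorem val_sq (a : ZMod 2) : (a.val : ℝ) * a.val = a.val := by
  rcases zmod_two_cases a with rfl | rfl <;> simp [ZMod.val_one]

theorem half_sq (a : ZMod 2) (k : ℤ) :
    half a k ^ 2 = ((k * (k + a.val) : ℤ) : ℝ) + (a.val : ℝ) / 4 := by
  unfold half
  push_cast
  linear_combination val_sq a / 4

theorem mul_add_val_nonneg (a : ZMod 2) (k : ℤ) : 0 ≤ k * (k + a.val) := by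
  rcases zmod_two_cases a with rfl | rfl
  · simp [mul_self_nonneg]
  · rw [ZMod.val_one]
    rcases le_or_gt 0 k with h | h
    · positivity
    · have : k + ((1 : ℕ) : ℤ) ≤ 0 := by push_cast; omega
      nlinarith

/-! ### Minima of reduced forms on shifted lattices -/

/-- A reduced positive form. -/
def Reduced (x y z : ℝ) : Prop := 2 * |y| < x ∧ 2 * |y| < z

theorem Reduced.pos {x y z : ℝ} (h : Reduced x y z) : 0 < x ∧ 0 < z :=
  ⟨by linarith [h.1, abs_nonneg y], by linarith [h.2, abs_nonneg y]⟩

theorem Reduced.sq_lt {x y z : ℝ} (h : Reduced x y z) : y ^ 2 < x * z := by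
  rw [← sq_abs]
  nlinarith [h.1, h.2, abs_nonneg y, h.pos.1, h.pos.2]

/-- With one shift zero, the cross term vanishes at the minimum, and elsewhere it is outweighed by
the diagonal terms because the form is reduced. The integers on the left vanish exactly at the
minimal vectors. -/
theorem Reduced.qform_ge {x y z : ℝ} (h : Reduced x y z) {a : Fin 2 → ZMod 2}
    (ha : a 0 = 0 ∨ a 1 = 0) (k : ℤ × ℤ) :
    (min x z - 2 * |y|) * ((k.1 * (k.1 + (a 0).val) : ℤ) + (k.2 * (k.2 + (a 1).val) : ℤ)) ≤
      qform x y z a k - (x * (a 0).val / 4 + z * (a 1).val / 4) := by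
  have hh : ((a 0).val : ℝ) * (a 1).val = 0 := by
    rcases ha with ha | ha <;> simp [ha]
  have hn0 := mul_add_val_nonneg (a 0) k.1
  have hn1 := mul_add_val_nonneg (a 1) k.2
  have e0 := half_sq (a 0) k.1
  have e1 := half_sq (a 1) k.2
  have ha0 : ((a 0).val : ℝ) ≤ 1 := by exact_mod_cast Nat.lt_succ_iff.1 (ZMod.val_lt (a 0))
  have ha1 : ((a 1).val : ℝ) ≤ 1 := by exact_mod_cast Nat.lt_succ_iff.1 (ZMod.val_lt (a 1))
  have q0 : (0 : ℝ) ≤ (a 0).val := by positivity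
  have q1 : (0 : ℝ) ≤ (a 1).val := by positivity
  unfold qform
  set u := half (a 0) k.1
  set v := half (a 1) k.2
  generalize k.1 * (k.1 + ((a 0).val : ℤ)) = n0 at *
  generalize k.2 * (k.2 + ((a 1).val : ℤ)) = n1 at *
  generalize ((a 0).val : ℝ) = A at *
  generalize ((a 1).val : ℝ) = B at *
  have s0 : (n0 : ℝ) ≤ (n0 : ℝ) ^ 2 := by exact_mod_cast Int.le_self_sq n0
  have s1 : (n1 : ℝ) ≤ (n1 : ℝ) ^ 2 := by exact_mod_cast Int.le_self_sq n1
  have r0 : (0 : ℝ) ≤ n0 := by exact_mod_cast hn0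
  have r1 : (0 : ℝ) ≤ n1 := by exact_mod_cast hn1
  -- Here `(u v)² = (n0 + A/4)(n1 + B/4)` with `A B = 0` and `A, B ≤ 1`, while `n ≤ n²` for
  -- integers; so the square is bounded by `(n0 + n1)²`.
  have huv : |u * v| ≤ n0 + n1 := by
    refine abs_le_of_sq_le_sq ?_ (by positivity)
    have : (u * v) ^ 2 = (n0 + A / 4) * (n1 + B / 4) := by rw [mul_pow, e0, e1]
    rw [this]
    nlinarith [mul_nonneg r0 r1, mul_le_of_le_one_left r1 ha0, mul_le_of_le_one_left r0 ha1]
  have hcross : -(2 * |y| * (n0 + n1)) ≤ 2 * y * u * v := by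
    have h1 : |2 * y * u * v| ≤ 2 * |y| * (n0 + n1) := by
      rw [mul_assoc, abs_mul, abs_mul, abs_two]
      exact mul_le_mul_of_nonneg_left huv (by positivity)
    exact (abs_le.1 h1).1
  have hx : min x z * n0 ≤ x * n0 := mul_le_mul_of_nonneg_right (min_le_left _ _) r0
  have hz : min x z * n1 ≤ z * n1 := mul_le_mul_of_nonneg_right (min_le_right _ _) r1
  rw [e0, e1]
  nlinarith

/-- The zeros of `k (k + a)`. -/
def minSet (a : ZMod 2) : Finset ℤ := {0, -(a.val : ℤ)}

theorem mem_minSet (a : ZMod 2) (k : ℤ) : k ∈ minSet a ↔ k * (k + a.val) = 0 := by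
  simp [minSet, eq_neg_iff_add_eq_zero]

open Filter Topology in
theorem Reduced.tendsto_ser {w : ℝ → ℝ → ℝ} (hw : Mild w) {m : Characteristic} {x y z : ℝ}
    (h : Reduced x y z) (hm : m.1 0 = 0 ∨ m.1 1 = 0) :
    Tendsto (fun t : ℝ => (Real.exp (Real.pi * t * (x * (m.1 0).val / 4 + z * (m.1 1).val / 4)) : ℂ) *
      ser w m (Complex.I * (t * x)) (Complex.I * (t * y)) (Complex.I * (t * z))) atTop
      (𝓝 (∑ k ∈ minSet (m.1 0) ×ˢ minSet (m.1 1), (w (half (m.1 0) k.1) (half (m.1 1) k.2) : ℂ) *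
          (phase (m.1 0) (m.2 0) k.1 * phase (m.1 1) (m.2 1) k.2))) := by
  have hc : 0 < min x z - 2 * |y| := sub_pos.2 (lt_min h.1 h.2)
  have hn := fun k : ℤ × ℤ => mul_add_val_nonneg (m.1 0) k.1
  have hn' := fun k : ℤ × ℤ => mul_add_val_nonneg (m.1 1) k.2
  refine ThetaGenusTwo.tendsto_ser hw m h.pos.1 h.sq_lt _ (fun k => ?_) (fun k => ?_)
  · have h1 := h.qform_ge hm k
    have h2 : (0 : ℝ) ≤ (k.1 * (k.1 + (m.1 0).val) : ℤ) := by exact_mod_cast hn k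
    have h3 : (0 : ℝ) ≤ (k.2 * (k.2 + (m.1 1).val) : ℤ) := by exact_mod_cast hn' k
    have := mul_nonneg hc.le (add_nonneg h2 h3)
    linarith
  · rw [Finset.mem_product, mem_minSet, mem_minSet]
    constructor
    · rintro ⟨h1, h2⟩
      have e0 := half_sq (m.1 0) k.1
      have e1 := half_sq (m.1 1) k.2
      rw [h1, Int.cast_zero, zero_add] at e0
      rw [h2, Int.cast_zero, zero_add] at e1
      have e2 : half (m.1 0) k.1 * half (m.1 1) k.2 = 0 := by
        rcases hm with h | h
        · rw [h] at e0 ⊢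
          simp at e0
          simp [e0]
        · rw [h] at e1 ⊢
          simp at e1
          simp [e1]
      unfold qform
      rw [e0, e1, mul_assoc, e2]
      ring
    · intro h0
      have h1 := h.qform_ge hm k
      rw [h0, sub_self] at h1
      have h2 : ((k.1 * (k.1 + (m.1 0).val) : ℤ) : ℝ) + (k.2 * (k.2 + (m.1 1).val) : ℤ) ≤ 0 :=
        nonpos_of_mul_nonpos_right h1 hc
      have h3 : k.1 * (k.1 + (m.1 0).val) + k.2 * (k.2 + (m.1 1).val) ≤ 0 := by exact_mod_cast h2
      have := hn k
      have := hn' k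
      constructor <;> linarith

theorem phase_zero_left (b : ZMod 2) : phase 0 b 0 = 1 := by simp [phase]

theorem phase_zero_right (a : ZMod 2) (k : ℤ) : phase a 0 k = 1 := by simp [phase]

theorem phase_one_zero : phase 1 1 0 = Complex.I := by simp [phase, ZMod.val_one]

theorem phase_one_neg : phase 1 1 (-1) = -Complex.I := by simp [phase, ZMod.val_one]

theorem half_one_zero : half 1 0 = 1 / 2 := by simp [half, ZMod.val_one]

theorem half_one_neg : half 1 (-1) = -1 / 2 := by simp [half, ZMod.val_one]; norm_num

theorem half_zero_zero : half 0 0 = 0 := by simp [half]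

theorem minSet_zero : minSet 0 = {0} := by simp [minSet]

theorem minSet_one : minSet 1 = {0, -1} := by simp [minSet, ZMod.val_one]

open Filter Topology in
/-- The leading terms of the theta constants whose first half characteristic is not `(1, 1)`. -/
theorem tendsto_tc {m : Characteristic} (hm : m.1 0 = 0 ∨ m.1 1 = 0) (he : IsEven m) {x y z : ℝ}
    (h : Reduced x y z) :
    Tendsto (fun t : ℝ => (Real.exp (Real.pi * t * (x * (m.1 0).val / 4 + z * (m.1 1).val / 4)) : ℂ) *
      tc m (Complex.I * (t * x)) (Complex.I * (t * y)) (Complex.I * (t * z))) atTop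
      (𝓝 (if m.1 = 0 then 1 else 2)) := by
  suffices hs : ∑ k ∈ minSet (m.1 0) ×ˢ minSet (m.1 1),
      phase (m.1 0) (m.2 0) k.1 * phase (m.1 1) (m.2 1) k.2 = if m.1 = 0 then 1 else 2 by
    simpa only [tc, Complex.ofReal_one, one_mul, hs] using h.tendsto_ser mild_one hm
  obtain ⟨a, b⟩ := m
  rw [← vec_eta a, ← vec_eta b] at *
  simp only [IsEven, Matrix.cons_val_zero, Matrix.cons_val_one] at *
  rcases zmod_two_cases (a 0) with h0 | h0 <;> rcases zmod_two_cases (a 1) with h1 | h1 <;>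
    rcases zmod_two_cases (b 0) with h2 | h2 <;> rcases zmod_two_cases (b 1) with h3 | h3 <;>
    simp only [h0, h1, h2, h3] at * <;>
    simp [minSet_zero, minSet_one, phase_zero_left, phase_zero_right] at * <;>
    norm_num

open Filter Topology in
/-- The leading terms of the theta constants with first half characteristic `(1, 1)`. -/
theorem tendsto_tc_one {m : Characteristic} (hm : m.1 = 1) (he : IsEven m) :
    ∃ c : ℂ, c ≠ 0 ∧ Tendsto (fun t : ℝ => (Real.exp (Real.pi * t * (3 / 8)) : ℂ) *
      tc m (Complex.I * (t * (1 : ℝ))) (Complex.I * (t * (-1 / 4 : ℝ)))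
        (Complex.I * (t * (1 : ℝ)))) atTop (𝓝 c) := by
  obtain ⟨a, b⟩ := m
  obtain rfl : a = 1 := hm
  -- The nonzero off-diagonal entry `-1/4` matters: it leaves only `(0, 0)` and `(-1, -1)` as
  -- minimal vectors. With a diagonal form there would be four, and their phases would cancel for
  -- `m'' = (1, 1)`.
  have key : ∀ k : ℤ × ℤ, 3 / 8 + 3 / 4 * (((k.1 * (k.1 + 1) + k.2 * (k.2 + 1) : ℤ) : ℝ)) +
      1 / 4 * (k.1 - k.2) ^ 2 = qform 1 (-1 / 4) 1 1 k := by
    intro k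
    simp [qform, half, ZMod.val_one]
    ring
  have hn : ∀ k : ℤ × ℤ, 0 ≤ k.1 * (k.1 + 1) ∧ 0 ≤ k.2 * (k.2 + 1) := fun k => by
    simpa [ZMod.val_one] using And.intro (mul_add_val_nonneg 1 k.1) (mul_add_val_nonneg 1 k.2)
  refine ⟨_, ?_, ThetaGenusTwo.tendsto_ser mild_one (1, b) one_pos (by norm_num)
    {(0, 0), (-1, -1)} (fun k => ?_) (fun k => ?_)⟩
  · simp only [IsEven, Pi.one_apply, one_mul] at he ⊢
    rw [Finset.sum_pair (by simp)]
    rcases zmod_two_cases (b 0) with h2 | h2 <;> rcases zmod_two_cases (b 1) with h3 | h3 <;>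
      simp [h2, h3] at he
    · simp [h2, h3, phase_zero_right]
    · simp [h2, h3, phase_one_zero, phase_one_neg]
  · rw [← key]
    have : (0 : ℝ) ≤ ((k.1 * (k.1 + 1) + k.2 * (k.2 + 1) : ℤ) : ℝ) := by
      exact_mod_cast add_nonneg (hn k).1 (hn k).2
    nlinarith [sq_nonneg ((k.1 : ℝ) - k.2)]
  · rw [← key]
    constructor
    · intro hk
      simp only [Finset.mem_insert, Finset.mem_singleton] at hk
      rcases hk with rfl | rfl <;> norm_num
    · intro hk
      have h0 : (0 : ℝ) ≤ ((k.1 * (k.1 + 1) + k.2 * (k.2 + 1) : ℤ) : ℝ) := by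
        exact_mod_cast add_nonneg (hn k).1 (hn k).2
      have h1 : ((k.1 * (k.1 + 1) + k.2 * (k.2 + 1) : ℤ) : ℝ) = 0 := by
        nlinarith [sq_nonneg ((k.1 : ℝ) - k.2)]
      have h2 : ((k.1 : ℝ) - k.2) ^ 2 = 0 := by
        nlinarith [sq_nonneg ((k.1 : ℝ) - k.2)]
      have h3 : k.1 = k.2 := by exact_mod_cast sub_eq_zero.1 (pow_eq_zero_iff two_ne_zero |>.1 h2)
      have h4 : k.1 * (k.1 + 1) + k.2 * (k.2 + 1) = 0 := by exact_mod_cast h1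
      have h5 : k.1 * (k.1 + 1) = 0 := by linarith [(hn k).1, (hn k).2]
      simp only [Finset.mem_insert, Finset.mem_singleton, Prod.ext_iff]
      rcases mul_eq_zero.1 h5 with h6 | h6 <;> omega

theorem reduced_point : Reduced 1 (-1 / 4) 1 := by
  unfold Reduced
  rw [abs_of_nonpos (by norm_num)]
  norm_num

theorem val_pair_cases (a : Fin 2 → ZMod 2) : (a 0 = 0 ∨ a 1 = 0) ∨ a = 1 := by
  revert a; decide

open Filter in
/-- The ten even theta constants do not vanish far out on a suitable ray. -/
theorem eventually_tc_ne_zero : ∀ᶠ t : ℝ in atTop, ∀ m : EvenChar,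
    tc m (Complex.I * (t * (1 : ℝ))) (Complex.I * (t * (-1 / 4 : ℝ)))
      (Complex.I * (t * (1 : ℝ))) ≠ 0 := by
  rw [eventually_all]
  rintro ⟨m, he⟩
  rcases val_pair_cases m.1 with hm | hm
  · have := (tendsto_tc hm he reduced_point).eventually_ne (b₂ := 0) (by split_ifs <;> norm_num)
    filter_upwards [this] with t ht
    exact right_ne_zero_of_mul ht
  · obtain ⟨c, hc, h⟩ := tendsto_tc_one hm he
    filter_upwards [h.eventually_ne hc] with t ht
    exact right_ne_zero_of_mul ht

/-- A single point at which no even theta constant vanishes is what permits cancelling such factors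
from identities on the whole half-plane. -/
theorem exists_tc_ne_zero : ∃ p q r, InSiegel p q r ∧ ∀ m, IsEven m → tc m p q r ≠ 0 := by
  obtain ⟨t, h, ht⟩ := (eventually_tc_ne_zero.and (Filter.eventually_gt_atTop 0)).exists
  exact ⟨_, _, _, inSiegel_imag ht one_pos (by norm_num), fun m hm => h ⟨m, hm⟩⟩

open Filter Topology in
/-- The values of the theta constants at the boundary. -/
theorem tendsto_tc_cusp {m : Characteristic} (he : IsEven m) :
    Tendsto (fun t : ℝ => tc m (Complex.I * (t * (1 : ℝ))) (Complex.I * (t * (-1 / 4 : ℝ)))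
      (Complex.I * (t * (1 : ℝ)))) atTop (𝓝 (if m.1 = 0 then 1 else 0)) := by
  have aux : ∀ {μ : ℝ} {c : ℂ} {f : ℝ → ℂ}, 0 < μ →
      Tendsto (fun t : ℝ => (Real.exp (Real.pi * t * μ) : ℂ) * f t) atTop (𝓝 c) →
      Tendsto f atTop (𝓝 0) := by
    intro μ c f hμ hf
    have h1 : Tendsto (fun t : ℝ => Real.exp (-(Real.pi * t * μ))) atTop (𝓝 0) :=
      Real.tendsto_exp_neg_atTop_nhds_zero.comp
        ((tendsto_id.const_mul_atTop Real.pi_pos).atTop_mul_const hμ)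
    have h2 := ((Complex.continuous_ofReal.tendsto 0).comp h1).mul hf
    rw [Complex.ofReal_zero, zero_mul] at h2
    refine h2.congr fun t => ?_
    rw [Function.comp_apply, ← mul_assoc, ← Complex.ofReal_mul, ← Real.exp_add]
    simp
  rcases val_pair_cases m.1 with hm | hm
  · have h := tendsto_tc hm he reduced_point
    by_cases h0 : m.1 = 0
    · simpa [h0] using h
    · rw [if_neg h0] at h ⊢
      refine aux ?_ h
      have h1 : m.1 0 ≠ 0 ∨ m.1 1 ≠ 0 := by
        by_contra hn
        push Not at hn
        exact h0 (by ext i; fin_cases i <;> simp [hn.1, hn.2])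
      rcases h1 with h1 | h1
      · have : 0 < (m.1 0).val := Nat.pos_of_ne_zero (by simpa using h1)
        positivity
      · have : 0 < (m.1 1).val := Nat.pos_of_ne_zero (by simpa using h1)
        positivity
  · obtain ⟨c, -, h⟩ := tendsto_tc_one hm he
    rw [if_neg (by rw [hm]; exact one_ne_zero)]
    exact aux (by norm_num) h

/-! ### Rosenhain's formula -/

/-- Rosenhain's formula for a pair of odd characteristics. -/
def Rosenhain (i j : Fin 6) : Prop := ∃ ε : ℤˣ, ∀ p q r, InSiegel p q r →
  jac (oddChar i) (oddChar j) p q r = ((ε : ℤ) : ℂ) * thetaProd i j p q r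

theorem lineHol_prod {ι : Type*} (s : Finset ι) {F : ι → ℂ → ℂ → ℂ → ℂ}
    (h : ∀ i ∈ s, LineHol (F i)) : LineHol fun p q r => ∏ i ∈ s, F i p q r := by
  classical
  induction s using Finset.induction_on with
  | empty => simpa using lineHol_const 1
  | insert i s hi ih =>
    simp only [Finset.prod_insert hi]
    exact (h i (Finset.mem_insert_self _ _)).mul
      (ih fun j hj => h j (Finset.mem_insert_of_mem hj))

theorem lineHol_thetaProd (i j : Fin 6) : LineHol (thetaProd i j) := by
  refine lineHol_prod _ fun l _ => ?_
  split_ifs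
  · exact lineHol_const 1
  · exact lineHol_tc _

theorem lineHol_rosenhain (i j : Fin 6) (c : ℂ) :
    LineHol fun p q r => jac (oddChar i) (oddChar j) p q r - c * thetaProd i j p q r :=
  (lineHol_jac _ _).sub ((lineHol_const c).mul (lineHol_thetaProd i j))

theorem units_cast_mul_self (δ : ℤˣ) : ((δ : ℤ) : ℂ) * ((δ : ℤ) : ℂ) = 1 := by
  rw [← Int.cast_mul, ← Units.val_mul, Int.units_mul_self]; simp

theorem Rosenhain.symm {i j : Fin 6} (h : Rosenhain i j) : Rosenhain j i := by
  obtain ⟨ε, h⟩ := h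
  refine ⟨-ε, fun p q r hp => ?_⟩
  have e1 : jac (oddChar j) (oddChar i) p q r = -jac (oddChar i) (oddChar j) p q r := by
    unfold jac; ring
  have e2 : thetaProd j i p q r = thetaProd i j p q r := by
    unfold thetaProd
    refine Finset.prod_congr rfl fun l _ => ?_
    rw [add_comm (oddChar j)]
    congr 1
    exact propext or_comm
  rw [e1, e2, h p q r hp]
  push_cast
  ring

/-- Rosenhain's formula is inherited along a link. -/
theorem Rosenhain.of_link {i j i' j' : Fin 6} {m m' : Characteristic}
    (hl : ∃ X, Link i j i' j' m m' X) (hm : IsEven m) (hm' : IsEven m')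
    (h : Rosenhain i' j') : Rosenhain i j := by
  obtain ⟨X, δ, hl⟩ := hl
  obtain ⟨ε, h⟩ := h
  obtain ⟨p₀, q₀, r₀, h₀, hne⟩ := exists_tc_ne_zero
  refine ⟨ε * δ, fun p q r hp => ?_⟩
  have := (lineHol_rosenhain i j (((ε * δ : ℤˣ) : ℤ) : ℂ)).eq_zero_of_mul
    ((lineHol_tc m).mul (lineHol_tc m')) (fun p q r hp => by
      obtain ⟨h1, h2⟩ := hl p q r hp
      have h3 := h _ _ _ hp.two_mul
      rw [sub_mul, h1, mul_assoc, h2, h3]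
      push_cast
      linear_combination (-((ε : ℤ) : ℂ) * X (2 * p) (2 * q) (2 * r) *
        thetaProd i' j' (2 * p) (2 * q) (2 * r)) * units_cast_mul_self δ)
    h₀ (mul_ne_zero (hne m hm) (hne m' hm')) hp
  exact sub_eq_zero.1 this

/-- Rosenhain's formula is inherited along a link in the opposite direction. -/
theorem Rosenhain.of_link_symm {i j i' j' : Fin 6} {m m' n n' : Characteristic}
    (hl : ∃ c ≠ 0, Link i j i' j' m m' fun p q r => c * (tc n p q r * tc n' p q r))
    (hn : IsEven n) (hn' : IsEven n') (h : Rosenhain i j) : Rosenhain i' j' := by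
  obtain ⟨c, hc, δ, hl⟩ := hl
  obtain ⟨ε, h⟩ := h
  obtain ⟨p₀, q₀, r₀, h₀, hne⟩ := exists_tc_ne_zero
  refine ⟨ε * δ, fun p q r hp => ?_⟩
  have := (lineHol_rosenhain i' j' (((ε * δ : ℤˣ) : ℤ) : ℂ)).eq_zero_of_mul
    ((lineHol_const c).mul ((lineHol_tc n).mul (lineHol_tc n'))) (fun p q r hp => by
      -- The link is read at `τ / 2`, so that its doubled side lies at the given point.
      have hp' : InSiegel (p / 2) (q / 2) (r / 2) := by
        obtain ⟨h1, h2⟩ := hp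
        constructor <;> simp <;> linarith
      obtain ⟨h1, h2⟩ := hl _ _ _ hp'
      rw [h _ _ _ hp'] at h1
      simp only [mul_div_cancel₀ _ (two_ne_zero' ℂ)] at h1 h2
      push_cast
      linear_combination -h1 + ((ε : ℤ) : ℂ) * h2)
    h₀ (mul_ne_zero hc (mul_ne_zero (hne n hn) (hne n' hn'))) hp
  exact sub_eq_zero.1 this

/-! ### Rosenhain's formula for the self-linked pair -/

/-- The theta series without signs are positive at purely imaginary points. -/
theorem tc_imag_ne_zero (a : Fin 2 → ZMod 2) {t x y z : ℝ} (ht : 0 < t) (hx : 0 < x)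
    (h : y ^ 2 < x * z) :
    tc (a, 0) (Complex.I * (t * x)) (Complex.I * (t * y)) (Complex.I * (t * z)) ≠ 0 := by
  have hs := summable_serTerm mild_one (a, 0) (inSiegel_imag ht hx h)
  have e : ∀ k, serTerm (fun _ _ => 1) (a, 0) (Complex.I * (t * x)) (Complex.I * (t * y))
      (Complex.I * (t * z)) k = ((Real.exp (-(Real.pi * t * qform x y z a k)) : ℝ) : ℂ) := by
    intro k
    rw [serTerm_imag]
    simp [phase_zero_right]
  unfold tc ser
  replace hs := (summable_congr e).1 hs
  simp only [e]
  rw [← Complex.ofReal_tsum, Complex.ofReal_ne_zero]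
  exact ((Complex.summable_ofReal.1 hs).tsum_pos (fun _ => (Real.exp_pos _).le) 0
    (Real.exp_pos _)).ne'

theorem thetaProd_two_three (p q r : ℂ) : thetaProd 2 3 p q r =
    tc (![1, 0], ![0, 1]) p q r * tc (![0, 1], ![1, 0]) p q r * tc (0, ![0, 1]) p q r *
      tc (0, ![1, 0]) p q r := by
  simp [thetaProd, Fin.prod_univ_six, oddChar, show (1 + 1 : ZMod 2) = 0 from rfl, vec_eta_zero]

open Filter Topology in
/-- The leading term of the fourfold product along a ray. -/
theorem tendsto_thetaProd_two_three {x y z : ℝ} (h : Reduced x y z) :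
    Tendsto (fun t : ℝ => (Real.exp (Real.pi * t * ((x + z) / 4)) : ℂ) *
      thetaProd 2 3 (Complex.I * (t * x)) (Complex.I * (t * y)) (Complex.I * (t * z))) atTop
      (𝓝 4) := by
  have h1 := tendsto_tc (m := (![1, 0], ![0, 1])) (by decide) (by decide) h
  have h2 := tendsto_tc (m := (![0, 1], ![1, 0])) (by decide) (by decide) h
  have h3 := tendsto_tc (m := (0, ![0, 1])) (by decide) (by decide) h
  have h4 := tendsto_tc (m := (0, ![1, 0])) (by decide) (by decide) h
  have := ((h1.mul h2).mul h3).mul h4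
  convert! this using 2
  · rename_i t
    rw [thetaProd_two_three]
    simp only [Matrix.cons_val_zero, Matrix.cons_val_one, ZMod.val_one, ZMod.val_zero, Pi.zero_apply]
    rw [show Real.pi * t * ((x + z) / 4) = Real.pi * t * (x * ((1 : ℕ) : ℝ) / 4 + z * ((0 : ℕ) : ℝ) / 4)
      + Real.pi * t * (x * ((0 : ℕ) : ℝ) / 4 + z * ((1 : ℕ) : ℝ) / 4) by push_cast; ring,
      Real.exp_add]
    simp only [Nat.cast_zero, mul_zero, zero_div, add_zero, Real.exp_zero]
    push_cast
    ring
  · norm_num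

open Filter Topology in
/-- The leading term of the Jacobian determinant along a ray. -/
theorem tendsto_jac_two_three {x y z : ℝ} (h : Reduced x y z) :
    Tendsto (fun t : ℝ => (Real.exp (Real.pi * t * ((x + z) / 4)) : ℂ) *
      jac (oddChar 2) (oddChar 3) (Complex.I * (t * x)) (Complex.I * (t * y))
        (Complex.I * (t * z))) atTop (𝓝 (-4)) := by
  have e2 : oddChar 2 = (![0, 1], ![1, 1]) := rfl
  have e3 : oddChar 3 = (![1, 0], ![1, 1]) := rfl
  have l := fun i => h.tendsto_ser (mild_coordWeight i) (m := (![0, 1], ![1, 1])) (by decide)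
  have l' := fun i => h.tendsto_ser (mild_coordWeight i) (m := (![1, 0], ![1, 1])) (by decide)
  have := (((l 0).mul (l' 1)).sub ((l 1).mul (l' 0))).const_mul (-4)
  convert! this using 2
  · rename_i t
    rw [e2, e3]
    simp only [Matrix.cons_val_zero, Matrix.cons_val_one, ZMod.val_one, ZMod.val_zero]
    rw [show Real.pi * t * ((x + z) / 4) = Real.pi * t * (x * ((1 : ℕ) : ℝ) / 4 + z * ((0 : ℕ) : ℝ) / 4)
      + Real.pi * t * (x * ((0 : ℕ) : ℝ) / 4 + z * ((1 : ℕ) : ℝ) / 4) by push_cast; ring,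
      Real.exp_add]
    unfold jac tg
    push_cast
    ring
  · simp [minSet_zero, minSet_one, coordWeight, phase_zero_left, phase_one_zero,
      phase_one_neg, half_zero_zero, half_one_zero, half_one_neg]
    ring_nf
    simp

/-- Doubling preserves the ratio of Jacobian to theta product up to a fixed sign, and along the ray
their leading coefficients are `-4` and `4`. The theta constants to be cancelled have `m'' = 0`,
hence are positive at purely imaginary points. -/
theorem jac_two_three_imag {x y z : ℝ} (h : Reduced x y z) :
    jac (oddChar 2) (oddChar 3) (Complex.I * x) (Complex.I * y) (Complex.I * z) =
      -thetaProd 2 3 (Complex.I * x) (Complex.I * y) (Complex.I * z) := by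
  obtain ⟨X, δ, hl⟩ := link_23_23
  set J : ℕ → ℂ := fun n => jac (oddChar 2) (oddChar 3) (Complex.I * ((2 ^ n : ℝ) * x))
    (Complex.I * ((2 ^ n : ℝ) * y)) (Complex.I * ((2 ^ n : ℝ) * z)) with hJ
  set T : ℕ → ℂ := fun n => thetaProd 2 3 (Complex.I * ((2 ^ n : ℝ) * x))
    (Complex.I * ((2 ^ n : ℝ) * y)) (Complex.I * ((2 ^ n : ℝ) * z)) with hT
  have step : ∀ n, ∃ A B : ℂ, A ≠ 0 ∧ J n * A = B * J (n + 1) ∧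
      T n * A = ((δ : ℤ) : ℂ) * B * T (n + 1) := by
    intro n
    have ht : (0 : ℝ) < 2 ^ n := by positivity
    have h1 := hl _ _ _ (inSiegel_imag ht h.pos.1 h.sq_lt)
    have e : ∀ u : ℝ, 2 * (Complex.I * (((2 ^ n : ℝ) : ℂ) * u)) =
        Complex.I * (((2 ^ (n + 1) : ℝ) : ℂ) * u) := fun u => by push_cast; ring
    rw [e, e, e] at h1
    exact ⟨_, _, mul_ne_zero (tc_imag_ne_zero _ ht h.pos.1 h.sq_lt)
      (tc_imag_ne_zero _ ht h.pos.1 h.sq_lt), h1⟩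
  have iter : ∀ n, ∃ A B : ℂ, A ≠ 0 ∧ J 0 * A = B * J n ∧
      T 0 * A = ((δ : ℤ) : ℂ) ^ n * B * T n := by
    intro n
    induction n with
    | zero => exact ⟨1, 1, one_ne_zero, by simp, by simp⟩
    | succ n ih =>
      obtain ⟨A, B, hA, h1, h2⟩ := ih
      obtain ⟨A', B', hA', h1', h2'⟩ := step n
      refine ⟨A * A', B * B', mul_ne_zero hA hA', ?_, ?_⟩
      · linear_combination A' * h1 + B * h1'
      · rw [pow_succ]
        linear_combination A' * h2 + ((δ : ℤ) : ℂ) ^ n * B * h2'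
  -- An even number of doublings removes the unknown sign `δ`. Cross-multiplication requires only `A
  -- ≠ 0`; the factor `B` may vanish.
  have cross : ∀ n, J 0 * T (2 * n) = T 0 * J (2 * n) := by
    intro n
    obtain ⟨A, B, hA, h1, h2⟩ := iter (2 * n)
    rw [pow_mul, pow_two, units_cast_mul_self, one_pow, one_mul] at h2
    apply mul_right_cancel₀ hA
    linear_combination T (2 * n) * h1 - J (2 * n) * h2
  have lim : Filter.Tendsto (fun n : ℕ => (2 ^ (2 * n) : ℝ)) Filter.atTop Filter.atTop := by
    simp only [pow_mul]
    exact tendsto_pow_atTop_atTop_of_one_lt (by norm_num)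
  have l1 := ((tendsto_thetaProd_two_three h).comp lim).const_mul (J 0)
  have l2 := ((tendsto_jac_two_three h).comp lim).const_mul (T 0)
  have := tendsto_nhds_unique (l1.congr fun n => by
    have := cross n
    simp only [Function.comp_apply]
    rw [mul_left_comm, mul_left_comm (T 0)]
    exact congrArg _ this) l2
  have h4 : J 0 = -T 0 := by linear_combination this / 4
  simpa [hJ, hT] using h4

/-- Identity principle: a holomorphic function that vanishes at the purely imaginary points with
reduced imaginary part vanishes identically. -/
theorem LineHol.eq_zero_of_reduced {F : ℂ → ℂ → ℂ → ℂ} (hF : LineHol F)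
    (h : ∀ x y z : ℝ, Reduced x y z → F (Complex.I * x) (Complex.I * y) (Complex.I * z) = 0)
    {p q r : ℂ} (hp : InSiegel p q r) : F p q r = 0 := by
  have step1 : ∀ p q r : ℂ, Reduced p.im q.im r.im → F p q r = 0 := by
    intro p q r hr
    have hS : InSiegel p q r := ⟨hr.pos.1, hr.sq_lt⟩
    have e : ∀ u : ℂ, Complex.I * u.im + u.re = u := fun u => by
      conv_rhs => rw [← Complex.re_add_im u]
      ring
    -- The line runs from `i Im τ` in the direction `Re τ`. At an imaginary parameter its points are
    -- purely imaginary, and for a small parameter still reduced, so the zeros accumulate at the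
    -- origin.
    have key := hF.eq_zero_of_frequently (p := Complex.I * p.im) (q := Complex.I * q.im)
      (r := Complex.I * r.im) (p' := p.re) (q' := q.re) (r' := r.re)
      (by constructor <;> simp [hr.pos.1, hr.sq_lt]) (by rwa [e, e, e]) ?_
    · rwa [e, e, e] at key
    have hc : ∀ᶠ u : ℝ in nhds 0, Reduced (p.im - u * p.re) (q.im - u * q.re) (r.im - u * r.re) := by
      have h1 : IsOpen {u : ℝ | 2 * |q.im - u * q.re| < p.im - u * p.re} :=
        isOpen_lt (by fun_prop) (by fun_prop)
      have h2 : IsOpen {u : ℝ | 2 * |q.im - u * q.re| < r.im - u * r.re} :=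
        isOpen_lt (by fun_prop) (by fun_prop)
      exact (h1.inter h2).mem_nhds (by simpa [Reduced] using hr)
    have hmap : Filter.Tendsto (fun u : ℝ => Complex.I * u) (nhdsWithin 0 {0}ᶜ)
        (nhdsWithin 0 {0}ᶜ) := by
      refine tendsto_nhdsWithin_iff.2 ⟨?_, ?_⟩
      · refine Filter.Tendsto.mono_left ?_ nhdsWithin_le_nhds
        have : Continuous fun u : ℝ => Complex.I * (u : ℂ) := by fun_prop
        simpa using this.tendsto 0
      · filter_upwards [self_mem_nhdsWithin] with u hu
        simpa using hu
    refine hmap.frequently (Filter.Eventually.frequently ?_)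
    filter_upwards [nhdsWithin_le_nhds ((continuous_neg.tendsto' (0 : ℝ) 0 neg_zero).eventually hc)]
      with u hu
    have e2 : ∀ v : ℂ, Complex.I * v.im + Complex.I * u * v.re =
        Complex.I * ((v.im - -u * v.re : ℝ) : ℂ) := fun v => by push_cast; ring
    rw [e2, e2, e2]
    exact h _ _ _ hu
  -- Points near `i` times the identity matrix have reduced imaginary part, so the function vanishes
  -- on the start of the line to any given point.
  have key := hF.eq_zero_of_frequently (p := Complex.I) (q := 0) (r := Complex.I)
    (p' := p - Complex.I) (q' := q) (r' := r - Complex.I)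
    (by constructor <;> simp) (by simpa using hp) (Filter.Eventually.frequently ?_)
  · simpa using key
  refine nhdsWithin_le_nhds ?_
  have h1 : IsOpen {s : ℂ | 2 * |(0 + s * q).im| < (Complex.I + s * (p - Complex.I)).im} :=
    isOpen_lt (by fun_prop) (by fun_prop)
  have h2 : IsOpen {s : ℂ | 2 * |(0 + s * q).im| < (Complex.I + s * (r - Complex.I)).im} :=
    isOpen_lt (by fun_prop) (by fun_prop)
  filter_upwards [(h1.inter h2).mem_nhds (by simp)] with s hs
  exact step1 _ _ _ hs

theorem rosenhain_two_three : Rosenhain 2 3 := by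
  refine ⟨-1, fun p q r hp => sub_eq_zero.1 ?_⟩
  refine (lineHol_rosenhain 2 3 (((-1 : ℤˣ) : ℤ) : ℂ)).eq_zero_of_reduced (fun x y z h => ?_) hp
  rw [jac_two_three_imag h]
  simp

theorem forall_pairs {P : Fin 6 → Fin 6 → Prop} (hP : ∀ i j, P i j → P j i) (h01 : P 0 1)
    (h02 : P 0 2) (h03 : P 0 3) (h04 : P 0 4) (h05 : P 0 5) (h12 : P 1 2) (h13 : P 1 3)
    (h14 : P 1 4) (h15 : P 1 5) (h23 : P 2 3) (h24 : P 2 4) (h25 : P 2 5) (h34 : P 3 4)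
    (h35 : P 3 5) (h45 : P 4 5) {i j : Fin 6} (hij : i ≠ j) : P i j := by
  fin_cases i <;> fin_cases j <;> first
    | exact absurd rfl hij
    | assumption
    | (apply hP; assumption)

/-- Rosenhain's formula: the Jacobian determinant of two odd theta functions is, up to sign, the
product of four theta constants. -/
theorem rosenhain {i j : Fin 6} (hij : i ≠ j) : Rosenhain i j := by
  -- From `{2, 3}` links lead to the pairs `{0, 2}` and `{1, 3}`; two links followed backwards then
  -- reach `{0, 4}` and `{1, 5}`, the end points of all other links.
  have h23 := rosenhain_two_three
  have h01 := h23.of_link link_01_23 (by decide) (by decide)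
  have h02 := h23.of_link link_02_23 (by decide) (by decide)
  have h03 := h23.of_link link_03_23 (by decide) (by decide)
  have h21 := h23.of_link link_21_23 (by decide) (by decide)
  have h31 := h23.symm.of_link link_31_32 (by decide) (by decide)
  have h04 := h02.of_link_symm link_02_04 (by decide) (by decide)
  have h15 := h31.symm.of_link_symm link_13_15 (by decide) (by decide)
  have h05 := h04.of_link link_05_04 (by decide) (by decide)
  have h24 := h04.of_link link_24_04 (by decide) (by decide)
  have h25 := h04.of_link link_25_04 (by decide) (by decide)
  have h45 := h04.symm.of_link link_45_40 (by decide) (by decide)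
  have h14 := h15.of_link link_14_15 (by decide) (by decide)
  have h34 := h15.of_link link_34_15 (by decide) (by decide)
  have h35 := h15.of_link link_35_15 (by decide) (by decide)
  exact forall_pairs (P := Rosenhain) (fun _ _ => Rosenhain.symm) h01 h02 h03 h04 h05 h21.symm h31.symm h14 h15 h23
    h24 h25 h34 h35 h45 hij

/-! ### Transformations under which the theta constants change by a sign -/

/-- Five automorphisms of the half-plane: two translations and three changes of basis. -/
def moveFun (g : Fin 5) (p q r : ℂ) : ℂ × ℂ × ℂ :=
  ![(p + 4, q, r), (p, q, r + 4), (p + 4 * q + 4 * r, q + 2 * r, r),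
    (p, q + 2 * p, r + 4 * q + 4 * p), (p, -q, r)] g

/-- The exponent of the sign by which the theta constant with characteristic `m` changes. -/
def moveExp (g : Fin 5) (m : Characteristic) : ZMod 2 :=
  ![m.1 0, m.1 1, m.1 0 * m.2 1, m.1 1 * m.2 0, m.1 0 * m.2 0] g

theorem inSiegel_moveFun (g : Fin 5) {p q r : ℂ} (h : InSiegel p q r) :
    InSiegel (moveFun g p q r).1 (moveFun g p q r).2.1 (moveFun g p q r).2.2 := by
  have h0 := h.pos_right
  obtain ⟨h1, h2⟩ := h
  -- This is the value of the positive form at `(1, 2)`.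
  have key : ∀ x y z : ℝ, 0 < x → 0 < z → y ^ 2 < x * z → 0 < x + 4 * y + 4 * z := by
    intro x y z hx hz hy
    by_contra hn
    nlinarith [sq_nonneg (x + 2 * y), sq_nonneg (y + 2 * z)]
  fin_cases g <;> simp [moveFun, InSiegel]
  · exact ⟨h1, h2⟩
  · exact ⟨h1, h2⟩
  · exact ⟨key _ _ _ h1 h0 h2, by nlinarith⟩
  · exact ⟨h1, by nlinarith⟩
  · exact ⟨h1, h2⟩

theorem tc_of_equiv {m : Characteristic} {p q r p' q' r' c : ℂ} (e : ℤ × ℤ ≃ ℤ × ℤ)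
    (h : ∀ k, serTerm (fun _ _ => 1) m p' q' r' k = c * serTerm (fun _ _ => 1) m p q r (e k)) :
    tc m p' q' r' = c * tc m p q r := by
  unfold tc ser
  rw [tsum_congr h, tsum_mul_left, e.tsum_eq]

theorem sgn_mul_self (x : ZMod 2) : sgn x * sgn x = 1 := by
  rw [sgn_mul_sgn, CharTwo.add_self_eq_zero]; simp [sgn]

theorem exp_translation (a : ZMod 2) (k : ℤ) :
    Complex.exp (Real.pi * Complex.I * (4 * half a k ^ 2)) = sgn a := by
  have e : Real.pi * Complex.I * (4 * (half a k : ℂ) ^ 2) =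
      ((2 * (2 * (k * (k + a.val))) : ℤ) : ℂ) * (Real.pi * Complex.I) +
        a.val * (Real.pi * Complex.I) := by
    rw [← Complex.ofReal_pow, half_sq]
    push_cast
    ring
  rw [e, Complex.exp_add, Complex.exp_int_mul, Complex.exp_nat_mul, Complex.exp_pi_mul_I, zpow_mul]
  simp [sgn]

theorem phase_shift (a a' b : ZMod 2) (k l : ℤ) :
    phase a b (k + 2 * l + a'.val) = sgn (a' * b) * phase a b k := by
  have hI : (Complex.I : ℂ) ≠ 0 := Complex.I_ne_zero
  have h2 : Complex.I ^ (2 : ℤ) = -1 := by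
    rw [show (2 : ℤ) = ((2 : ℕ) : ℤ) from rfl, zpow_natCast, Complex.I_sq]
  unfold phase sgn
  rcases zmod_two_cases b with rfl | rfl
  · simp
  · rw [mul_one, ZMod.val_one, Nat.cast_one, mul_one, mul_one,
      show 2 * (k + 2 * l + (a'.val : ℤ)) + (a.val : ℤ) = (2 * k + a.val) + 2 * (2 * l + a'.val) by
        ring, zpow_add₀ hI _ (2 * _), zpow_mul _ 2 (2 * l + _), h2,
      zpow_add₀ (by norm_num : (-1 : ℂ) ≠ 0), zpow_mul, zpow_natCast]
    simp [mul_comm]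

/-- A translation by `4` multiplies a term by `exp (4 π i x²)`, a sign depending only on the shift.
The other moves are integral changes of basis that are trivial modulo two, so they permute the
shifted lattice and affect only the phases. -/
theorem tc_move (g : Fin 5) {m : Characteristic} (p q r : ℂ) :
    tc m (moveFun g p q r).1 (moveFun g p q r).2.1 (moveFun g p q r).2.2 =
      sgn (moveExp g m) * tc m p q r := by
  have two : ∀ x y : ZMod 2, ∀ z w : ℂ, z = sgn (x * y) * w → w = sgn (x * y) * z := by
    intro x y z w h
    rw [h, ← mul_assoc, sgn_mul_self, one_mul]
  fin_cases g
  · refine tc_of_equiv (Equiv.refl _) fun k => ?_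
    simp only [serTerm, moveFun, moveExp, Equiv.refl_apply, Fin.zero_eta, Matrix.cons_val_zero,
      Complex.ofReal_one, one_mul, ← exp_translation (m.1 0) k.1]
    rw [← mul_assoc (Complex.exp _) (Complex.exp _), ← Complex.exp_add]
    congr 2
    ring
  · refine tc_of_equiv (Equiv.refl _) fun k => ?_
    simp only [serTerm, moveFun, moveExp, Equiv.refl_apply, Fin.mk_one, Matrix.cons_val_one,
      Matrix.cons_val_zero, Complex.ofReal_one, one_mul, ← exp_translation (m.1 1) k.2]
    rw [← mul_assoc (Complex.exp _) (Complex.exp _), ← Complex.exp_add]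
    congr 2
    ring
  -- The new form at `(x, y)` is the old one at `(x, y + 2x)`; on lattice coordinates the
  -- half-integral shift of `x` adds `m' 0`.
  · refine tc_of_equiv ⟨fun k => (k.1, k.2 + 2 * k.1 + (m.1 0).val),
      fun k => (k.1, k.2 - 2 * k.1 - (m.1 0).val), fun k => by ext <;> simp <;> ring, fun k => by
      ext <;> simp <;> ring⟩ fun k => ?_
    have h := two _ _ _ _ (phase_shift (m.1 1) (m.1 0) (m.2 1) k.2 k.1)
    have hh : half (m.1 1) (k.2 + 2 * k.1 + (m.1 0).val) =
        half (m.1 1) k.2 + 2 * half (m.1 0) k.1 := by simp [half]; ring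
    simp only [serTerm, moveFun, moveExp, Equiv.coe_fn_mk, Fin.reduceFinMk, Matrix.cons_val,
      Complex.ofReal_one, one_mul]
    rw [h, hh, mul_left_comm (phase (m.1 0) _ _) (sgn _), mul_left_comm (Complex.exp _) (sgn _)]
    congr 3
    push_cast
    ring
  · refine tc_of_equiv ⟨fun k => (k.1 + 2 * k.2 + (m.1 1).val, k.2),
      fun k => (k.1 - 2 * k.2 - (m.1 1).val, k.2), fun k => by ext <;> simp <;> ring, fun k => by
      ext <;> simp <;> ring⟩ fun k => ?_
    have h := two _ _ _ _ (phase_shift (m.1 0) (m.1 1) (m.2 0) k.1 k.2)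
    have hh : half (m.1 0) (k.1 + 2 * k.2 + (m.1 1).val) =
        half (m.1 0) k.1 + 2 * half (m.1 1) k.2 := by simp [half]; ring
    simp only [serTerm, moveFun, moveExp, Equiv.coe_fn_mk, Fin.reduceFinMk, Matrix.cons_val,
      Complex.ofReal_one, one_mul]
    rw [h, hh, mul_assoc (sgn _) (phase _ _ _), mul_left_comm (Complex.exp _) (sgn _)]
    congr 3
    push_cast
    ring
  · refine tc_of_equiv ⟨fun k => (-k.1 - (m.1 0).val, k.2),
      fun k => (-k.1 - (m.1 0).val, k.2), fun k => by ext <;> simp, fun k => by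
      ext <;> simp⟩ fun k => ?_
    have h := two _ _ _ _ (phase_neg (m.1 0) (m.2 0) k.1)
    simp only [serTerm, moveFun, moveExp, Equiv.coe_fn_mk, Fin.reduceFinMk, Matrix.cons_val,
      Complex.ofReal_one, one_mul]
    rw [h, half_neg, mul_assoc (sgn _) (phase _ _ _), mul_left_comm (Complex.exp _) (sgn _)]
    congr 3
    push_cast
    ring

/-- The five automorphisms on the half-plane itself. -/
def move (g : Fin 5) (τ : SiegelHalfPlane) : SiegelHalfPlane :=
  siegelMk _ _ _ (inSiegel_moveFun g (siegel_coords τ))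

theorem thetaConst_siegelMk (m : Characteristic) {p q r : ℂ} (h : InSiegel p q r) :
    thetaConst m (siegelMk p q r h) = tc m p q r := by
  rw [thetaConst_eq]; rfl

theorem thetaConst_move (g : Fin 5) (m : Characteristic) (τ : SiegelHalfPlane) :
    thetaConst m (move g τ) = sgn (moveExp g m) * thetaConst m τ := by
  rw [move, thetaConst_siegelMk, tc_move, thetaConst_eq]
  rfl

theorem thetaSq_move (g : Fin 5) (e : Sym2 EvenChar) (τ : SiegelHalfPlane) :
    thetaSq e (move g τ) = thetaSq e τ := by
  induction e using Sym2.ind with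
  | _ m n =>
    simp only [thetaSq, Sym2.lift_mk, thetaConst_move]
    linear_combination (thetaConst m τ ^ 2 * thetaConst n τ ^ 2) *
      ((sgn (moveExp g n)) ^ 2 * sgn_mul_self (moveExp g m) + sgn_mul_self (moveExp g n))

/-! ### The functions `D(N)` -/

/-- The exponent of the sign by which `D(N)` changes. -/
def pairExp (g : Fin 5) (N : OddPair) : ZMod 2 :=
  ∑ l, if l = N.1.inf ∨ l = N.1.sup then 0
    else moveExp g (oddChar N.1.inf + oddChar N.1.sup + oddChar l)

theorem inf_ne_sup (N : OddPair) : N.1.inf ≠ N.1.sup := by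
  obtain ⟨e, he⟩ := N
  induction e using Sym2.ind with
  | _ i j =>
    simp only [Sym2.inf_mk, Sym2.sup_mk] at *
    exact fun h => he (inf_eq_sup.1 h)

/-- The product of theta constants attached to a pair, on the half-plane. -/
def pairProd (N : OddPair) (τ : SiegelHalfPlane) : ℂ :=
  ∏ l, if l = N.1.inf ∨ l = N.1.sup then 1
    else thetaConst (oddChar N.1.inf + oddChar N.1.sup + oddChar l) τ

theorem exists_sign (N : OddPair) : ∃ ε : ℤˣ, ∀ τ, jacD N τ = ((ε : ℤ) : ℂ) * pairProd N τ := by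
  obtain ⟨ε, h⟩ := rosenhain (inf_ne_sup N)
  refine ⟨ε, fun τ => ?_⟩
  rw [jacD, jacobian_eq, h _ _ _ (siegel_coords τ), pairProd, thetaProd]
  simp only [thetaConst_eq]
  rfl

/-- The sign in Rosenhain's formula. -/
def pairSign (N : OddPair) : ℤˣ := (exists_sign N).choose

theorem jacD_eq (N : OddPair) (τ : SiegelHalfPlane) :
    jacD N τ = ((pairSign N : ℤ) : ℂ) * pairProd N τ := (exists_sign N).choose_spec τ

theorem sgn_sum {ι : Type*} (s : Finset ι) (f : ι → ZMod 2) : sgn (∑ i ∈ s, f i) = ∏ i ∈ s, sgn (f i) := by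
  classical
  induction s using Finset.induction_on with
  | empty => simp [sgn]
  | insert i s hi ih => rw [Finset.sum_insert hi, Finset.prod_insert hi, ← sgn_mul_sgn, ih]

theorem jacD_move (g : Fin 5) (N : OddPair) (τ : SiegelHalfPlane) :
    jacD N (move g τ) = sgn (pairExp g N) * jacD N τ := by
  rw [jacD_eq, jacD_eq, mul_left_comm]
  congr 1
  rw [pairExp, sgn_sum, pairProd, pairProd, ← Finset.prod_mul_distrib]
  refine Finset.prod_congr rfl fun l _ => ?_
  split_ifs
  · simp [sgn]
  · rw [thetaConst_move]

theorem isEven_triple : ∀ i j l : Fin 6, i ≠ j → l ≠ i → l ≠ j →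
    IsEven (oddChar i + oddChar j + oddChar l) := by
  decide

/-- A point where none of the even theta constants vanishes. -/
theorem exists_thetaConst_ne_zero : ∃ τ : SiegelHalfPlane, ∀ m, IsEven m → thetaConst m τ ≠ 0 := by
  obtain ⟨p, q, r, h, hne⟩ := exists_tc_ne_zero
  exact ⟨siegelMk p q r h, fun m hm => by rw [thetaConst_siegelMk]; exact hne m hm⟩

theorem pairProd_ne_zero {τ : SiegelHalfPlane} (hτ : ∀ m, IsEven m → thetaConst m τ ≠ 0)
    (N : OddPair) : pairProd N τ ≠ 0 := by
  refine Finset.prod_ne_zero_iff.2 fun l _ => ?_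
  split_ifs with hl
  · exact one_ne_zero
  · push Not at hl
    exact hτ _ (isEven_triple _ _ _ (inf_ne_sup N) hl.1 hl.2)

theorem jacD_ne_zero {τ : SiegelHalfPlane} (hτ : ∀ m, IsEven m → thetaConst m τ ≠ 0)
    (N : OddPair) : jacD N τ ≠ 0 := by
  rw [jacD_eq]
  refine mul_ne_zero ?_ (pairProd_ne_zero hτ N)
  exact Int.cast_ne_zero.2 (Units.ne_zero _)

/-! ### Multisets of pairs -/

/-- The indicator of `v ∉ e`. -/
def missing (v : Fin 6) (e : Sym2 (Fin 6)) : ZMod 2 := if v ∈ e then 0 else 1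

/-- Every index is missing from an even number of the pairs. -/
def EvenMissing (t : Multiset (Sym2 (Fin 6))) : Prop := ∀ v, (t.map (missing v)).sum = 0

/-! ### Exhaustive search for subgraphs on six vertices -/

/-- Whether some index outside a list satisfies a property. -/
def anyNew (used : List (Fin 6)) (p : Fin 6 → Bool) : Bool :=
  [0, 1, 2, 3, 4, 5].any fun i => !used.contains i && p i

/-- Whether a graph on six vertices contains one of the listed subgraphs. -/
def search (adj : Fin 6 → Fin 6 → Bool) : Bool :=
  anyNew [] fun a => anyNew [a] fun b => adj a b && anyNew [a, b] fun c =>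
    anyNew [a, b, c] fun d =>
      (adj c d && ((adj b c && adj d a) ||
        anyNew [a, b, c, d] fun e => anyNew [a, b, c, d, e] fun f => adj e f)) ||
      (adj a c && ((adj a d && anyNew [a, b, c, d] fun e => anyNew [a, b, c, d, e] fun f =>
          (adj b e && adj b f) || (adj a e && adj a f)) ||
        (adj b c && anyNew [a, b, c, d] fun e => adj d e &&
          ((adj e a && adj a d) || anyNew [a, b, c, d, e] fun f => adj e f && adj f d))))

/-- A graph given by the rows of its adjacency matrix. -/
def ofRows (g : List (List Bool)) (i j : Fin 6) : Bool := (g.getD i.val []).getD j.val false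

/-- The parity conditions leave few unknowns: the condition at vertex `5` concerns the ten edges
among the other vertices, and comparing the conditions at `0` and `v` determines the edge from `v`
to `5`. Only the edges among `0, …, 4` and the edge `{0, 5}` have to be enumerated. -/
theorem search_ofRows : ∀ b01 b02 b03 b04 b12 b13 b14 b23 b24 b34 b05 : Bool,
    (b01 ^^ b02 ^^ b03 ^^ b04 ^^ b12 ^^ b13 ^^ b14 ^^ b23 ^^ b24 ^^ b34) = false →
    let b15 := b02 ^^ b03 ^^ b04 ^^ b05 ^^ b12 ^^ b13 ^^ b14
    let b25 := b01 ^^ b03 ^^ b04 ^^ b05 ^^ b12 ^^ b23 ^^ b24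
    let b35 := b01 ^^ b02 ^^ b04 ^^ b05 ^^ b13 ^^ b23 ^^ b34
    let b45 := b01 ^^ b02 ^^ b03 ^^ b05 ^^ b14 ^^ b24 ^^ b34
    (b01 || b02 || b03 || b04 || b12 || b13 || b14 || b23 || b24 || b34 || b05 || b15 || b25 ||
      b35 || b45) = true →
    search (ofRows [[false, b01, b02, b03, b04, b05], [b01, false, b12, b13, b14, b15],
      [b02, b12, false, b23, b24, b25], [b03, b13, b23, false, b34, b35],
      [b04, b14, b24, b34, false, b45], [b05, b15, b25, b35, b45, false]]) = true := by
  decide +kernel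

theorem anyNew_eq_true (used : List (Fin 6)) (p : Fin 6 → Bool) :
    anyNew used p = true ↔ ∃ i, i ∉ used ∧ p i = true := by
  have h : ∀ i : Fin 6, i ∈ [(0 : Fin 6), 1, 2, 3, 4, 5] := by decide
  simp [anyNew, -List.any_cons, List.any_eq_true, h]

/-- The listed subgraphs, on standard vertices. -/
def stdPattern : Fin 6 → Multiset (Sym2 (Fin 6)) :=
  ![{s(0, 1), s(2, 3), s(4, 5)}, {s(0, 1), s(1, 2), s(2, 3), s(3, 0)},
    {s(0, 1), s(0, 2), s(0, 3), s(1, 4), s(1, 5)}, {s(0, 1), s(0, 2), s(0, 3), s(0, 4), s(0, 5)},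
    {s(0, 1), s(1, 2), s(2, 0), s(3, 4), s(4, 5), s(5, 3)},
    {s(0, 1), s(1, 2), s(2, 0), s(3, 4), s(4, 0), s(0, 3)}]

/-- The multisets of pairs occurring on the left-hand sides of the system. -/
def IsListed (s : Multiset OddPair) : Prop :=
  IsSquare s ∨ ∃ (k : Fin 6) (f : Equiv.Perm (Fin 6)),
    s.map Subtype.val = (stdPattern k).map (Sym2.map f)

/-- The permutation with a given list of distinct values. -/
theorem exists_perm_of_nodup {a b c d e f : Fin 6} (h : [a, b, c, d, e, f].Nodup) :
    ∃ g : Equiv.Perm (Fin 6), g 0 = a ∧ g 1 = b ∧ g 2 = c ∧ g 3 = d ∧ g 4 = e ∧ g 5 = f := by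
  have he : ∀ i : Fin 6, ![a, b, c, d, e, f] i = [a, b, c, d, e, f].get i := by
    intro i
    fin_cases i <;> rfl
  have hinj : Function.Injective ![a, b, c, d, e, f] := fun i j hij =>
    List.nodup_iff_injective_get.1 h (by rw [← he, ← he, hij])
  refine ⟨Equiv.ofBijective _ (Finite.injective_iff_bijective.1 hinj), ?_⟩
  simp [Equiv.ofBijective]

theorem exists_pattern_of_search {t : Multiset (Sym2 (Fin 6))} {adj : Fin 6 → Fin 6 → Bool}
    (hadj : ∀ i j, adj i j = true → s(i, j) ∈ t) (h : search adj = true) :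
    ∃ (k : Fin 6) (f : Equiv.Perm (Fin 6)), ∀ e ∈ stdPattern k, e.map f ∈ t := by
  have key : ∃ a b c d e f : Fin 6, [a, b, c, d, e, f].Nodup ∧
      ((adj a b ∧ adj c d ∧ adj e f) ∨ (adj a b ∧ adj b c ∧ adj c d ∧ adj d a) ∨
        (adj a b ∧ adj a c ∧ adj a d ∧ adj b e ∧ adj b f) ∨
        (adj a b ∧ adj a c ∧ adj a d ∧ adj a e ∧ adj a f) ∨
        (adj a b ∧ adj b c ∧ adj a c ∧ adj d e ∧ adj e f ∧ adj f d) ∨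
        (adj a b ∧ adj b c ∧ adj a c ∧ adj d e ∧ adj e a ∧ adj a d)) := by
    have ex : ∀ a b c d : Fin 6, [a, b, c, d].Nodup → ∃ e f, [a, b, c, d, e, f].Nodup := by
      decide +kernel
    have ex1 : ∀ a b c d e : Fin 6, [a, b, c, d, e].Nodup → ∃ f, [a, b, c, d, e, f].Nodup := by
      decide +kernel
    simp only [search, anyNew_eq_true, Bool.and_eq_true, Bool.or_eq_true] at h
    obtain ⟨a, -, b, hb, hab, c, hc, d, hd, h⟩ := h
    have h4 : [a, b, c, d].Nodup :=
      List.Nodup.concat hd (List.Nodup.concat hc (List.Nodup.concat hb (List.nodup_singleton a)))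
    have h6 : ∀ {e f}, e ∉ [a, b, c, d] → f ∉ [a, b, c, d, e] → [a, b, c, d, e, f].Nodup :=
      fun he hf => List.Nodup.concat hf (List.Nodup.concat he h4)
    rcases h with ⟨hcd, ⟨hbc, hda⟩ | ⟨e, he, f, hf, hef⟩⟩ |
      ⟨hac, ⟨had, e, he, f, hf, ⟨h1, h2⟩ | ⟨h1, h2⟩⟩ | ⟨hbc, e, he, hde, ⟨h1, h2⟩ | ⟨f, hf, h1, h2⟩⟩⟩
    · obtain ⟨e, f, hn⟩ := ex a b c d h4
      exact ⟨a, b, c, d, e, f, hn, .inr (.inl ⟨hab, hbc, hcd, hda⟩)⟩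
    · exact ⟨a, b, c, d, e, f, h6 he hf, .inl ⟨hab, hcd, hef⟩⟩
    · exact ⟨a, b, c, d, e, f, h6 he hf, .inr (.inr (.inl ⟨hab, hac, had, h1, h2⟩))⟩
    · exact ⟨a, b, c, d, e, f, h6 he hf, .inr (.inr (.inr (.inl ⟨hab, hac, had, h1, h2⟩)))⟩
    · obtain ⟨f, hn⟩ := ex1 a b c d e (List.Nodup.concat he h4)
      exact ⟨a, b, c, d, e, f, hn,
        .inr (.inr (.inr (.inr (.inr ⟨hab, hbc, hac, hde, h1, h2⟩))))⟩
    · exact ⟨a, b, c, d, e, f, h6 he hf,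
        .inr (.inr (.inr (.inr (.inl ⟨hab, hbc, hac, hde, h1, h2⟩))))⟩
  obtain ⟨a, b, c, d, e, f, hn, h⟩ := key
  obtain ⟨g, rfl, rfl, rfl, rfl, rfl, rfl⟩ := exists_perm_of_nodup hn
  rcases h with h | h | h | h | h | h
  · refine ⟨0, g, ?_⟩
    simp only [stdPattern, Matrix.cons_val, Multiset.insert_eq_cons, Multiset.mem_cons,
      Multiset.mem_singleton, forall_eq_or_imp, forall_eq, Sym2.map_mk]
    exact ⟨hadj _ _ h.1, hadj _ _ h.2.1, hadj _ _ h.2.2⟩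
  · refine ⟨1, g, ?_⟩
    simp only [stdPattern, Matrix.cons_val, Multiset.insert_eq_cons, Multiset.mem_cons,
      Multiset.mem_singleton, forall_eq_or_imp, forall_eq, Sym2.map_mk]
    exact ⟨hadj _ _ h.1, hadj _ _ h.2.1, hadj _ _ h.2.2.1, hadj _ _ h.2.2.2⟩
  · refine ⟨2, g, ?_⟩
    simp only [stdPattern, Matrix.cons_val, Multiset.insert_eq_cons, Multiset.mem_cons,
      Multiset.mem_singleton, forall_eq_or_imp, forall_eq, Sym2.map_mk]
    exact ⟨hadj _ _ h.1, hadj _ _ h.2.1, hadj _ _ h.2.2.1, hadj _ _ h.2.2.2.1, hadj _ _ h.2.2.2.2⟩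
  · refine ⟨3, g, ?_⟩
    simp only [stdPattern, Matrix.cons_val, Multiset.insert_eq_cons, Multiset.mem_cons,
      Multiset.mem_singleton, forall_eq_or_imp, forall_eq, Sym2.map_mk]
    exact ⟨hadj _ _ h.1, hadj _ _ h.2.1, hadj _ _ h.2.2.1, hadj _ _ h.2.2.2.1, hadj _ _ h.2.2.2.2⟩
  · refine ⟨4, g, ?_⟩
    simp only [stdPattern, Matrix.cons_val, Multiset.insert_eq_cons, Multiset.mem_cons,
      Multiset.mem_singleton, forall_eq_or_imp, forall_eq, Sym2.map_mk]
    exact ⟨hadj _ _ h.1, hadj _ _ h.2.1, Sym2.eq_swap ▸ hadj _ _ h.2.2.1, hadj _ _ h.2.2.2.1,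
      hadj _ _ h.2.2.2.2.1, hadj _ _ h.2.2.2.2.2⟩
  · refine ⟨5, g, ?_⟩
    simp only [stdPattern, Matrix.cons_val, Multiset.insert_eq_cons, Multiset.mem_cons,
      Multiset.mem_singleton, forall_eq_or_imp, forall_eq, Sym2.map_mk]
    exact ⟨hadj _ _ h.1, hadj _ _ h.2.1, Sym2.eq_swap ▸ hadj _ _ h.2.2.1, hadj _ _ h.2.2.2.1,
      hadj _ _ h.2.2.2.2.1, hadj _ _ h.2.2.2.2.2⟩

/-- The fifteen pairs of distinct indices. -/
def allPairs : List (Sym2 (Fin 6)) :=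
  [s(0, 1), s(0, 2), s(0, 3), s(0, 4), s(0, 5),
   s(1, 2), s(1, 3), s(1, 4), s(1, 5),
   s(2, 3), s(2, 4), s(2, 5),
   s(3, 4), s(3, 5),
   s(4, 5)]

theorem mem_allPairs : ∀ e : Sym2 (Fin 6), ¬ e.IsDiag → e ∈ allPairs := by decide

theorem sum_missing {t : Multiset (Sym2 (Fin 6))} (ht : t.Nodup) (hd : ∀ e ∈ t, ¬ e.IsDiag)
    (v : Fin 6) : (t.map (missing v)).sum =
      (allPairs.map fun e => if e ∈ t then missing v e else 0).sum := by
  have hn : allPairs.Nodup := by decide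
  rw [← List.sum_toFinset _ hn, ← Finset.sum_filter]
  have : t = (allPairs.toFinset.filter (· ∈ t)).val := by
    refine (Multiset.Nodup.ext ht (Finset.nodup _)).2 fun e => ?_
    simpa using fun h => mem_allPairs e (hd e h)
  conv_lhs => rw [this]
  rfl

theorem exists_pattern {t : Multiset (Sym2 (Fin 6))} (ht : t.Nodup) (hd : ∀ e ∈ t, ¬ e.IsDiag)
    (h : EvenMissing t) (h0 : t ≠ 0) :
    ∃ (k : Fin 6) (f : Equiv.Perm (Fin 6)), ∀ e ∈ stdPattern k, e.map f ∈ t := by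
  -- The indicator carries exclusive or to addition, so the Boolean conditions of the search follow
  -- by linear algebra over `ℤ/2`.
  obtain ⟨c, hc⟩ : ∃ c : Bool → ZMod 2, c = fun b => if b then 1 else 0 := ⟨_, rfl⟩
  have hx : ∀ a b, c (a ^^ b) = c a + c b := by subst hc; decide
  have hinj : ∀ a b, c a = c b → a = b := by subst hc; decide
  have hf : c false = 0 := by subst hc; rfl
  have two : (2 : ZMod 2) = 0 := rfl
  have hv : ∀ v, (allPairs.map fun e => c (decide (e ∈ t)) * missing v e).sum = 0 := by
    intro v
    rw [← h v, sum_missing ht hd]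
    congr 1
    refine List.map_congr_left fun e _ => ?_
    by_cases he : e ∈ t <;> simp [he, hc]
  simp only [allPairs, List.map_cons, List.map_nil, List.sum_cons, List.sum_nil] at hv
  obtain ⟨b01, e01⟩ : ∃ b, b = decide (s(0, 1) ∈ t) := ⟨_, rfl⟩
  obtain ⟨b02, e02⟩ : ∃ b, b = decide (s(0, 2) ∈ t) := ⟨_, rfl⟩
  obtain ⟨b03, e03⟩ : ∃ b, b = decide (s(0, 3) ∈ t) := ⟨_, rfl⟩
  obtain ⟨b04, e04⟩ : ∃ b, b = decide (s(0, 4) ∈ t) := ⟨_, rfl⟩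
  obtain ⟨b05, e05⟩ : ∃ b, b = decide (s(0, 5) ∈ t) := ⟨_, rfl⟩
  obtain ⟨b12, e12⟩ : ∃ b, b = decide (s(1, 2) ∈ t) := ⟨_, rfl⟩
  obtain ⟨b13, e13⟩ : ∃ b, b = decide (s(1, 3) ∈ t) := ⟨_, rfl⟩
  obtain ⟨b14, e14⟩ : ∃ b, b = decide (s(1, 4) ∈ t) := ⟨_, rfl⟩
  obtain ⟨b15, e15⟩ : ∃ b, b = decide (s(1, 5) ∈ t) := ⟨_, rfl⟩
  obtain ⟨b23, e23⟩ : ∃ b, b = decide (s(2, 3) ∈ t) := ⟨_, rfl⟩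
  obtain ⟨b24, e24⟩ : ∃ b, b = decide (s(2, 4) ∈ t) := ⟨_, rfl⟩
  obtain ⟨b25, e25⟩ : ∃ b, b = decide (s(2, 5) ∈ t) := ⟨_, rfl⟩
  obtain ⟨b34, e34⟩ : ∃ b, b = decide (s(3, 4) ∈ t) := ⟨_, rfl⟩
  obtain ⟨b35, e35⟩ : ∃ b, b = decide (s(3, 5) ∈ t) := ⟨_, rfl⟩
  obtain ⟨b45, e45⟩ : ∃ b, b = decide (s(4, 5) ∈ t) := ⟨_, rfl⟩
  simp only [← e01, ← e02, ← e03, ← e04, ← e05, ← e12, ← e13, ← e14, ← e15, ← e23, ← e24, ← e25, ← e34, ← e35, ← e45] at hv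
  have h0' := hv 0
  have h1' := hv 1
  have h2' := hv 2
  have h3' := hv 3
  have h4' := hv 4
  have h5' := hv 5
  simp [missing] at h0' h1' h2' h3' h4' h5'
  -- Edges missing both `0` and `1` cancel in the difference of the two conditions; the remaining
  -- signs disappear because two is zero.
  have q1 : b15 = (b02 ^^ b03 ^^ b04 ^^ b05 ^^ b12 ^^ b13 ^^ b14) := hinj _ _ (by
    simp only [hx]
    linear_combination h0' - h1' - (c b12 + c b13 + c b14) * two)
  have q2 : b25 = (b01 ^^ b03 ^^ b04 ^^ b05 ^^ b12 ^^ b23 ^^ b24) := hinj _ _ (by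
    simp only [hx]
    linear_combination h0' - h2' - (c b12 + c b23 + c b24) * two)
  have q3 : b35 = (b01 ^^ b02 ^^ b04 ^^ b05 ^^ b13 ^^ b23 ^^ b34) := hinj _ _ (by
    simp only [hx]
    linear_combination h0' - h3' - (c b13 + c b23 + c b34) * two)
  have q4 : b45 = (b01 ^^ b02 ^^ b03 ^^ b05 ^^ b14 ^^ b24 ^^ b34) := hinj _ _ (by
    simp only [hx]
    linear_combination h0' - h4' - (c b14 + c b24 + c b34) * two)
  have q5 : (b01 ^^ b02 ^^ b03 ^^ b04 ^^ b12 ^^ b13 ^^ b14 ^^ b23 ^^ b24 ^^ b34) = false := hinj _ _ (by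
    simp only [hx, hf]
    linear_combination h5')
  have hs := search_ofRows b01 b02 b03 b04 b12 b13 b14 b23 b24 b34 b05 q5
  simp only [← q1, ← q2, ← q3, ← q4] at hs
  refine exists_pattern_of_search ?_ (hs ?_)
  · clear hs q1 q2 q3 q4 q5 hv h0' h1' h2' h3' h4' h5'
    have hF : ∀ e : Sym2 (Fin 6), false = true → e ∈ t := fun _ h => (Bool.false_ne_true h).elim
    have m01 : b01 = true → s(0, 1) ∈ t := fun h => of_decide_eq_true (e01 ▸ h)
    have m02 : b02 = true → s(0, 2) ∈ t := fun h => of_decide_eq_true (e02 ▸ h)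
    have m03 : b03 = true → s(0, 3) ∈ t := fun h => of_decide_eq_true (e03 ▸ h)
    have m04 : b04 = true → s(0, 4) ∈ t := fun h => of_decide_eq_true (e04 ▸ h)
    have m05 : b05 = true → s(0, 5) ∈ t := fun h => of_decide_eq_true (e05 ▸ h)
    have m12 : b12 = true → s(1, 2) ∈ t := fun h => of_decide_eq_true (e12 ▸ h)
    have m13 : b13 = true → s(1, 3) ∈ t := fun h => of_decide_eq_true (e13 ▸ h)
    have m14 : b14 = true → s(1, 4) ∈ t := fun h => of_decide_eq_true (e14 ▸ h)
    have m15 : b15 = true → s(1, 5) ∈ t := fun h => of_decide_eq_true (e15 ▸ h)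
    have m23 : b23 = true → s(2, 3) ∈ t := fun h => of_decide_eq_true (e23 ▸ h)
    have m24 : b24 = true → s(2, 4) ∈ t := fun h => of_decide_eq_true (e24 ▸ h)
    have m25 : b25 = true → s(2, 5) ∈ t := fun h => of_decide_eq_true (e25 ▸ h)
    have m34 : b34 = true → s(3, 4) ∈ t := fun h => of_decide_eq_true (e34 ▸ h)
    have m35 : b35 = true → s(3, 5) ∈ t := fun h => of_decide_eq_true (e35 ▸ h)
    have m45 : b45 = true → s(4, 5) ∈ t := fun h => of_decide_eq_true (e45 ▸ h)
    intro i j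
    fin_cases i <;> fin_cases j
    exacts [hF _, m01, m02, m03, m04, m05, fun h => Sym2.eq_swap ▸ m01 h, hF _, m12, m13, m14,
      m15, fun h => Sym2.eq_swap ▸ m02 h, fun h => Sym2.eq_swap ▸ m12 h, hF _, m23, m24,
      m25, fun h => Sym2.eq_swap ▸ m03 h, fun h => Sym2.eq_swap ▸ m13 h,
      fun h => Sym2.eq_swap ▸ m23 h, hF _, m34, m35, fun h => Sym2.eq_swap ▸ m04 h,
      fun h => Sym2.eq_swap ▸ m14 h, fun h => Sym2.eq_swap ▸ m24 h,
      fun h => Sym2.eq_swap ▸ m34 h, hF _, m45, fun h => Sym2.eq_swap ▸ m05 h,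
      fun h => Sym2.eq_swap ▸ m15 h, fun h => Sym2.eq_swap ▸ m25 h,
      fun h => Sym2.eq_swap ▸ m35 h, fun h => Sym2.eq_swap ▸ m45 h, hF _]
  · obtain ⟨e, he⟩ := Multiset.exists_mem_of_ne_zero h0
    have := mem_allPairs e (hd e he)
    simp only [allPairs, List.mem_cons, List.not_mem_nil, or_false] at this
    clear hs q1 q2 q3 q4 q5 hv h0' h1' h2' h3' h4' h5'
    simp only [Bool.or_eq_true, e01, e02, e03, e04, e05, e12, e13, e14, e15, e23, e24, e25, e34, e35, e45,
      decide_eq_true_eq]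
    rcases this with rfl | rfl | rfl | rfl | rfl | rfl | rfl | rfl | rfl | rfl | rfl | rfl | rfl | rfl | rfl <;>
      simp only [he, true_or, or_true]

theorem IsProduct3.eq_map {s : Multiset OddPair} :
    IsProduct3 s ↔ ∃ f : Equiv.Perm (Fin 6), s.map Subtype.val = (stdPattern 0).map (Sym2.map f) :=
  Iff.rfl

theorem IsProduct4.eq_map {s : Multiset OddPair} :
    IsProduct4 s ↔ ∃ f : Equiv.Perm (Fin 6), s.map Subtype.val = (stdPattern 1).map (Sym2.map f) :=
  Iff.rfl

theorem IsProduct5.eq_map {s : Multiset OddPair} :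
    IsProduct5 s ↔ ∃ f : Equiv.Perm (Fin 6), s.map Subtype.val = (stdPattern 2).map (Sym2.map f) ∨
      s.map Subtype.val = (stdPattern 3).map (Sym2.map f) := by
  refine exists_congr fun f => ?_
  constructor
  · rintro ⟨m, rfl | rfl, h⟩
    exacts [.inl h, .inr h]
  · rintro (h | h)
    exacts [⟨_, .inl rfl, h⟩, ⟨_, .inr rfl, h⟩]

theorem IsProduct6.eq_map {s : Multiset OddPair} :
    IsProduct6 s ↔ ∃ f : Equiv.Perm (Fin 6), s.map Subtype.val = (stdPattern 4).map (Sym2.map f) ∨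
      s.map Subtype.val = (stdPattern 5).map (Sym2.map f) := by
  refine exists_congr fun f => ?_
  constructor
  · rintro ⟨m, rfl | rfl, h⟩
    exacts [.inl h, .inr h]
  · rintro (h | h)
    exacts [⟨_, .inl rfl, h⟩, ⟨_, .inr rfl, h⟩]

theorem isListed_iff {s : Multiset OddPair} :
    IsListed s ↔ IsSquare s ∨ IsProduct3 s ∨ IsProduct4 s ∨ IsProduct5 s ∨ IsProduct6 s := by
  rw [IsProduct3.eq_map, IsProduct4.eq_map, IsProduct5.eq_map, IsProduct6.eq_map, IsListed]
  refine or_congr_right ⟨?_, ?_⟩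
  · rintro ⟨k, f, h⟩
    fin_cases k
    exacts [.inl ⟨f, h⟩, .inr (.inl ⟨f, h⟩), .inr (.inr (.inl ⟨f, .inl h⟩)),
      .inr (.inr (.inl ⟨f, .inr h⟩)), .inr (.inr (.inr ⟨f, .inl h⟩)),
      .inr (.inr (.inr ⟨f, .inr h⟩))]
  · rintro (⟨f, h⟩ | ⟨f, h⟩ | ⟨f, h | h⟩ | ⟨f, h | h⟩)
    exacts [⟨_, f, h⟩, ⟨_, f, h⟩, ⟨_, f, h⟩, ⟨_, f, h⟩, ⟨_, f, h⟩, ⟨_, f, h⟩]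

/-! ### The listed multigraphs: parity, minimality and completeness -/

theorem stdPattern_nodup (k : Fin 6) : (stdPattern k).Nodup := by
  revert k; decide

theorem missing_map (f : Equiv.Perm (Fin 6)) (v : Fin 6) (e : Sym2 (Fin 6)) :
    missing v (e.map f) = missing (f.symm v) e := by
  have : v ∈ e.map f ↔ f.symm v ∈ e := by
    rw [Sym2.mem_map]
    constructor
    · rintro ⟨a, ha, rfl⟩
      simpa using ha
    · intro h
      exact ⟨_, h, by simp⟩
  simp only [missing, this]

theorem evenMissing_stdPattern (k v : Fin 6) : ((stdPattern k).map (missing v)).sum = 0 := by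
  revert k v; decide

/-- A finite check on the subgraphs of the six standard graphs; it is the combinatorial source of
independence. -/
theorem le_stdPattern (k : Fin 6) : ∀ t ∈ (stdPattern k).powerset,
    Multiset.card t = 0 ∨ Multiset.card t = Multiset.card (stdPattern k) ∨
      ∃ v, (t.map (missing v)).sum ≠ 0 := by
  revert k; decide +kernel

theorem stdPattern_card (k : Fin 6) : Multiset.card (stdPattern k) ≠ 0 := by
  revert k; decide

theorem exists_not_mem (e : Sym2 (Fin 6)) : ∃ v, missing v e ≠ 0 := by
  revert e; decide

theorem IsListed.evenMissing {s : Multiset OddPair} (h : IsListed s) :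
    EvenMissing (s.map Subtype.val) := by
  intro v
  rcases h with ⟨N, rfl⟩ | ⟨k, f, h⟩
  · simp [CharTwo.add_self_eq_zero]
  · rw [h, Multiset.map_map]
    simp only [Function.comp_def, missing_map]
    exact evenMissing_stdPattern k _

theorem IsListed.ne_zero {s : Multiset OddPair} (h : IsListed s) : s ≠ 0 := by
  rcases h with ⟨N, rfl⟩ | ⟨k, f, h⟩
  · simp
  · rintro rfl
    exact stdPattern_card k (by simpa using (congrArg Multiset.card h).symm)

/-- A single edge misses some vertex, which settles double edges; the other cases are transported to
the standard graphs by the inverse permutation. -/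
theorem IsListed.eq_of_le {s s' : Multiset OddPair} (h : IsListed s) (hle : s' ≤ s) (h0 : s' ≠ 0)
    (he : EvenMissing (s'.map Subtype.val)) : s' = s := by
  refine Multiset.eq_of_le_of_card_le hle ?_
  rcases h with ⟨N, rfl⟩ | ⟨k, f, h⟩
  · by_contra hlt
    have h1 : Multiset.card s' = 1 := by
      have := Multiset.card_pos.2 h0
      simp at hlt
      omega
    obtain ⟨M, rfl⟩ := Multiset.card_eq_one.1 h1
    obtain ⟨v, hv⟩ := exists_not_mem M.1
    exact hv (by simpa using he v)
  · have hle' : (s'.map Subtype.val).map (Sym2.map f.symm) ≤ stdPattern k := by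
      have := Multiset.map_le_map (f := Sym2.map f.symm) (Multiset.map_le_map (f := Subtype.val) hle)
      rwa [h, Multiset.map_map _ (Sym2.map f), ← Sym2.map_comp, Equiv.symm_comp_self, Sym2.map_id,
        Multiset.map_id] at this
    have hc : Multiset.card s = Multiset.card (stdPattern k) := by
      simpa using congrArg Multiset.card h
    rcases le_stdPattern k _ (Multiset.mem_powerset.2 hle') with h1 | h1 | ⟨v, hv⟩
    · simp [h0] at h1
    · simp at h1
      omega
    · refine absurd ?_ hv
      rw [Multiset.map_map]
      simp only [Function.comp_def, missing_map]
      exact he _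

/-- A repeated edge is already a listed multigraph; without repetition the multigraph is an ordinary
graph, to which the exhaustive search applies. -/
theorem exists_le_isListed {s : Multiset OddPair} (h0 : s ≠ 0)
    (he : EvenMissing (s.map Subtype.val)) : ∃ s' ≤ s, IsListed s' := by
  classical
  by_cases hn : s.Nodup
  · obtain ⟨k, f, h⟩ := exists_pattern (hn.map Subtype.val_injective)
      (fun e he => by obtain ⟨N, -, rfl⟩ := Multiset.mem_map.1 he; exact N.2) he (by simpa using h0)
    refine ⟨s.filter fun N => N.1 ∈ (stdPattern k).map (Sym2.map f), Multiset.filter_le _ _,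
      .inr ⟨k, f, ?_⟩⟩
    refine (Multiset.Nodup.ext ((hn.filter _).map Subtype.val_injective)
      ((stdPattern_nodup k).map (Sym2.map.injective f.injective))).2 fun e => ?_
    simp only [Multiset.mem_map, Multiset.mem_filter]
    constructor
    · rintro ⟨N, ⟨-, h⟩, rfl⟩
      exact h
    · rintro ⟨e', he', rfl⟩
      obtain ⟨N, hN, hN'⟩ := Multiset.mem_map.1 (h e' he')
      exact ⟨N, ⟨hN, e', he', hN'.symm⟩, hN'⟩
  · rw [Multiset.nodup_iff_ne_cons_cons] at hn
    push Not at hn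
    obtain ⟨N, t, rfl⟩ := hn
    exact ⟨{N, N}, Multiset.cons_le_cons _ (Multiset.cons_le_cons _ (Multiset.zero_le _)),
      .inl ⟨N, rfl⟩⟩

/-- The sign character of a multiset of pairs under an automorphism. -/
def multExp (g : Fin 5) (s : Multiset OddPair) : ZMod 2 := (s.map (pairExp g)).sum

/-- Coefficients that express the functions `missing v` through the exponents `pairExp g`. -/
def missingCoeff : Fin 6 → Fin 5 → ZMod 2 :=
  ![![1, 1, 0, 1, 1], ![1, 1, 1, 0, 1], ![0, 1, 0, 1, 1], ![1, 0, 1, 0, 1], ![1, 0, 0, 0, 1],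
    ![0, 1, 0, 0, 1]]

/-- Five characters suffice for six vertices: every edge misses four vertices, so the six functions
add up to zero modulo two. -/
theorem missing_eq_sum : ∀ (v : Fin 6) (N : OddPair),
    missing v N.1 = ∑ g, missingCoeff v g * pairExp g N := by
  decide +kernel

theorem evenMissing_of_multExp {s : Multiset OddPair} (h : ∀ g, multExp g s = 0) :
    EvenMissing (s.map Subtype.val) := by
  intro v
  have : ∀ s : Multiset OddPair, ((s.map Subtype.val).map (missing v)).sum =
      ∑ g, missingCoeff v g * multExp g s := by
    intro s
    induction s using Multiset.induction with
    | empty => simp [multExp]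
    | cons N s ih =>
      simp only [Multiset.map_cons, Multiset.sum_cons, ih, missing_eq_sum, multExp, mul_add,
        Finset.sum_add_distrib]
  rw [this]
  exact Finset.sum_eq_zero fun g _ => by rw [h, mul_zero]

/-! ### Even characteristics as partitions of the odd ones into two triples -/

/-- The ten triples containing `0`, one for each partition into two triples. -/
def split : Fin 10 → Finset (Fin 6) :=
  ![{0, 1, 2}, {0, 1, 3}, {0, 1, 4}, {0, 1, 5}, {0, 2, 3}, {0, 2, 4}, {0, 2, 5}, {0, 3, 4},
    {0, 3, 5}, {0, 4, 5}]

theorem isEven_sum_of_card : ∀ A ∈ (Finset.univ : Finset (Fin 6)).powersetCard 3,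
    IsEven (∑ i ∈ A, oddChar i) := by
  decide +kernel

/-- The six odd characteristics add up to zero, so complementary triples have the same sum; by
enumeration there is no other coincidence, and the twenty triples give ten even characteristics. -/
theorem eq_or_eq_compl_of_sum_eq : ∀ A ∈ (Finset.univ : Finset (Fin 6)).powersetCard 3,
    ∀ B ∈ (Finset.univ : Finset (Fin 6)).powersetCard 3,
    ∑ i ∈ A, oddChar i = ∑ i ∈ B, oddChar i → A = B ∨ A = Bᶜ := by
  decide +kernel

theorem sum_compl_eq : ∀ A ∈ (Finset.univ : Finset (Fin 6)).powersetCard 3,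
    ∑ i ∈ Aᶜ, oddChar i = ∑ i ∈ A, oddChar i := by
  decide +kernel

theorem card_split (k : Fin 10) : (split k).card = 3 := by revert k; decide

theorem zero_mem_split (k : Fin 10) : 0 ∈ split k := by revert k; decide

theorem split_injective : Function.Injective split := by unfold Function.Injective; decide

theorem sum_map_perm (f : Equiv.Perm (Fin 6)) (A : Finset (Fin 6)) :
    ∑ i ∈ A, oddChar (f i) = ∑ i ∈ A.map f.toEmbedding, oddChar i := by
  simp

theorem map_mem_powersetCard (f : Equiv.Perm (Fin 6)) {A : Finset (Fin 6)} (hA : A.card = 3) :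
    A.map f.toEmbedding ∈ (Finset.univ : Finset (Fin 6)).powersetCard 3 := by
  simp [Finset.mem_powersetCard, hA]

/-- The even characteristic attached to a partition into two triples. -/
def splitChar (f : Equiv.Perm (Fin 6)) (k : Fin 10) : EvenChar :=
  ⟨∑ i ∈ split k, oddChar (f i), by
    rw [sum_map_perm]
    exact isEven_sum_of_card _ (map_mem_powersetCard f (card_split k))⟩

theorem splitChar_injective (f : Equiv.Perm (Fin 6)) : Function.Injective (splitChar f) := by
  intro k k' h
  have h' := congrArg Subtype.val h
  simp only [splitChar, sum_map_perm] at h'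
  rcases eq_or_eq_compl_of_sum_eq _ (map_mem_powersetCard f (card_split k)) _
    (map_mem_powersetCard f (card_split k')) h' with h1 | h1
  · exact split_injective (Finset.map_injective _ h1)
  · exfalso
    have h0 : f 0 ∈ (split k).map f.toEmbedding :=
      (Finset.mem_map' f.toEmbedding).2 (zero_mem_split k)
    rw [h1, Finset.mem_compl] at h0
    exact h0 ((Finset.mem_map' f.toEmbedding).2 (zero_mem_split k'))

theorem splitChar_bijective (f : Equiv.Perm (Fin 6)) : Function.Bijective (splitChar f) :=
  (Fintype.bijective_iff_injective_and_card _).2 ⟨splitChar_injective f, by decide +kernel⟩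

/-- The partition with a given triple as one of its halves. -/
def splitIdx (A : Finset (Fin 6)) : Fin 10 :=
  ((List.finRange 10).find? fun k => decide (A = split k ∨ A = (split k)ᶜ)).getD 0

theorem splitIdx_spec : ∀ A ∈ (Finset.univ : Finset (Fin 6)).powersetCard 3,
    A = split (splitIdx A) ∨ A = (split (splitIdx A))ᶜ := by
  decide +kernel

/-- The partitions that do not separate the indices of a pair. -/
def together (e : Sym2 (Fin 6)) : Multiset (Fin 10) :=
  (Finset.univ.filter fun k => (∀ x ∈ e, x ∈ split k) ∨ ∀ x ∈ e, x ∉ split k).val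

/-- A partition that keeps `i` and `j` together is determined by the third member `l` of their
triple; this translates Rosenhain's product into partitions. -/
theorem map_splitIdx : ∀ i j : Fin 6, i ≠ j →
    ((Finset.univ.filter fun l => ¬ (l = i ∨ l = j)).val.map fun l => splitIdx {i, j, l}) =
      together s(i, j) := by
  decide +kernel

theorem splitChar_splitIdx (f : Equiv.Perm (Fin 6)) {A : Finset (Fin 6)} (hA : A.card = 3) :
    (splitChar f (splitIdx A) : Characteristic) = ∑ x ∈ A, oddChar (f x) := by
  have hA' : A ∈ (Finset.univ : Finset (Fin 6)).powersetCard 3 := by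
    simp [Finset.mem_powersetCard, hA]
  change ∑ x ∈ split (splitIdx A), oddChar (f x) = _
  rcases splitIdx_spec A hA' with h | h
  · rw [← h]
  · rw [eq_compl_comm.1 h, sum_map_perm, sum_map_perm,
      ← sum_compl_eq _ (map_mem_powersetCard f hA)]
    refine Finset.sum_congr ?_ fun _ _ => rfl
    ext x
    simp

theorem splitChar_triple (f : Equiv.Perm (Fin 6)) {i j l : Fin 6} (hij : i ≠ j) (hil : l ≠ i)
    (hjl : l ≠ j) : (splitChar f (splitIdx {i, j, l}) : Characteristic) =
      oddChar (f i) + oddChar (f j) + oddChar (f l) := by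
  rw [splitChar_splitIdx f (Finset.card_eq_three.2 ⟨i, j, l, hij, hil.symm, hjl.symm, rfl⟩),
    Finset.sum_insert (by simp [hij, hil.symm]), Finset.sum_insert (by simp [hjl.symm]),
    Finset.sum_singleton, add_assoc]

theorem mk_inf_sup {α : Type*} [LinearOrder α] (e : Sym2 α) : s(e.inf, e.sup) = e := by
  induction e using Sym2.ind with
  | _ i j =>
    rcases le_total i j with h | h
    · simp [h]
    · simp [h, Sym2.eq_swap]

theorem pairProd_eq_of_eq {N : OddPair} {a b : Fin 6} (h : N.1 = s(a, b)) (τ : SiegelHalfPlane) :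
    pairProd N τ = ∏ l, if l = a ∨ l = b then 1
      else thetaConst (oddChar a + oddChar b + oddChar l) τ := by
  have h1 : s(N.1.inf, N.1.sup) = s(a, b) := by rw [← h, mk_inf_sup]
  rcases Sym2.eq_iff.1 h1 with ⟨h2, h3⟩ | ⟨h2, h3⟩
  · rw [pairProd, h2, h3]
  · rw [pairProd, h2, h3]
    refine Finset.prod_congr rfl fun l _ => ?_
    simp only [or_comm, add_comm (oddChar b)]

theorem pairProd_eq_together (f : Equiv.Perm (Fin 6)) {N : OddPair} {e : Sym2 (Fin 6)}
    (h : N.1 = e.map f) (τ : SiegelHalfPlane) :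
    pairProd N τ = ((together e).map fun k => thetaConst (splitChar f k) τ).prod := by
  induction e using Sym2.ind with
  | _ i j =>
    rw [Sym2.map_mk] at h
    have hij : i ≠ j := by
      rintro rfl
      exact N.2 (h ▸ rfl)
    rw [pairProd_eq_of_eq h, ← map_splitIdx i j hij, Multiset.map_map, ← Equiv.prod_comp f]
    have : ∀ g : Fin 6 → ℂ, ∏ l, (if l = i ∨ l = j then 1 else g l) =
        ∏ l ∈ Finset.univ.filter fun l => ¬ (l = i ∨ l = j), g l := by
      intro g
      rw [Finset.prod_filter]
      exact Finset.prod_congr rfl fun l _ => by split_ifs <;> simp_all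
    simp only [f.injective.eq_iff]
    rw [this]
    refine Finset.prod_congr rfl fun l hl => ?_
    simp only [Finset.mem_filter, not_or] at hl
    rw [Function.comp_apply, splitChar_triple f hij hl.2.1 hl.2.2]

/-- The exponent of each theta constant is the number of edges not separated by its partition. Since
the permutation is carried by `splitChar`, this count is needed only for the standard graphs. -/
theorem prod_jacD (f : Equiv.Perm (Fin 6)) {s : Multiset OddPair} {t : Multiset (Sym2 (Fin 6))}
    (h : s.map Subtype.val = t.map (Sym2.map f)) : ∃ ε : ℤˣ, ∀ τ,
      (s.map fun N => jacD N τ).prod = ((ε : ℤ) : ℂ) *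
        ((t.bind together).map fun k => thetaConst (splitChar f k) τ).prod := by
  refine ⟨(s.map pairSign).prod, fun τ => ?_⟩
  induction t using Multiset.induction generalizing s with
  | empty =>
    have : s = 0 := by simpa using h
    simp [this]
  | cons e t ih =>
    rw [Multiset.map_cons] at h
    obtain ⟨N, hN, hNe⟩ := Multiset.mem_map.1 (h.symm ▸ Multiset.mem_cons_self _ _ :
      Sym2.map f e ∈ s.map Subtype.val)
    obtain ⟨s', rfl⟩ := Multiset.exists_cons_of_mem hN
    rw [Multiset.map_cons, hNe, Multiset.cons_inj_right] at h
    simp only [Multiset.map_cons, Multiset.prod_cons, ih h, jacD_eq N, pairProd_eq_together f hNe,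
      Multiset.cons_bind, Multiset.map_add, Multiset.prod_add]
    push_cast
    ring

/-! ### The relations of the system -/

theorem substitution_monD (s : Multiset OddPair) (τ : SiegelHalfPlane) :
    substitution (monD s) τ = (s.map fun N => jacD N τ).prod := by
  induction s using Multiset.induction with
  | empty => simp [monD]
  | cons N s ih =>
    rw [monD] at ih
    simp [monD, substitution] at ih ⊢
    simp [ih]

theorem substitution_monTheta (t : Multiset (Sym2 EvenChar)) (τ : SiegelHalfPlane) :
    substitution (monTheta t) τ = (t.map fun p => thetaSq p τ).prod := by
  induction t using Multiset.induction with
  | empty => simp [monTheta]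
  | cons p t ih =>
    rw [monTheta] at ih
    simp [monTheta, substitution] at ih ⊢
    simp [ih]

theorem mem_relations {G : RelRing} : G ∈ relations ↔ ∀ τ, substitution G τ = 0 := by
  rw [relations, RingHom.mem_ker]
  exact funext_iff

theorem binomial_mem_relations {s : Multiset OddPair} {ε : ℤˣ} {t : Multiset (Sym2 EvenChar)} :
    binomial s ε t ∈ relations ↔ ∀ τ, (s.map fun N => jacD N τ).prod =
      ((ε : ℤ) : ℂ) * (t.map fun p => thetaSq p τ).prod := by
  rw [mem_relations]
  refine forall_congr' fun τ => ?_
  rw [binomial, map_sub, map_mul, ← algebraMap_eq, AlgHom.commutes, Pi.sub_apply, Pi.mul_apply,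
    substitution_monD, substitution_monTheta, sub_eq_zero]
  rfl

theorem thetaSq_mk (m n : EvenChar) (τ : SiegelHalfPlane) :
    thetaSq s(m, n) τ = thetaConst m τ ^ 2 * thetaConst n τ ^ 2 := rfl

/-- Each partition leaves an even number of edges of the graph unseparated, so theta constants occur
in squares; the explicit multiset records these multiplicities. -/
theorem rc2_nonempty {s : Multiset OddPair} (hs : IsProduct3 s) : (rc2 s).Nonempty := by
  obtain ⟨f, hf⟩ := IsProduct3.eq_map.1 hs
  obtain ⟨ε, h⟩ := prod_jacD f hf
  have hb : (stdPattern 0).bind together =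
    {0, 0, 1, 1, 2, 2, 3, 3, 4, 4, 9, 9} := by decide +kernel
  rw [hb] at h
  refine ⟨_, ?_, hs, ε, splitChar f ∘ ![0, 1, 2, 3, 4, 9],
    (splitChar_injective f).comp (by unfold Function.Injective; decide), rfl⟩
  rw [binomial_mem_relations]
  intro τ
  rw [h]
  simp [thetaSq_mk]
  ring

theorem rc3_nonempty {s : Multiset OddPair} (hs : IsProduct4 s) : (rc3 s).Nonempty := by
  obtain ⟨f, hf⟩ := IsProduct4.eq_map.1 hs
  obtain ⟨ε, h⟩ := prod_jacD f hf
  have hb : (stdPattern 1).bind together =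
    {0, 0, 1, 1, 2, 2, 3, 3, 4, 4, 7, 7, 8, 8, 9, 9} := by decide +kernel
  rw [hb] at h
  refine ⟨_, ?_, hs, ε, splitChar f ∘ ![0, 1, 2, 3, 4, 7, 8, 9],
    (splitChar_injective f).comp (by unfold Function.Injective; decide), rfl⟩
  rw [binomial_mem_relations]
  intro τ
  rw [h]
  simp [thetaSq_mk]
  ring

theorem rc4_nonempty {s : Multiset OddPair} (hs : IsProduct5 s) : (rc4 s).Nonempty := by
  obtain ⟨f, hf | hf⟩ := IsProduct5.eq_map.1 hs
  · obtain ⟨ε, h⟩ := prod_jacD f hf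
    -- The partition `4`, `{0, 2, 3} | {1, 4, 5}`, occurs four times and the partition `9` never;
    -- this is the case with repeated factors.
    have hb : (stdPattern 2).bind together =
      {0, 0, 1, 1, 2, 2, 3, 3, 4, 4, 4, 4, 5, 5, 6, 6, 7, 7, 8, 8} := by decide +kernel
    rw [hb] at h
    refine ⟨_, ?_, hs, ε, splitChar f ∘ ![0, 1, 2, 3, 4, 4, 5, 6, 7, 8], rfl⟩
    rw [binomial_mem_relations]
    intro τ
    rw [h]
    simp [thetaSq_mk]
    ring
  · obtain ⟨ε, h⟩ := prod_jacD f hf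
    have hb : (stdPattern 3).bind together =
      {0, 0, 1, 1, 2, 2, 3, 3, 4, 4, 5, 5, 6, 6, 7, 7, 8, 8, 9, 9} := by decide +kernel
    rw [hb] at h
    refine ⟨_, ?_, hs, ε, splitChar f ∘ ![0, 1, 2, 3, 4, 5, 6, 7, 8, 9], rfl⟩
    rw [binomial_mem_relations]
    intro τ
    rw [h]
    simp [thetaSq_mk]
    ring

theorem rc5_nonempty {s : Multiset OddPair} (hs : IsProduct6 s) : (rc5 s).Nonempty := by
  obtain ⟨f, hf | hf⟩ := IsProduct6.eq_map.1 hs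
  · obtain ⟨ε, h⟩ := prod_jacD f hf
    -- The partition into the two triangles separates none of the six edges; its two additional
    -- squares give `p = q`.
    have hb : (stdPattern 4).bind together =
      {0, 0, 1, 1, 2, 2, 3, 3, 4, 4, 5, 5, 6, 6, 7, 7, 8, 8, 9, 9, 0, 0, 0, 0} := by
        decide +kernel
    rw [hb] at h
    refine ⟨_, ?_, hs, ε, splitChar f, splitChar f 0, splitChar f 0, splitChar_bijective f, rfl⟩
    rw [binomial_mem_relations]
    intro τ
    rw [h]
    simp [thetaSq_mk]
    ring
  · obtain ⟨ε, h⟩ := prod_jacD f hf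
    -- Each of the two triangles determines a partition, `0` and `7`, and each occurs with one
    -- additional square.
    have hb : (stdPattern 5).bind together =
      {0, 0, 1, 1, 2, 2, 3, 3, 4, 4, 5, 5, 6, 6, 7, 7, 8, 8, 9, 9, 0, 0, 7, 7} := by
        decide +kernel
    rw [hb] at h
    refine ⟨_, ?_, hs, ε, splitChar f, splitChar f 0, splitChar f 7, splitChar_bijective f, rfl⟩
    rw [binomial_mem_relations]
    intro τ
    rw [h]
    simp [thetaSq_mk]
    ring

/-! ### The squares of the functions `D(N)` -/

/-- The four even characteristics whose theta constants divide `D(N)`. -/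
def pairSet (N : OddPair) : Finset EvenChar :=
  Finset.univ.filter fun m => ∃ l, ¬ (l = N.1.inf ∨ l = N.1.sup) ∧
    (m : Characteristic) = oddChar N.1.inf + oddChar N.1.sup + oddChar l

theorem pairSet_mem_aux : ∀ N : OddPair, (pairSet N).card = 4 ∧
    ∀ T ∈ (pairSet N).powersetCard 3, IsOdd (∑ m ∈ T, (m : Characteristic)) := by
  decide +kernel

/-- Enumeration of all four-element sets of even characteristics shows that those with odd triple
sums come from pairs of odd characteristics. -/
theorem exists_pairSet_aux : ((Finset.univ : Finset EvenChar).powersetCard 4).filter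
    (fun M : Finset EvenChar => ∀ T ∈ M.powersetCard 3, IsOdd (∑ m ∈ T, (m : Characteristic))) ⊆
      Finset.univ.image pairSet := by
  decide +kernel

theorem mem_C4Minus {M : Finset EvenChar} : M ∈ C4Minus ↔ ∃ N, pairSet N = M := by
  constructor
  · rintro ⟨h, h'⟩
    simpa using exists_pairSet_aux (Finset.mem_filter.2
      ⟨Finset.mem_powersetCard.2 ⟨Finset.subset_univ M, h⟩, fun T hT =>
        h' T (Finset.mem_powersetCard.1 hT).1 (Finset.mem_powersetCard.1 hT).2⟩)
  · rintro ⟨N, rfl⟩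
    exact ⟨(pairSet_mem_aux N).1, fun T hT hc =>
      (pairSet_mem_aux N).2 T (Finset.mem_powersetCard.2 ⟨hT, hc⟩)⟩

theorem pairProd_eq_prod (N : OddPair) (τ : SiegelHalfPlane) :
    pairProd N τ = ∏ m ∈ pairSet N, thetaConst m τ := by
  have : pairProd N τ = ∏ l ∈ Finset.univ.filter fun l => ¬ (l = N.1.inf ∨ l = N.1.sup),
      thetaConst (oddChar N.1.inf + oddChar N.1.sup + oddChar l) τ := by
    rw [pairProd, Finset.prod_filter]
    exact Finset.prod_congr rfl fun l _ => by split_ifs <;> simp_all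
  rw [this]
  refine Finset.prod_bij (fun l hl => ⟨oddChar N.1.inf + oddChar N.1.sup + oddChar l, ?_⟩)
    ?_ ?_ ?_ ?_
  · rw [Finset.mem_filter, not_or] at hl
    exact isEven_triple _ _ _ (inf_ne_sup N) hl.2.1 hl.2.2
  · intro l hl
    exact Finset.mem_filter.2 ⟨Finset.mem_univ _, l, (Finset.mem_filter.1 hl).2, rfl⟩
  · intro l _ l' _ h
    exact oddChar_injective (add_left_cancel (congrArg Subtype.val h))
  · intro m hm
    obtain ⟨l, hl, h⟩ := (Finset.mem_filter.1 hm).2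
    exact ⟨l, Finset.mem_filter.2 ⟨Finset.mem_univ _, hl⟩, Subtype.ext h.symm⟩
  · intro l _
    rfl

theorem jacD_sq (N : OddPair) (τ : SiegelHalfPlane) :
    jacD N τ ^ 2 = ∏ m ∈ pairSet N, thetaConst m τ ^ 2 := by
  have h : (((pairSign N : ℤ) : ℂ)) ^ 2 = 1 := by
    rw [sq]
    exact units_cast_mul_self _
  rw [jacD_eq, mul_pow, h, one_mul, pairProd_eq_prod, Finset.prod_pow]

theorem rc1_nonempty {s : Multiset OddPair} (hs : IsSquare s) : (rc1 s).Nonempty := by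
  obtain ⟨N, rfl⟩ := hs
  obtain ⟨a, b, c, d, hab, hac, had, hbc, hbd, hcd, hM⟩ :=
    Finset.card_eq_four.1 (pairSet_mem_aux N).1
  refine ⟨_, ?_, ⟨N, rfl⟩, a, b, c, d, mem_C4Minus.2 ⟨N, hM⟩, rfl⟩
  rw [binomial_mem_relations]
  intro τ
  have h := jacD_sq N τ
  rw [hM, Finset.prod_insert (by simp [hab, hac, had]), Finset.prod_insert (by simp [hbc, hbd]),
    Finset.prod_insert (by simp [hcd]), Finset.prod_singleton] at h
  simp [thetaSq_mk]
  linear_combination h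

theorem sgn_injective : Function.Injective sgn := by
  intro x y h
  rcases zmod_two_cases x with rfl | rfl <;> rcases zmod_two_cases y with rfl | rfl <;>
    first | rfl | norm_num [sgn, ZMod.val_one] at h

theorem eq_of_missing_add : ∀ N N' : OddPair, (∀ v, missing v N.1 + missing v N'.1 = 0) →
    N = N' := by
  decide +kernel

/-- The difference of squares factors, and by the identity principle a product of holomorphic
functions vanishes only if one factor does. -/
theorem eq_or_eq_neg_of_jacD_sq_eq {N N' : OddPair} (h : ∀ τ, jacD N τ ^ 2 = jacD N' τ ^ 2) :
    (∀ τ, jacD N τ = jacD N' τ) ∨ ∀ τ, jacD N τ = -jacD N' τ := by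
  have hN : ∀ (N : OddPair) {p q r : ℂ} (hp : InSiegel p q r), jacD N (siegelMk p q r hp) =
      jac (oddChar N.1.inf) (oddChar N.1.sup) p q r := by
    intro N p q r hp
    rw [jacD, jacobian_eq]
    rfl
  have hL : ∀ N : OddPair, LineHol (jac (oddChar N.1.inf) (oddChar N.1.sup)) :=
    fun N => lineHol_jac _ _
  by_cases hne : ∀ τ, jacD N τ = jacD N' τ
  · exact .inl hne
  · right
    push Not at hne
    obtain ⟨τ₀, h₀⟩ := hne
    intro τ
    have := LineHol.eq_zero_of_mul ((hL N).add (hL N')) ((hL N).sub (hL N')) (fun p q r hp => by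
      have := h (siegelMk p q r hp)
      rw [hN, hN] at this
      linear_combination this) (siegel_coords τ₀) (by
        simp only [jacD, jacobian_eq] at h₀
        exact sub_ne_zero.2 h₀) (siegel_coords τ)
    simp only [jacD, jacobian_eq]
    exact eq_neg_of_add_eq_zero_left this

/-- Functions equal up to sign have the same character under the five moves, and the characters
distinguish the fifteen pairs. -/
theorem eq_of_jacD_sq_eq {N N' : OddPair} (h : ∀ τ, jacD N τ ^ 2 = jacD N' τ ^ 2) : N = N' := by
  obtain ⟨τ₀, hτ₀⟩ := exists_thetaConst_ne_zero
  have h' : ∀ g, pairExp g N = pairExp g N' := by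
    intro g
    have key : ∀ c : ℂ, (∀ τ, jacD N τ = c * jacD N' τ) →
        sgn (pairExp g N) = sgn (pairExp g N') := by
      intro c hc
      have h1 := hc (move g τ₀)
      rw [jacD_move, jacD_move] at h1
      have h2 := hc τ₀
      refine mul_right_cancel₀ (jacD_ne_zero hτ₀ N) ?_
      rw [h1, h2]
      ring
    apply sgn_injective
    rcases eq_or_eq_neg_of_jacD_sq_eq h with h1 | h1
    · exact key 1 (by simpa using h1)
    · exact key (-1) (by simpa using h1)
  have hs : EvenMissing (({N, N'} : Multiset OddPair).map Subtype.val) :=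
    evenMissing_of_multExp fun g => by simp [multExp, h', CharTwo.add_self_eq_zero]
  exact eq_of_missing_add N N' fun v => by simpa using hs v

theorem existsUnique_pair {M : Finset EvenChar} (hM : M ∈ C4Minus) : ∃! N : OddPair, ∀ τ,
    jacD N τ ^ 2 = ∏ m ∈ M, thetaConst m τ ^ 2 := by
  obtain ⟨N, rfl⟩ := mem_C4Minus.1 hM
  exact ⟨N, jacD_sq N, fun N' h => eq_of_jacD_sq_eq fun τ => by rw [h, jacD_sq]⟩

theorem existsUnique_quadruple (N : OddPair) : ∃! M, M ∈ C4Minus ∧ ∀ τ,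
    jacD N τ ^ 2 = ∏ m ∈ M, thetaConst m τ ^ 2 := by
  refine ⟨pairSet N, ⟨mem_C4Minus.2 ⟨N, rfl⟩, jacD_sq N⟩, ?_⟩
  rintro M ⟨hM, h⟩
  obtain ⟨N', rfl⟩ := mem_C4Minus.1 hM
  rw [eq_of_jacD_sq_eq fun τ => (h τ).trans (jacD_sq N' τ).symm]

/-! ### Reduction of monomials -/

/-- The ideal generated by the system and by the relations among the theta constants. -/
def systemIdeal : Ideal RelRing := Ideal.span (rcSystem ∪ relationsTheta)

theorem systemIdeal_le : systemIdeal ≤ relations := by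
  refine Ideal.span_le.2 ?_
  rintro g (hg | hg)
  · obtain ⟨s, hs⟩ := Set.mem_iUnion.1 hg
    rcases hs with (((h | h) | h) | h) | h <;> exact h.1
  · exact hg.1

theorem monD_add (s t : Multiset OddPair) : monD (s + t) = monD s * monD t := by
  simp [monD]

theorem inTheta_monTheta (t : Multiset (Sym2 EvenChar)) :
    inTheta (t.map X).prod = monTheta t := by
  simp [inTheta, monTheta, map_multiset_prod]

theorem exists_binomial {s : Multiset OddPair} {g : RelRing} (hg : g ∈ rcAt s) :
    IsListed s ∧ g ∈ relations ∧ ∃ ε t, g = binomial s ε t := by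
  rw [isListed_iff]
  rcases hg with (((⟨h, hs, h'⟩ | ⟨h, hs, h'⟩) | ⟨h, hs, h'⟩) | ⟨h, hs, h'⟩) | ⟨h, hs, h'⟩
  · obtain ⟨a, b, c, d, -, h'⟩ := h'
    exact ⟨.inl hs, h, _, _, h'⟩
  · obtain ⟨ε, a, -, h'⟩ := h'
    exact ⟨.inr (.inl hs), h, _, _, h'⟩
  · obtain ⟨ε, a, -, h'⟩ := h'
    exact ⟨.inr (.inr (.inl hs)), h, _, _, h'⟩
  · obtain ⟨ε, a, h'⟩ := h'
    exact ⟨.inr (.inr (.inr (.inl hs))), h, _, _, h'⟩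
  · obtain ⟨ε, a, m, n, -, h'⟩ := h'
    exact ⟨.inr (.inr (.inr (.inr hs))), h, _, _, h'⟩

theorem IsListed.exists_mem_rcAt {s : Multiset OddPair} (h : IsListed s) : (rcAt s).Nonempty := by
  rcases isListed_iff.1 h with h | h | h | h | h
  · exact (rc1_nonempty h).mono fun _ h => .inl (.inl (.inl (.inl h)))
  · exact (rc2_nonempty h).mono fun _ h => .inl (.inl (.inl (.inr h)))
  · exact (rc3_nonempty h).mono fun _ h => .inl (.inl (.inr h))
  · exact (rc4_nonempty h).mono fun _ h => .inl (.inr h)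
  · exact (rc5_nonempty h).mono fun _ h => .inr h

/-- Removing a listed submultiset preserves the parity condition and lowers the degree. This
induction is why products of more than six determinants need no relations of their own. -/
theorem exists_sub_inTheta_mem {s : Multiset OddPair} (he : EvenMissing (s.map Subtype.val)) :
    ∃ P, monD s - inTheta P ∈ systemIdeal := by
  classical
  induction s using Multiset.strongInductionOn with
  | _ s ih =>
    by_cases h0 : s = 0
    · subst h0
      exact ⟨1, by simp [monD, inTheta]⟩
    · obtain ⟨s', hle, hl⟩ := exists_le_isListed h0 he
      obtain ⟨u, rfl⟩ := Multiset.le_iff_exists_add.1 hle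
      have hu : EvenMissing (u.map Subtype.val) := fun v => by
        have h1 := he v
        have h2 := hl.evenMissing v
        simp only [Multiset.map_add, Multiset.sum_add] at h1
        rwa [h2, zero_add] at h1
      have hlt : u < s' + u := lt_of_le_of_ne (Multiset.le_add_left _ _) fun h =>
        hl.ne_zero (by simpa using h)
      obtain ⟨P, hP⟩ := ih u hlt hu
      obtain ⟨g, hg⟩ := hl.exists_mem_rcAt
      obtain ⟨-, -, ε, t, rfl⟩ := exists_binomial hg
      have hg' : binomial s' ε t ∈ systemIdeal :=
        Ideal.subset_span (.inl (Set.mem_iUnion.2 ⟨s', hg⟩))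
      refine ⟨C ((ε : ℤ) : ℂ) * (t.map X).prod * P, ?_⟩
      -- Replace the listed factor by its right-hand side first, then the remaining factor by the
      -- polynomial from the induction.
      have e : monD (s' + u) - inTheta (C ((ε : ℤ) : ℂ) * (t.map X).prod * P) =
          monD u * binomial s' ε t + C ((ε : ℤ) : ℂ) * monTheta t * (monD u - inTheta P) := by
        have : inTheta (C ((ε : ℤ) : ℂ) * (t.map X).prod * P) =
            C ((ε : ℤ) : ℂ) * monTheta t * inTheta P := by
          rw [← inTheta_monTheta]
          simp only [inTheta, map_mul, rename_C]
        rw [this, monD_add, binomial]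
        ring
      rw [e]
      exact add_mem (Ideal.mul_mem_left _ _ hg') (Ideal.mul_mem_left _ _ hP)

theorem inTheta_mem {P : MvPolynomial (Sym2 EvenChar) ℂ} (h : inTheta P ∈ relations) :
    inTheta P ∈ systemIdeal :=
  Ideal.subset_span (.inr ⟨h, P, rfl⟩)

/-- The span of the monomials whose sign characters take prescribed values. -/
def isotypic (c : Fin 5 → ZMod 2) : Submodule ℂ RelRing :=
  Submodule.span ℂ {G | ∃ s t, (∀ g, multExp g s = c g) ∧ G = monD s * monTheta t}

theorem exists_sub_inTheta_mem_of_isotypic {G : RelRing} (hG : G ∈ isotypic 0) :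
    ∃ P, G - inTheta P ∈ systemIdeal := by
  induction hG using Submodule.span_induction with
  | mem G h =>
    obtain ⟨s, t, hs, rfl⟩ := h
    obtain ⟨P, hP⟩ := exists_sub_inTheta_mem (evenMissing_of_multExp hs)
    refine ⟨P * (t.map X).prod, ?_⟩
    have : inTheta (P * (t.map X).prod) = inTheta P * monTheta t := by
      rw [← inTheta_monTheta]
      simp only [inTheta, map_mul]
    rw [this, ← sub_mul]
    exact Ideal.mul_mem_right _ _ hP
  | zero => exact ⟨0, by simp [inTheta]⟩
  | add G H _ _ hG hH =>
    obtain ⟨P, hP⟩ := hG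
    obtain ⟨Q, hQ⟩ := hH
    refine ⟨P + Q, ?_⟩
    have : G + H - inTheta (P + Q) = (G - inTheta P) + (H - inTheta Q) := by
      simp only [inTheta, map_add]
      ring
    rw [this]
    exact add_mem hP hQ
  | smul a G _ hG =>
    obtain ⟨P, hP⟩ := hG
    refine ⟨a • P, ?_⟩
    have : a • G - inTheta (a • P) = a • (G - inTheta P) := by
      simp only [inTheta, map_smul, smul_sub]
    rw [this, MvPolynomial.smul_eq_C_mul]
    exact Ideal.mul_mem_left _ _ hP

/-- Modulo the system the element becomes a polynomial in the `θ_m² θ_n²`. Being congruent to a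
relation, this polynomial is itself one, hence a generator of the ideal. -/
theorem mem_systemIdeal_of_isotypic {G : RelRing} (h : G ∈ relations) (hG : G ∈ isotypic 0) :
    G ∈ systemIdeal := by
  obtain ⟨P, hP⟩ := exists_sub_inTheta_mem_of_isotypic hG
  have : inTheta P ∈ relations := by
    have := sub_mem h (systemIdeal_le hP)
    rwa [sub_sub_cancel] at this
  have := add_mem hP (inTheta_mem this)
  rwa [sub_add_cancel] at this

/-! ### Decomposition under the sign characters -/

theorem span_monomials : Submodule.span ℂ {G : RelRing | ∃ s t, G = monD s * monTheta t} = ⊤ := by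
  refine (Submodule.eq_top_iff').2 fun G => ?_
  induction G using MvPolynomial.induction_on with
  | C a =>
    have : (C a : RelRing) = a • (monD 0 * monTheta 0) := by
      simp [monD, monTheta, MvPolynomial.smul_eq_C_mul]
    rw [this]
    exact Submodule.smul_mem _ _ (Submodule.subset_span ⟨0, 0, rfl⟩)
  | add p q hp hq => exact add_mem hp hq
  | mul_X p i hp =>
    induction hp using Submodule.span_induction with
    | mem G h =>
      obtain ⟨s, t, rfl⟩ := h
      refine Submodule.subset_span ?_
      rcases i with N | e
      · exact ⟨N ::ₘ s, t, by simp [monD]; ring⟩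
      · exact ⟨s, e ::ₘ t, by simp [monTheta]; ring⟩
    | zero => simp
    | add G H _ _ hG hH => rw [add_mul]; exact add_mem hG hH
    | smul a G _ hG => rw [smul_mul_assoc]; exact Submodule.smul_mem _ _ hG

/-- The automorphism of the polynomial ring that corresponds to a move of the half-plane. -/
def flip (g : Fin 5) : RelRing →ₐ[ℂ] RelRing :=
  aeval (Sum.elim (fun N => C (sgn (pairExp g N)) * X (Sum.inl N)) fun e => X (Sum.inr e))

theorem flip_monD (g : Fin 5) (s : Multiset OddPair) :
    flip g (monD s) = C (sgn (multExp g s)) * monD s := by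
  induction s using Multiset.induction with
  | empty => simp [monD, multExp, sgn]
  | cons N s ih =>
    have h1 : monD (N ::ₘ s) = X (Sum.inl N) * monD s := by simp [monD]
    have h2 : multExp g (N ::ₘ s) = pairExp g N + multExp g s := by simp [multExp]
    rw [h1, h2, map_mul, ih, ← sgn_mul_sgn, C_mul]
    simp only [flip, aeval_X, Sum.elim_inl]
    ring

theorem flip_inTheta (g : Fin 5) (P : MvPolynomial (Sym2 EvenChar) ℂ) :
    flip g (inTheta P) = inTheta P := by
  have : (flip g).comp (rename Sum.inr) = rename Sum.inr :=
    MvPolynomial.algHom_ext fun e => by simp [flip]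
  exact DFunLike.congr_fun this P

theorem flip_monTheta (g : Fin 5) (t : Multiset (Sym2 EvenChar)) :
    flip g (monTheta t) = monTheta t := by
  rw [← inTheta_monTheta, flip_inTheta]

/-- Sign changes of the variables `X_N` thus correspond to points of the same half-plane; hence the
relations are stable under them and under the projections to components. -/
theorem substitution_flip (g : Fin 5) (G : RelRing) (τ : SiegelHalfPlane) :
    substitution (flip g G) τ = substitution G (move g τ) := by
  have : ((Pi.evalAlgHom ℂ (fun _ : SiegelHalfPlane => ℂ) τ).comp substitution).comp (flip g) =
      (Pi.evalAlgHom ℂ (fun _ : SiegelHalfPlane => ℂ) (move g τ)).comp substitution := by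
    refine MvPolynomial.algHom_ext fun i => ?_
    rcases i with N | e
    · simp [flip, substitution, jacD_move, ← algebraMap_eq]
    · simp [flip, substitution, thetaSq_move]
  exact DFunLike.congr_fun this G

/-- Projection to the elements on which `flip g` acts by the sign with exponent `x`. -/
def halfProj (g : Fin 5) (x : ZMod 2) : Module.End ℂ RelRing :=
  (1 / 2 : ℂ) • (1 + sgn x • (flip g).toLinearMap)

theorem halfProj_mon (g : Fin 5) (x : ZMod 2) (s : Multiset OddPair) (t : Multiset (Sym2 EvenChar)) :
    halfProj g x (monD s * monTheta t) =
      (if multExp g s = x then (1 : ℂ) else 0) • (monD s * monTheta t) := by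
  simp only [halfProj, LinearMap.smul_apply, LinearMap.add_apply, Module.End.one_apply,
    AlgHom.toLinearMap_apply, map_mul, flip_monD, flip_monTheta, ← MvPolynomial.smul_eq_C_mul,
    smul_mul_assoc, smul_add, smul_smul, ← add_smul]
  congr 1
  rw [mul_assoc, sgn_mul_sgn]
  rcases zmod_two_cases x with rfl | rfl <;>
    rcases zmod_two_cases (multExp g s) with h | h <;>
    norm_num [h, sgn, ZMod.val_one, CharTwo.add_self_eq_zero]

/-- Projection to an isotypic component. -/
def isoProj (c : Fin 5 → ZMod 2) : Module.End ℂ RelRing :=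
  halfProj 0 (c 0) * (halfProj 1 (c 1) * (halfProj 2 (c 2) * (halfProj 3 (c 3) * halfProj 4 (c 4))))

theorem isoProj_mon (c : Fin 5 → ZMod 2) (s : Multiset OddPair) (t : Multiset (Sym2 EvenChar)) :
    isoProj c (monD s * monTheta t) =
      if (fun g => multExp g s) = c then monD s * monTheta t else 0 := by
  simp only [isoProj, Module.End.mul_apply, halfProj_mon, map_smul, smul_smul]
  by_cases h : (fun g => multExp g s) = c
  · subst h
    simp
  · rw [if_neg h]
    obtain ⟨g, hg⟩ := Function.ne_iff.1 h
    refine smul_eq_zero_of_left ?_ _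
    fin_cases g <;> simp at hg <;> simp [hg]

theorem isoProj_mem_isotypic (c : Fin 5 → ZMod 2) (G : RelRing) : isoProj c G ∈ isotypic c := by
  have hG : G ∈ Submodule.span ℂ {G : RelRing | ∃ s t, G = monD s * monTheta t} := by
    rw [span_monomials]; trivial
  induction hG using Submodule.span_induction with
  | mem G h =>
    obtain ⟨s, t, rfl⟩ := h
    rw [isoProj_mon]
    split_ifs with h
    · exact Submodule.subset_span ⟨s, t, fun g => congrFun h g, rfl⟩
    · exact zero_mem _
  | zero => simp
  | add G H _ _ hG hH => rw [map_add]; exact add_mem hG hH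
  | smul a G _ hG => rw [map_smul]; exact Submodule.smul_mem _ _ hG

theorem sum_isoProj (G : RelRing) : ∑ c, isoProj c G = G := by
  have hG : G ∈ Submodule.span ℂ {G : RelRing | ∃ s t, G = monD s * monTheta t} := by
    rw [span_monomials]; trivial
  induction hG using Submodule.span_induction with
  | mem G h =>
    obtain ⟨s, t, rfl⟩ := h
    simp only [isoProj_mon, Finset.sum_ite_eq, Finset.mem_univ, if_true]
  | zero => simp
  | add G H _ _ hG hH => simp only [map_add, Finset.sum_add_distrib, hG, hH]
  | smul a G _ hG => simp only [map_smul, ← Finset.smul_sum, hG]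

theorem isoProj_mem {V : Submodule ℂ RelRing} (hV : ∀ g, ∀ G ∈ V, flip g G ∈ V)
    (c : Fin 5 → ZMod 2) {G : RelRing} (hG : G ∈ V) : isoProj c G ∈ V := by
  have h : ∀ g x, ∀ G ∈ V, halfProj g x G ∈ V := by
    intro g x G hG
    simp only [halfProj, LinearMap.smul_apply, LinearMap.add_apply, Module.End.one_apply,
      AlgHom.toLinearMap_apply]
    exact V.smul_mem _ (V.add_mem hG (V.smul_mem _ (hV g G hG)))
  simp only [isoProj, Module.End.mul_apply]
  exact h _ _ _ (h _ _ _ (h _ _ _ (h _ _ _ (h _ _ _ hG))))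

/-! ### Generation -/

theorem flip_mem_relations (g : Fin 5) {G : RelRing} (h : G ∈ relations) : flip g G ∈ relations := by
  rw [mem_relations] at h ⊢
  intro τ
  rw [substitution_flip, h]

theorem flip_inD (g : Fin 5) (F : MvPolynomial OddPair ℂ) : ∃ F', flip g (inD F) = inD F' := by
  refine ⟨aeval (fun N => C (sgn (pairExp g N)) * X N) F, ?_⟩
  have : (flip g).comp (rename Sum.inl) =
      (rename Sum.inl).comp (aeval fun N => C (sgn (pairExp g N)) * X N) :=
    MvPolynomial.algHom_ext fun N => by simp [flip]
  exact DFunLike.congr_fun this F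

/-- The relations of the form `F(D) = P(θ²θ²)`. -/
def separatedRelations : Submodule ℂ RelRing where
  carrier := {G | G ∈ relations ∧ ∃ F P, G = inD F - inTheta P}
  add_mem' := by
    rintro _ _ ⟨h, F, P, rfl⟩ ⟨h', F', P', rfl⟩
    refine ⟨add_mem h h', F + F', P + P', ?_⟩
    simp only [inD, inTheta, map_add]
    ring
  zero_mem' := ⟨zero_mem _, 0, 0, by simp [inD, inTheta]⟩
  smul_mem' := by
    rintro a _ ⟨h, F, P, rfl⟩
    refine ⟨?_, a • F, a • P, ?_⟩
    · rw [MvPolynomial.smul_eq_C_mul]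
      exact Ideal.mul_mem_left _ _ h
    · simp only [inD, inTheta, map_smul, smul_sub]

/-- Setting the variables of the functions `D(N)` to zero. -/
def killD : RelRing →ₐ[ℂ] RelRing := aeval (Sum.elim (fun _ => 0) fun e => X (Sum.inr e))

theorem killD_monD {s : Multiset OddPair} (h : s ≠ 0) : killD (monD s) = 0 := by
  obtain ⟨N, hN⟩ := Multiset.exists_mem_of_ne_zero h
  obtain ⟨s', rfl⟩ := Multiset.exists_cons_of_mem hN
  simp [monD, killD]

theorem killD_inD (F : MvPolynomial OddPair ℂ) : ∃ a : ℂ, killD (inD F) = inTheta (C a) := by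
  refine ⟨aeval (fun _ => 0) F, ?_⟩
  have : killD.comp (rename Sum.inl) = (Algebra.ofId ℂ RelRing).comp (aeval fun _ => 0) :=
    MvPolynomial.algHom_ext fun N => by simp [killD]
  rw [inTheta, rename_C]
  exact DFunLike.congr_fun this F

theorem killD_inTheta (P : MvPolynomial (Sym2 EvenChar) ℂ) : killD (inTheta P) = inTheta P := by
  have : killD.comp (rename Sum.inr) = rename Sum.inr :=
    MvPolynomial.algHom_ext fun e => by simp [killD]
  exact DFunLike.congr_fun this P

theorem killD_isotypic {c : Fin 5 → ZMod 2} (hc : c ≠ 0) {G : RelRing} (hG : G ∈ isotypic c) :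
    killD G = 0 := by
  induction hG using Submodule.span_induction with
  | mem G h =>
    obtain ⟨s, t, hs, rfl⟩ := h
    rw [map_mul, killD_monD, zero_mul]
    rintro rfl
    exact hc (funext fun g => by rw [← hs g]; simp [multExp])
  | zero => simp
  | add G H _ _ hG hH => rw [map_add, hG, hH, add_zero]
  | smul a G _ hG => rw [map_smul, hG, smul_zero]

/-- The invariant component lies in the ideal of the system. Every other component again has the
form `F'(D) - P'`, but all its monomials contain some `X_N`; hence `P'` is constant and the
component is a relation among the `D(N)`. -/
theorem mem_span_of_separated {F : MvPolynomial OddPair ℂ} {P : MvPolynomial (Sym2 EvenChar) ℂ}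
    (h : inD F - inTheta P ∈ relations) :
    inD F - inTheta P ∈ Ideal.span (rcSystem ∪ relationsD ∪ relationsTheta) := by
  have hV : inD F - inTheta P ∈ separatedRelations := ⟨h, F, P, rfl⟩
  rw [← sum_isoProj (inD F - inTheta P)]
  refine sum_mem fun c _ => ?_
  have hmem := isoProj_mem_isotypic c (inD F - inTheta P)
  obtain ⟨hr, F', P', he⟩ := isoProj_mem (V := separatedRelations) (by
    rintro g _ ⟨h, F, P, rfl⟩
    obtain ⟨F', hF'⟩ := flip_inD g F
    exact ⟨flip_mem_relations g h, F', P, by rw [map_sub, hF', flip_inTheta]⟩) c hV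
  by_cases hc : c = 0
  · subst hc
    refine Ideal.span_mono ?_ (mem_systemIdeal_of_isotypic hr hmem)
    exact Set.union_subset_union_left _ Set.subset_union_left
  · obtain ⟨a, ha⟩ := killD_inD F'
    have h0 := killD_isotypic hc hmem
    -- Setting all `X_N` to zero leaves the constant term of `F'` minus `P'`, so these two agree.
    rw [he, map_sub, ha, killD_inTheta] at h0
    refine Ideal.subset_span (.inl (.inr ⟨hr, F' - C a, ?_⟩))
    rw [he, ← sub_eq_zero.1 h0, inD, inD, inTheta, map_sub, rename_C, rename_C]

/-- A move leaves the theta side fixed and multiplies the monomial by a sign; comparison at a point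
where the monomial is nonzero forces the sign to be one. -/
theorem multExp_eq_zero_of_monomial {s : Multiset OddPair} {P : MvPolynomial (Sym2 EvenChar) ℂ}
    (h : monD s - inTheta P ∈ relations) (g : Fin 5) : multExp g s = 0 := by
  obtain ⟨τ, hτ⟩ := exists_thetaConst_ne_zero
  rw [mem_relations] at h
  have h1 := h τ
  have h2 := h (move g τ)
  rw [← substitution_flip, map_sub, flip_inTheta, flip_monD] at h2
  rw [map_sub, Pi.sub_apply] at h1 h2
  rw [map_mul, Pi.mul_apply, ← algebraMap_eq, AlgHom.commutes] at h2
  have hne : substitution (monD s) τ ≠ 0 := by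
    rw [substitution_monD]
    exact Multiset.prod_ne_zero fun h => by
      obtain ⟨N, -, hN⟩ := Multiset.mem_map.1 h
      exact jacD_ne_zero hτ N hN
  apply sgn_injective
  refine mul_right_cancel₀ hne ?_
  have h3 : sgn (multExp g s) * substitution (monD s) τ - substitution (inTheta P) τ = 0 := h2
  have h4 : sgn 0 = 1 := by simp [sgn]
  rw [h4]
  linear_combination h3 - h1

theorem mem_span_of_monomial {s : Multiset OddPair} {P : MvPolynomial (Sym2 EvenChar) ℂ}
    (h : monD s - inTheta P ∈ relations) : monD s - inTheta P ∈ systemIdeal := by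
  obtain ⟨Q, hQ⟩ := exists_sub_inTheta_mem
    (evenMissing_of_multExp (multExp_eq_zero_of_monomial h))
  have e : monD s - inTheta P = (monD s - inTheta Q) + inTheta (Q - P) := by
    rw [inTheta, inTheta, inTheta, map_sub]
    ring
  rw [e] at h ⊢
  refine add_mem hQ (inTheta_mem ?_)
  have := sub_mem h (systemIdeal_le hQ)
  rwa [add_sub_cancel_left] at this

/-- Sign characters have order two, so multiplying a component by a monomial of the same character
makes it invariant. A component whose character belongs to no monomial is zero. -/
theorem exists_monD_mul_mem {G : RelRing} (h : G ∈ relations) :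
    ∃ s, monD s * G ∈ systemIdeal := by
  classical
  have hV : ∀ g, ∀ G ∈ relations.restrictScalars ℂ, flip g G ∈ relations.restrictScalars ℂ :=
    fun g G hG => flip_mem_relations g hG
  have key : ∀ c, ∃ s, monD s * isoProj c G ∈ systemIdeal := by
    intro c
    have hr : isoProj c G ∈ relations := isoProj_mem hV c h
    by_cases hc : ∃ s, ∀ g, multExp g s = c g
    · obtain ⟨s, hs⟩ := hc
      refine ⟨s, mem_systemIdeal_of_isotypic (Ideal.mul_mem_left _ _ hr) ?_⟩
      have hmem := isoProj_mem_isotypic c G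
      generalize isoProj c G = H at hmem
      induction hmem using Submodule.span_induction with
      | mem G h =>
        obtain ⟨s', t, hs', rfl⟩ := h
        refine Submodule.subset_span ⟨s + s', t, fun g => ?_, by rw [monD_add, mul_assoc]⟩
        have : multExp g (s + s') = multExp g s + multExp g s' := by simp [multExp]
        rw [this, hs, hs', CharTwo.add_self_eq_zero, Pi.zero_apply]
      | zero => simp
      | add G H _ _ hG hH => rw [mul_add]; exact add_mem hG hH
      | smul a G _ hG => rw [mul_smul_comm]; exact Submodule.smul_mem _ _ hG
    · refine ⟨0, ?_⟩
      have hmem := isoProj_mem_isotypic c G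
      have : isotypic c = ⊥ := by
        rw [isotypic, Submodule.span_eq_bot]
        rintro _ ⟨s, t, hs, -⟩
        exact absurd ⟨s, hs⟩ hc
      rw [this, Submodule.mem_bot] at hmem
      rw [hmem, mul_zero]
      exact zero_mem _
  choose s hs using key
  refine ⟨∑ c, s c, ?_⟩
  have e : monD (∑ c, s c) * G = ∑ c, monD (∑ c, s c) * isoProj c G := by
    rw [← Finset.mul_sum, sum_isoProj]
  rw [e]
  refine sum_mem fun c _ => ?_
  -- The product of the monomials chosen for all characters contains the one that suits `c`.
  rw [← Finset.sum_erase_add _ _ (Finset.mem_univ c), monD_add, mul_assoc]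
  exact Ideal.mul_mem_left _ _ (hs c)

/-! ### Independence -/

/-- Points of the half-plane that approach a cusp. -/
def cuspPoint (n : ℕ) : SiegelHalfPlane :=
  siegelMk _ _ _ (inSiegel_imag (t := (n : ℝ) + 1) (x := 1) (y := -1 / 4) (z := 1) (by positivity)
    one_pos (by norm_num))

/-- The values of the theta constants at the cusp. -/
def cuspValue (m : Characteristic) : ℂ := if m.1 = 0 then 1 else 0

/-- The values of the functions `θ_m² θ_n²` at the cusp. -/
def cuspSq : Sym2 EvenChar → ℂ :=
  Sym2.lift ⟨fun m n => cuspValue m ^ 2 * cuspValue n ^ 2, fun _ _ => mul_comm _ _⟩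

open Filter Topology in
theorem tendsto_thetaConst {m : Characteristic} (hm : IsEven m) :
    Tendsto (fun n => thetaConst m (cuspPoint n)) atTop (𝓝 (cuspValue m)) := by
  have h := (tendsto_tc_cusp hm).comp
    (tendsto_atTop_add_const_right atTop (1 : ℝ) tendsto_natCast_atTop_atTop)
  refine h.congr fun n => ?_
  rw [cuspPoint, thetaConst_siegelMk]
  rfl

open Filter Topology in
theorem tendsto_thetaSq (e : Sym2 EvenChar) :
    Tendsto (fun n => thetaSq e (cuspPoint n)) atTop (𝓝 (cuspSq e)) := by
  induction e using Sym2.ind with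
  | _ m n => exact ((tendsto_thetaConst m.2).pow 2).mul ((tendsto_thetaConst n.2).pow 2)

/-- Three even characteristics with `m' = 0` would have an even sum, which is excluded in these
quadruples. Consequently every `D(N)` vanishes at the cusp. -/
theorem exists_fst_ne_zero : ∀ N : OddPair, ∃ m ∈ pairSet N, m.1.1 ≠ 0 := by
  decide +kernel

open Filter Topology in
theorem tendsto_jacD (N : OddPair) : Tendsto (fun n => jacD N (cuspPoint n)) atTop (𝓝 0) := by
  have h := (tendsto_finsetProd (pairSet N) fun m _ => tendsto_thetaConst m.2).const_mul
    ((pairSign N : ℤ) : ℂ)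
  obtain ⟨m, hm, hm'⟩ := exists_fst_ne_zero N
  rw [Finset.prod_eq_zero hm (by simp [cuspValue, hm']), mul_zero] at h
  refine h.congr fun n => ?_
  rw [jacD_eq, pairProd_eq_prod]

/-- Specialisation of the variables of the `θ_m² θ_n²` to their values at the cusp. -/
def specialize : RelRing →ₐ[ℂ] MvPolynomial OddPair ℂ :=
  aeval (Sum.elim X fun e => C (cuspSq e))

theorem specialize_monD (s : Multiset OddPair) :
    specialize (monD s) = monomial (Multiset.toFinsupp s) 1 := by
  induction s using Multiset.induction with
  | empty => simp [monD]
  | cons N s ih =>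
    have h : monD (N ::ₘ s) = X (Sum.inl N) * monD s := by simp [monD]
    rw [h, map_mul, ih, ← Multiset.singleton_add, map_add, Multiset.toFinsupp_singleton]
    have hX : specialize (X (Sum.inl N)) = monomial (Finsupp.single N 1) 1 := by
      rw [specialize, aeval_X]
      rfl
    rw [hX, monomial_mul, one_mul]

theorem specialize_monTheta (t : Multiset (Sym2 EvenChar)) :
    specialize (monTheta t) = C (t.map cuspSq).prod := by
  induction t using Multiset.induction with
  | empty => simp [monTheta]
  | cons e t ih =>
    have h : monTheta (e ::ₘ t) = X (Sum.inr e) * monTheta t := by simp [monTheta]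
    rw [h, map_mul, ih]
    simp [specialize]

-- A relation among the `θ_m² θ_n²` holds at every point of the sequence and therefore, by
-- continuity of polynomials, for the limiting values.
open Filter Topology in
theorem specialize_inTheta {P : MvPolynomial (Sym2 EvenChar) ℂ} (h : inTheta P ∈ relations) :
    specialize (inTheta P) = 0 := by
  have h1 : specialize (inTheta P) = C (eval cuspSq P) := by
    have : specialize.comp (rename Sum.inr) = (Algebra.ofId ℂ (MvPolynomial OddPair ℂ)).comp
        (aeval cuspSq) := MvPolynomial.algHom_ext fun e => by
      simp [specialize]
    exact DFunLike.congr_fun this P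
  have h2 : ∀ τ, eval (fun e => thetaSq e τ) P = 0 := by
    intro τ
    have : ((Pi.evalAlgHom ℂ (fun _ : SiegelHalfPlane => ℂ) τ).comp substitution).comp
        (rename Sum.inr) = aeval fun e => thetaSq e τ :=
      MvPolynomial.algHom_ext fun e => by simp [substitution]
    exact (DFunLike.congr_fun this P).symm.trans (mem_relations.1 h τ)
  have h3 : Tendsto (fun n e => thetaSq e (cuspPoint n)) atTop (𝓝 cuspSq) :=
    tendsto_pi_nhds.2 tendsto_thetaSq
  have h4 := ((MvPolynomial.continuous_eval P).tendsto cuspSq).comp h3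
  have h5 : eval cuspSq P = 0 :=
    tendsto_nhds_unique h4 (tendsto_const_nhds.congr fun n => (h2 _).symm)
  rw [h1, h5, C_0]

-- The left-hand product tends to zero at the cusp, so the theta product has limit zero and only the
-- left-hand monomial survives.
open Filter Topology in
theorem specialize_mem_rcAt {s : Multiset OddPair} {g : RelRing} (hg : g ∈ rcAt s) :
    specialize g = monomial (Multiset.toFinsupp s) 1 := by
  obtain ⟨hl, hr, ε, t, rfl⟩ := exists_binomial hg
  rw [binomial_mem_relations] at hr
  have h1 : Tendsto (fun n => (s.map fun N => jacD N (cuspPoint n)).prod) atTop (𝓝 0) := by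
    have := tendsto_multiset_prod s fun N _ => tendsto_jacD N
    obtain ⟨N, hN⟩ := Multiset.exists_mem_of_ne_zero hl.ne_zero
    rwa [Multiset.prod_eq_zero (Multiset.mem_map.2 ⟨N, hN, rfl⟩)] at this
  have h2 : Tendsto (fun n => ((ε : ℤ) : ℂ) * (t.map fun e => thetaSq e (cuspPoint n)).prod) atTop
      (𝓝 (((ε : ℤ) : ℂ) * (t.map cuspSq).prod)) :=
    (tendsto_multiset_prod t fun e _ => tendsto_thetaSq e).const_mul _
  have h3 := tendsto_nhds_unique h1 (h2.congr fun n => (hr _).symm)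
  have h4 : (t.map cuspSq).prod = 0 :=
    (mul_eq_zero.1 h3.symm).resolve_left (Int.cast_ne_zero.2 (Units.ne_zero _))
  rw [binomial, map_sub, map_mul, specialize_monD, specialize_monTheta, h4, C_0, mul_zero, sub_zero]

/-- After specialisation, membership would put one listed monomial into the ideal of the others. For
monomial ideals this means divisibility, contrary to minimality. -/
theorem not_mem_span_of_mem_rcAt {s : Multiset OddPair} {g : RelRing} (hg : g ∈ rcAt s) :
    g ∉ Ideal.span ((⋃ s' ∈ {s' | s' ≠ s}, rcAt s') ∪ relationsTheta) := by
  intro h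
  have hle : Ideal.span ((⋃ s' ∈ {s' | s' ≠ s}, rcAt s') ∪ relationsTheta) ≤
      (Ideal.span ((fun u => monomial u (1 : ℂ)) ''
        (Multiset.toFinsupp '' {s' | s' ≠ s ∧ IsListed s'}))).comap specialize := by
    refine Ideal.span_le.2 ?_
    rintro g' (hg' | ⟨hr, P, rfl⟩) <;> rw [SetLike.mem_coe, Ideal.mem_comap]
    · obtain ⟨s', hs', hg'⟩ := Set.mem_iUnion₂.1 hg'
      rw [specialize_mem_rcAt hg']
      exact Ideal.subset_span ⟨_, ⟨s', ⟨hs', (exists_binomial hg').1⟩, rfl⟩, rfl⟩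
    · rw [specialize_inTheta hr]
      exact zero_mem _
  have h' := hle h
  rw [Ideal.mem_comap, specialize_mem_rcAt hg, mem_ideal_span_monomial_image] at h'
  obtain ⟨_, ⟨s', ⟨hne, hl⟩, rfl⟩, hs'⟩ := h' (Multiset.toFinsupp s) (by simp [mem_support_iff])
  have hs'' : s' ≤ s := Multiset.le_iff_count.2 fun N => hs' N
  exact hne ((exists_binomial hg).1.eq_of_le hs'' hl.ne_zero hl.evenMissing)

end ThetaGenusTwo

end

theorem mainTheorem10 :
    -- the fifteen relations of the first kind are indexed by `C₄⁻`, bijectively with the `D(N)`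
    (∀ M ∈ ThetaGenusTwo.C4Minus, ∃! N : ThetaGenusTwo.OddPair, ∀ τ,
      ThetaGenusTwo.jacD N τ ^ 2 = ∏ m ∈ M, ThetaGenusTwo.thetaConst m τ ^ 2) ∧
    (∀ N : ThetaGenusTwo.OddPair, ∃! M, M ∈ ThetaGenusTwo.C4Minus ∧ ∀ τ,
      ThetaGenusTwo.jacD N τ ^ 2 = ∏ m ∈ M, ThetaGenusTwo.thetaConst m τ ^ 2) ∧
    -- every product of the listed kinds does satisfy a relation of the stated form
    (∀ s, ThetaGenusTwo.IsSquare s → (ThetaGenusTwo.rc1 s).Nonempty) ∧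
    (∀ s, ThetaGenusTwo.IsProduct3 s → (ThetaGenusTwo.rc2 s).Nonempty) ∧
    (∀ s, ThetaGenusTwo.IsProduct4 s → (ThetaGenusTwo.rc3 s).Nonempty) ∧
    (∀ s, ThetaGenusTwo.IsProduct5 s → (ThetaGenusTwo.rc4 s).Nonempty) ∧
    (∀ s, ThetaGenusTwo.IsProduct6 s → (ThetaGenusTwo.rc5 s).Nonempty) ∧
    -- generation: every relation `F(D) = P(θ²θ²)`
    (∀ (F : MvPolynomial ThetaGenusTwo.OddPair ℂ)
        (P : MvPolynomial (Sym2 ThetaGenusTwo.EvenChar) ℂ),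
      ThetaGenusTwo.inD F - ThetaGenusTwo.inTheta P ∈ ThetaGenusTwo.relations →
      ThetaGenusTwo.inD F - ThetaGenusTwo.inTheta P ∈
        Ideal.span (ThetaGenusTwo.rcSystem ∪ ThetaGenusTwo.relationsD ∪
          ThetaGenusTwo.relationsTheta)) ∧
    -- generation: products of any number of determinants, in particular of more than six
    (∀ (s : Multiset ThetaGenusTwo.OddPair) (P : MvPolynomial (Sym2 ThetaGenusTwo.EvenChar) ℂ),
      ThetaGenusTwo.monD s - ThetaGenusTwo.inTheta P ∈ ThetaGenusTwo.relations →
      ThetaGenusTwo.monD s - ThetaGenusTwo.inTheta P ∈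
        Ideal.span (ThetaGenusTwo.rcSystem ∪ ThetaGenusTwo.relationsTheta)) ∧
    -- generation: arbitrary relations, up to multiplication by a monomial in the determinants
    (∀ G ∈ ThetaGenusTwo.relations, ∃ s : Multiset ThetaGenusTwo.OddPair,
      ThetaGenusTwo.monD s * G ∈
        Ideal.span (ThetaGenusTwo.rcSystem ∪ ThetaGenusTwo.relationsTheta)) ∧
    -- independence: no relation of the system follows from those with other left-hand sides
    (∀ s, ∀ g ∈ ThetaGenusTwo.rcAt s,
      g ∉ Ideal.span ((⋃ s' ∈ {s' | s' ≠ s}, ThetaGenusTwo.rcAt s') ∪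
        ThetaGenusTwo.relationsTheta)) := by
  open ThetaGenusTwo in
  exact ⟨fun _ hM => existsUnique_pair hM, existsUnique_quadruple, fun _ => rc1_nonempty,
    fun _ => rc2_nonempty, fun _ => rc3_nonempty, fun _ => rc4_nonempty, fun _ => rc5_nonempty,
    fun _ _ => mem_span_of_separated, fun _ _ => mem_span_of_monomial,
    fun _ => exists_monD_mul_mem, fun _ _ => not_mem_span_of_mem_rcAt⟩
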